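/- Throughout, $n$ is a positive integer and $[n]=\{1,\dots,n\}$. A composition of $n$ is a finite sequence $\alpha=(\alpha_1,\dots,\alpha_k)$ of positive integers with sum $n$; its reverse is $\alpha^{\mathrm{rev}}=(\alpha_k,\dots,\alpha_1)$. It is a \emph{peak composition} if all its parts except possibly the last are greater than $1$. A composition $\beta$ refines $\alpha$ if $\alpha$ is obtained by summing consecutive parts of $\beta$. Put $\mathrm{set}(\alpha)=\{\alpha_1,\alpha_1+\alpha_2,\dots,\alpha_1+\cdots+\alpha_{k-1}\}\subseteq[n-1]$, and let $\mathrm{comp}_n$ be the inverse of $\alpha\mapsto\mathrm{set}(\alpha)$. For $X\subseteq[n]$ let $\mathrm{Peak}(X)=\{i\in X: i-1\notin X,\ i\ne 1\}$. In $\mathbb{C}[[x_1,x_2,\dots]]$ let $M_\alpha=\sum_{i_1<\cdots<i_k}x_{i_1}^{\alpha_1}\cdots x_{i_k}^{\alpha_k}$, let $F_\alpha=\sum_{\beta\text{ refines }\alpha}M_\beta$, and, for a peak composition $\alpha$ of $n$ with $P=\mathrm{Peak}(\mathrm{set}(\alpha))$, let $$K_\alpha=2^{|P|+1}\sum_{\beta}F_\beta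 ,$$ where $\beta$ runs over the compositions of $n$ with $P\subseteq\mathrm{set}(\beta)\,\triangle\,(\mathrm{set}(\beta)+1)$. The diagram $D_\alpha$ of $\alpha$ consists of the boxes $(c,r)$ (column $c$, row $r$) with $1\le r\le k$ and $1\le c\le\alpha_r$; rows are numbered from bottom to top, columns from left to right. A filling of shape $\alpha$ is a function $T$ on $D_\alpha$; it is standard if it is a bijection onto $[n]$. \emph{Quasisymmetric Schur $Q$-functions.} For a peak composition $\alpha$ of $n$, a marked peak composition tableau of shape $\alpha$ is a filling $T$ of $D_\alpha$ with entries from $1'<1<2'<2<\cdots$ such that: (1) entries weakly increase from left to right in each row, and no marked entry is repeated in a row; (2) entries strictly increase from bottom to top in the first column; (3) for each $k\le n$ the boxes with entries in $\{1',1,\dots,k',k\}$ form the diagram of a peak composition; (4) if $T(2,r)$ is an unmarked $i$, then $T(1,r+1)$ is neither $i$ nor $i'$. Its weight $\mathrm{wt}(T)$ is the sequence whose $i$th term is the number of entries equal to $i$ or $i'$. Let $\mathrm{MPCT}(\alpha)$ be the set of those $T$ whose weight has no zero to the left of a nonzero term, so that $\mathrm{wt}(T)$, with its trailing zeros omitted,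 is a composition of $n$. Then $$\tilde Q_\alpha=\sum_{T\in\mathrm{MPCT}(\alpha)}M_{\mathrm{wt}(T)}.$$ \emph{Peak Young quasisymmetric Schur functions.} For a peak composition $\beta$ of $n$, let $\mathrm{SPYCT}(\beta)$ be the set of standard fillings $T$ of shape $\beta$ such that: (1) entries increase from left to right in each row; (2) entries increase from bottom to top in the first column; (3) for each $k\le n$ the boxes with entries at most $k$ form the diagram of a peak composition; (4) if $T(c,r)<T(c+1,r')$ with $r'<r$, then $(c+1,r)\in D_\beta$ and $T(c+1,r)<T(c+1,r')$. Let $\mathrm{Des}_{\leftarrow}(T)$ be the set of $i\in[n-1]$ such that $i+1$ is weakly left of $i$ in $T$. Then $$\tilde S_\beta=\sum_{T\in\mathrm{SPYCT}(\beta)}K_{\mathrm{comp}_n(\mathrm{Peak}(\mathrm{Des}_{\leftarrow}(T)))}.$$ \emph{Dual immaculate recording tableaux.} A row strip of length $j$ of a standard filling $Q$ is a maximal sequence $a,a+1,\dots,a+j-1$ of consecutive entries in which each entry after the first is strictly right of the preceding one. A dual immaculate recording tableau (DIRT) of shape $\beta$ is a standard filling $Q$ of shape $\beta$ such that: (1)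 entries increase from left to right in each row; (2) every row strip starts in the first column; (3) entries in the first column increase from top to bottom; (4) if $Q(c,r)>Q(c,r')$ with $r'<r$, then $(c+1,r')\in D_\beta$ and $Q(c,r)>Q(c+1,r')$. Its row strip shape is the composition $\gamma$ of $n$ such that, for every $i$, the row strip that starts with $\gamma_1+\cdots+\gamma_{i-1}+1$ has length $\gamma_i$. **Theorem.** Let $n\ge 1$ and let $\alpha$ be a peak composition of $n$. Then $$\tilde Q_\alpha=\sum_{\beta}c_{\alpha,\beta}\,\tilde S_\beta ,$$ where the sum is over all peak compositions $\beta$ of $n$, and $c_{\alpha,\beta}$ is the number of DIRTs of shape $\beta$ with row strip shape $\alpha^{\mathrm{rev}}$. In particular, all the coefficients $c_{\alpha,\beta}$ are nonnegative integers. -/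

import Mathlib

namespace PeakExpansion

/-! ### Compositions -/

/-- A peak composition: all parts except possibly the last one are greater than `1`. -/
def IsPeak {n : ℕ} (α : Composition n) : Prop :=
  ∀ x ∈ α.blocks.dropLast, 1 < x

instance {n : ℕ} (α : Composition n) : Decidable (IsPeak α) :=
  inferInstanceAs (Decidable (∀ x ∈ α.blocks.dropLast, 1 < x))

/-- `β` refines `α`: the parts of `α` are the sums of consecutive runs of parts of `β`. -/
def Refines {n : ℕ} (β α : Composition n) : Prop :=
  ∃ L : List (List ℕ), L.flatten = β.blocks ∧ L.map List.sum = α.blocks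

/-- `set(α) = {α₁, α₁ + α₂, …, α₁ + ⋯ + α_{k-1}}`. -/
def partialSums {n : ℕ} (α : Composition n) : Finset ℕ :=
  (Finset.Ioo 0 α.length).image α.sizeUpTo

/-- The composition `comp_n(X) = (x₁, x₂ - x₁, …, n - x_r)` of `n`, for a subset
`X = {x₁ < ⋯ < x_r}` of `{1, …, n - 1}`: its blocks end at the elements of `X` and at `n`.
(Elements of `X` outside `{1, …, n - 1}` have no effect.) -/
def compOfSet (n : ℕ) (X : Finset ℕ) : Composition n :=
  CompositionAsSet.toComposition
    { boundaries := Finset.univ.filter fun i : Fin (n + 1) => i = 0 ∨ i = Fin.last n ∨ (i : ℕ) ∈ X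
      zero_mem := by simp
      getLast_mem := by simp }

/-- The peak set `{i ∈ X : i - 1 ∉ X and i ≠ 1}` of a set `X` of positive integers. -/
def peakSet (X : Finset ℕ) : Finset ℕ :=
  X.filter fun i => i - 1 ∉ X ∧ i ≠ 1

/-! ### Quasisymmetric functions, as power series in `x₁, x₂, …` over `ℂ`
(the index `i : ℕ` stands for the variable `x_{i+1}`) -/

/-- The monomial quasisymmetric function `M_α`: the sum of `x_{i₁}^{α₁} ⋯ x_{i_k}^{α_k}` over all
`i₁ < ⋯ < i_k`. The coefficient of the monomial with exponent vector `m` is the number of sequences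
`i₁ < ⋯ < i_k` that give this monomial. -/
noncomputable def monomialQS {n : ℕ} (α : Composition n) : MvPowerSeries ℕ ℂ :=
  fun m => (Nat.card {i : Fin α.length → ℕ //
    StrictMono i ∧ ∑ j, Finsupp.single (i j) (α.blocksFun j) = m} : ℂ)

open scoped Classical in
/-- The fundamental quasisymmetric function `F_α`. -/
noncomputable def fundamentalQS {n : ℕ} (α : Composition n) : MvPowerSeries ℕ ℂ :=
  ∑ β : Composition n with Refines β α, monomialQS β

/-- The peak function `K_α`, given for all compositions by the formula that defines it for peak
compositions. -/
noncomputable def peakFunction {n : ℕ} (α : Composition n) : MvPowerSeries ℕ ℂ :=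
  (2 : ℂ) ^ ((peakSet (partialSums α)).card + 1) •
    ∑ β : Composition n with peakSet (partialSums α) ⊆
        symmDiff (partialSums β) ((partialSums β).image (· + 1)),
      fundamentalQS β

/-! ### Diagrams and fillings -/

/-- The diagram of `α`: the boxes `(c, r)` (column `c`, row `r`, both counted from `1`, rows counted
from the bottom) such that row `r` is left-justified and has `α_r` boxes. -/
def diagram {n : ℕ} (α : Composition n) : Finset (ℕ × ℕ) :=
  Finset.univ.biUnion fun i : Fin α.length => Finset.Icc 1 (α.blocksFun i) ×ˢ {(i : ℕ) + 1}

/-- The boxes of the diagram of `α`, as a type. -/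
abbrev Box {n : ℕ} (α : Composition n) : Type := {b : ℕ × ℕ // b ∈ diagram α}

/-- The column of a box. -/
abbrev Box.col {n : ℕ} {α : Composition n} (b : Box α) : ℕ := b.1.1

/-- The row of a box. -/
abbrev Box.row {n : ℕ} {α : Composition n} (b : Box α) : ℕ := b.1.2

/-- Fillings of the diagram of `α` with entries from `X`. -/
abbrev Filling {n : ℕ} (α : Composition n) (X : Type) : Type := Box α → X

/-- The set `[n] = {1, …, n}`, as a type. -/
abbrev Entry (n : ℕ) : Type := {i : ℕ // i ∈ Finset.Icc 1 n}

/-- A set of boxes is the diagram of a peak composition (of some number `m`). -/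
def IsPeakDiagram (B : Finset (ℕ × ℕ)) : Prop :=
  ∃ (m : ℕ) (γ : Composition m), IsPeak γ ∧ diagram γ = B

theorem card_box {n : ℕ} (α : Composition n) : Fintype.card (Box α) = n := by
  rw [Fintype.card_coe, diagram, Finset.card_biUnion]
  · simp [α.sum_blocksFun]
  · intro i _ j _ hij
    rw [Function.onFun, Finset.disjoint_left]
    rintro ⟨c, r⟩ h₁ h₂
    simp only [Finset.mem_product, Finset.mem_singleton] at h₁ h₂
    exact hij (Fin.ext (by omega))

/-! ### Quasisymmetric Schur `Q`-functions -/

/-- The marked alphabet `1' < 1 < 2' < 2 < ⋯ < n' < n`: the pair `(i, false)` stands for the marked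
entry `i'` and the pair `(i, true)` for the unmarked entry `i`; the order is lexicographic. -/
abbrev MarkedEntry (n : ℕ) : Type := Entry n ×ₗ Bool

/-- The integer `i` underlying the entry `i` or `i'`. -/
def MarkedEntry.val {n : ℕ} (x : MarkedEntry n) : ℕ := ((ofLex x).1 : ℕ)

/-- The entry is marked. -/
def MarkedEntry.IsMarked {n : ℕ} (x : MarkedEntry n) : Prop := (ofLex x).2 = false

/-- Marked peak composition tableaux. -/
structure IsMPCT {n : ℕ} {α : Composition n} (T : Filling α (MarkedEntry n)) : Prop where
  row_weak : ∀ b b' : Box α, b.row = b'.row → b.col < b'.col → T b ≤ T b'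
  row_marked : ∀ b b' : Box α, b.row = b'.row → b.col < b'.col → (T b).IsMarked → T b ≠ T b'
  first_col : ∀ b b' : Box α, b.col = 1 → b'.col = 1 → b.row < b'.row → T b < T b'
  peak : ∀ k ≤ n, IsPeakDiagram
    ((Finset.univ.filter fun b : Box α => (T b).val ≤ k).image Subtype.val)
  second_col : ∀ b b' : Box α, b.col = 2 → ¬ (T b).IsMarked → b'.col = 1 → b'.row = b.row + 1 →
    (T b').val ≠ (T b).val

/-- `wt(T)_i`, the number of occurrences of `i` or `i'` in `T`. -/
def weight {n : ℕ} {α : Composition n} (T : Filling α (MarkedEntry n)) (i : ℕ) : ℕ :=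
  (Finset.univ.filter fun b : Box α => (T b).val = i).card

/-- The weight has no zero entry to the left of a nonzero entry. -/
def IsPacked {n : ℕ} {α : Composition n} (T : Filling α (MarkedEntry n)) : Prop :=
  ∀ i j : ℕ, 1 ≤ i → i < j → j ≤ n → weight T i = 0 → weight T j = 0

/-- The sequence of the nonzero entries of `(wt(T)_1, …, wt(T)_n)`. If the weight is packed, this
only omits its trailing zeros. -/
def weightComposition {n : ℕ} {α : Composition n} (T : Filling α (MarkedEntry n)) :
    Composition n where
  blocks := ((List.range' 1 n).map (weight T)).filter (· ≠ 0)
  blocks_pos := by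
    intro i hi
    have := (List.mem_filter.1 hi).2
    simp only [decide_eq_true_eq] at this
    omega
  blocks_sum := by
    have h₁ : ∀ l : List ℕ, (l.filter (· ≠ 0)).sum = l.sum := by
      intro l
      induction l with
      | nil => simp
      | cons a l ih =>
        by_cases ha : a = 0
        · subst ha
          simpa using ih
        · rw [List.filter_cons_of_pos (by simpa using ha), List.sum_cons, List.sum_cons, ih]
    have h₂ : ((List.range' 1 n).map (weight T)).sum = ∑ i ∈ Finset.Icc 1 n, weight T i := by
      rw [← List.sum_toFinset _ List.nodup_range']
      refine Finset.sum_congr ?_ fun _ _ => rfl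
      ext i
      simp only [List.mem_toFinset, List.mem_range'_1, Finset.mem_Icc]
      omega
    rw [h₁, h₂]
    have h₃ := Finset.card_eq_sum_card_fiberwise (f := fun b : Box α => (T b).val)
      (s := Finset.univ) (t := Finset.Icc 1 n) (fun b _ => (ofLex (T b)).1.2)
    rw [Finset.card_univ, card_box] at h₃
    exact h₃.symm

open scoped Classical in
/-- The quasisymmetric Schur `Q`-function: the sum of `M_{wt(T)}` over the marked peak composition
tableaux `T` of shape `α` with packed weight. -/
noncomputable def schurQ {n : ℕ} (α : Composition n) : MvPowerSeries ℕ ℂ :=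
  ∑ T : Filling α (MarkedEntry n) with IsMPCT T ∧ IsPacked T, monomialQS (weightComposition T)

/-! ### Peak Young quasisymmetric Schur functions -/

/-- Standard peak Young composition tableaux. -/
structure IsSPYCT {n : ℕ} {β : Composition n} (T : Filling β (Entry n)) : Prop where
  bijective : Function.Bijective T
  row_increasing : ∀ b b' : Box β, b.row = b'.row → b.col < b'.col → T b < T b'
  first_col : ∀ b b' : Box β, b.col = 1 → b'.col = 1 → b.row < b'.row → T b < T b'
  peak : ∀ k ≤ n, IsPeakDiagram
    ((Finset.univ.filter fun b : Box β => (T b : ℕ) ≤ k).image Subtype.val)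
  young : ∀ b b' : Box β, b'.col = b.col + 1 → b'.row < b.row → T b < T b' →
    ∃ d : Box β, d.col = b.col + 1 ∧ d.row = b.row ∧ T d < T b'

/-- The descent set: the `i` such that `i + 1` is weakly left of `i` in `T`. -/
def descentLeft {n : ℕ} {β : Composition n} (T : Filling β (Entry n)) : Finset ℕ :=
  (Finset.Icc 1 (n - 1)).filter fun i =>
    ∃ b b' : Box β, (T b : ℕ) = i ∧ (T b' : ℕ) = i + 1 ∧ b'.col ≤ b.col

open scoped Classical in
/-- The peak Young quasisymmetric Schur function. -/
noncomputable def peakYoungSchur {n : ℕ} (β : Composition n) : MvPowerSeries ℕ ℂ :=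
  ∑ T : Filling β (Entry n) with IsSPYCT T, peakFunction (compOfSet n (peakSet (descentLeft T)))

/-! ### Dual immaculate recording tableaux -/

/-- `i` and `i + 1` are entries of `Q`, and `i + 1` is strictly right of `i`. -/
def StepsRight {n : ℕ} {β : Composition n} (Q : Filling β (Entry n)) (i : ℕ) : Prop :=
  ∃ b b' : Box β, (Q b : ℕ) = i ∧ (Q b' : ℕ) = i + 1 ∧ b.col < b'.col

/-- `a, a + 1, …, a + j - 1` is a row strip of length `j` in `Q`: a nonempty sequence of consecutive
entries, each strictly right of the preceding one, that cannot be extended at either end. -/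
structure IsRowStrip {n : ℕ} {β : Composition n} (Q : Filling β (Entry n)) (a j : ℕ) : Prop where
  start_pos : 1 ≤ a
  length_pos : 1 ≤ j
  end_le : a + j ≤ n + 1
  steps : ∀ i, a ≤ i → i + 1 < a + j → StepsRight Q i
  maximal_left : ¬ StepsRight Q (a - 1)
  maximal_right : ¬ StepsRight Q (a + j - 1)

/-- Dual immaculate recording tableaux. -/
structure IsDIRT {n : ℕ} {β : Composition n} (Q : Filling β (Entry n)) : Prop where
  bijective : Function.Bijective Q
  row_increasing : ∀ b b' : Box β, b.row = b'.row → b.col < b'.col → Q b < Q b'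
  strips_start : ∀ a j, IsRowStrip Q a j → ∀ b : Box β, (Q b : ℕ) = a → b.col = 1
  first_col : ∀ b b' : Box β, b.col = 1 → b'.col = 1 → b'.row < b.row → Q b < Q b'
  recording : ∀ b b' : Box β, b.col = b'.col → b'.row < b.row → Q b' < Q b →
    ∃ d : Box β, d.col = b.col + 1 ∧ d.row = b'.row ∧ Q d < Q b

/-- `Q` has row strip shape `γ`: for each `i`, the row strip that starts with
`γ₁ + ⋯ + γ_{i-1} + 1` has length `γ_i`. -/
def HasRowStripShape {n : ℕ} {β : Composition n} (Q : Filling β (Entry n)) (γ : Composition n) :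
    Prop :=
  ∀ i : Fin γ.length, IsRowStrip Q (γ.sizeUpTo i + 1) (γ.blocksFun i)

/-- The number `c_{α,β}` of dual immaculate recording tableaux of shape `β` whose row strip shape is
the reverse of `α`. -/
noncomputable def dirtCount {n : ℕ} (α β : Composition n) : ℕ :=
  Nat.card {Q : Filling β (Entry n) // IsDIRT Q ∧ HasRowStripShape Q α.reverse}

end PeakExpansion

/-! Both sides become sums of peak functions over standard tableaux, and an insertion algorithm
matches the tableaux.

Left side. Standardize a marked tableau `T`: list the boxes by entry, equal marked entries upwards
and equal unmarked entries downwards. The result `S` is a standard filling, and `T` satisfies the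
tableau axioms exactly when `S` satisfies `IsSPIT`: rows increase, and a row is opened only when all
lower rows have at least two boxes. Now fix `S` and a weight `γ`. The values in `T` are forced. The
box of `i` must be marked if `i + 1` is in a higher row and in the same block of `γ`; the box of `i
+ 1` must be unmarked if `i + 1` is in the same block but not higher; all other choices are free.
The two demands collide at a box exactly when its entry is a peak `p` of the descent set with
neither `p` nor `p - 1` in `set(γ)`. Hence there are `2 ^ γ.length` tableaux or none
(`card_standardization`), which is the coefficient of `M_γ` in the peak function
(`peakFunction_compOfSet`). This gives `schurQ_eq`.

Right side. Expanding the coefficients gives a sum over pairs `(U, Q)` of a standard peak Young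
composition tableau and a recording tableau of the same shape. So a bijection from the tableaux `S`
to these pairs is needed that turns "`i + 1` is higher than `i`" into "`i + 1` is weakly left of
`i`".

The bijection inserts the row indices of `1, …, n` in `S` one after another. The state is a shape
together with the word of columns of a recording tableau of this shape; the row strips of that
tableau, last strip first, have the lengths of the rows of `S` filled so far. Inserting `r`
lengthens the strip with index `r`. To do so, `insertStep` peels off the last letter `d` of the
word, inserts into the rest, and closes a square of shapes by a local rule: if the inner new box has
column `c ≠ d`, the two letters pass each other; if `c = d`, both become the largest column at most
`d` that can receive a box. The columns of the new boxes form the word of `U`.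

The insertion is well defined (`insertStep_spec`), invertible (`exists_insertStep`,
`insertStep_injective`) and compatible with descents (`insertStep_descent`), each by induction along
the local rules. The peak conditions on `S` and `U` agree because all rows of the current shape have
length at least two exactly when all strips do (`IsColumnWord.forall_two_le_iff`). The rest
translates the tableaux into words. -/

namespace PeakExpansion

/-! ### Adding and removing boxes of composition diagrams -/

/-- Lengthen the topmost row of length `c - 1` to `c`; for `c = 1`, put a new row on top. -/
def addBox (c : ℕ) : List ℕ → List ℕ
  | [] => [c]
  | b :: l => if b + 1 = c ∧ b ∉ l then c :: l else b :: addBox c l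

/-- Shorten the lowest row of length `d`, deleting it when `d = 1`. -/
def removeBox (d : ℕ) : List ℕ → List ℕ
  | [] => []
  | b :: l => if b = d then (if d = 1 then l else (d - 1) :: l) else b :: removeBox d l

/-- A box can be added in column `c`. -/
def CanAdd (c : ℕ) (l : List ℕ) : Prop := c = 1 ∨ c - 1 ∈ l

instance (l : List ℕ) : DecidablePred fun c => CanAdd c l := fun c =>
  inferInstanceAs (Decidable (c = 1 ∨ c - 1 ∈ l))

/-- A box can be removed from column `d`; from column `1` only as the bottom row. -/
def CanRemove (d : ℕ) (l : List ℕ) : Prop := d ∈ l ∧ (d = 1 → l.head? = some 1)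

/-- The largest column `≤ d` in which a box can be added. -/
def bump (l : List ℕ) (d : ℕ) : ℕ := Nat.findGreatest (fun c => CanAdd c l) d

/-- The column to the right of the longest row. -/
def newColumn (l : List ℕ) : ℕ := l.foldr max 0 + 1

/-- Up to the order of the rows, one part `c - 1` is replaced by `c`. Counting parts reduces later
questions about membership to arithmetic. For `c = 1` the lost part would be `0`, hence the
restriction to positive `x`. -/
theorem count_addBox {l : List ℕ} (hl : 0 ∉ l) {c : ℕ} (hc : CanAdd c l) {x : ℕ} (hx : 0 < x) :
    (addBox c l).count x + (if x + 1 = c then 1 else 0)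
      = l.count x + (if x = c then 1 else 0) := by
  induction l with
  | nil =>
    simp only [CanAdd, List.not_mem_nil, or_false] at hc
    subst hc
    simp only [addBox, List.count_cons, List.count_nil, beq_iff_eq]
    grind
  | cons b l ih =>
    simp only [List.mem_cons, not_or] at hl
    by_cases h : b + 1 = c ∧ b ∉ l
    · simp only [addBox, h, not_false_eq_true, and_self, if_true, List.count_cons, beq_iff_eq]
      grind
    · have h' : CanAdd c l := by
        simp only [CanAdd, List.mem_cons] at hc ⊢
        grind
      have := ih hl.2 h'
      simp only [addBox, h, if_false, List.count_cons]
      omega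

theorem count_removeBox {l : List ℕ} (hl : 0 ∉ l) {d : ℕ} (hd : d ∈ l) {x : ℕ} (hx : 0 < x) :
    (removeBox d l).count x + (if x = d then 1 else 0)
      = l.count x + (if x + 1 = d then 1 else 0) := by
  induction l with
  | nil => simp at hd
  | cons b l ih =>
    simp only [List.mem_cons, not_or] at hl
    by_cases h : b = d
    · subst h
      by_cases h1 : b = 1
      · simp only [removeBox, if_true, h1, List.count_cons, beq_iff_eq]
        grind
      · simp only [removeBox, if_true, h1, if_false, List.count_cons, beq_iff_eq]
        grind
    · have hd' : d ∈ l := by grind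
      have := ih hl.2 hd'
      simp only [removeBox, h, if_false, List.count_cons]
      omega

theorem zero_notMem_addBox {l : List ℕ} (hl : 0 ∉ l) {c : ℕ} (hc : CanAdd c l) :
    0 ∉ addBox c l := by
  have hc0 : c ≠ 0 := by
    rintro rfl
    simp [CanAdd, hl] at hc
  clear hc
  induction l with
  | nil => simpa [addBox] using hc0.symm
  | cons b l ih =>
    simp only [List.mem_cons, not_or] at hl
    simp only [addBox]
    split <;> simp [hl, ih hl.2, hc0.symm]

theorem zero_notMem_removeBox {l : List ℕ} (hl : 0 ∉ l) (d : ℕ) : 0 ∉ removeBox d l := by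
  induction l with
  | nil => simp [removeBox]
  | cons b l ih =>
    simp only [List.mem_cons, not_or] at hl
    simp only [removeBox]
    have := ih hl.2
    split
    · split
      · exact hl.2
      · simp only [List.mem_cons, not_or]
        refine ⟨by omega, hl.2⟩
    · simp [hl, this]

theorem CanAdd.pos {l : List ℕ} (hl : 0 ∉ l) {c : ℕ} (hc : CanAdd c l) : 0 < c := by
  rcases hc with rfl | h
  · norm_num
  · rcases c with _ | c
    · exact absurd h hl
    · omega

theorem canAdd_iff {l : List ℕ} (hl : 0 ∉ l) {c : ℕ} :
    CanAdd c l ↔ c = 1 ∨ 2 ≤ c ∧ 0 < l.count (c - 1) := by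
  rw [List.count_pos_iff]
  refine ⟨fun h => ?_, fun h => h.imp id And.right⟩
  have := h.pos hl
  rcases h with h | h
  · exact Or.inl h
  · by_cases h1 : c = 1
    · exact Or.inl h1
    · exact Or.inr ⟨by omega, h⟩

theorem mem_addBox {l : List ℕ} (hl : 0 ∉ l) {c : ℕ} (hc : CanAdd c l) : c ∈ addBox c l := by
  have := count_addBox hl hc (hc.pos hl)
  rw [← List.count_pos_iff]
  simp at this
  omega

theorem CanRemove.pos {l : List ℕ} (hl : 0 ∉ l) {d : ℕ} (hd : CanRemove d l) : 0 < d :=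
  Nat.pos_of_ne_zero fun h => hl (h ▸ hd.1)

/-- The two operations touch different rows. They could compete only for a row of length `d = c -
1`, and then `hc` guarantees a second such row: removal takes the lowest, addition the topmost. The
changed rows get lengths `d - 1 ≠ c - 1` and `c ≠ d`, so neither misleads the other operation. -/
theorem removeBox_addBox_of_ne {l : List ℕ} (hl : 0 ∉ l) {c d : ℕ} (hd : d ∈ l) (hcd : c ≠ d)
    (hc : CanAdd c (removeBox d l)) : removeBox d (addBox c l) = addBox c (removeBox d l) := by
  induction l with
  | nil => simp at hd
  | cons b l ih =>
    have hl' : 0 ∉ l := by grind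
    have hb : b ≠ 0 := by grind
    by_cases h : b = d
    · subst h
      by_cases h1 : b = 1
      · subst h1
        simp only [removeBox, if_true] at hc ⊢
        have : ¬ (1 + 1 = c ∧ 1 ∉ l) := by
          rintro ⟨rfl, h⟩
          simp [CanAdd, h] at hc
        simp [addBox, this, removeBox]
      · simp only [removeBox, if_true, h1, if_false] at hc ⊢
        have h2 : ¬ (b + 1 = c ∧ b ∉ l) := by
          rintro ⟨rfl, h⟩
          simp only [CanAdd, List.mem_cons] at hc
          grind
        have h3 : ¬ (b - 1 + 1 = c ∧ b - 1 ∉ l) := by omega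
        simp only [addBox, h2, h3, if_false, removeBox, if_true, h1]
    · have hd' : d ∈ l := by grind
      have hd0 : 0 < d := Nat.pos_of_ne_zero (by rintro rfl; exact hl' hd')
      simp only [removeBox, h, if_false] at hc ⊢
      have hb' : b + 1 = c → (b ∈ removeBox d l ↔ b ∈ l) := by
        intro hbc
        have := count_removeBox hl' hd' (Nat.pos_of_ne_zero hb)
        rw [← List.count_pos_iff, ← List.count_pos_iff]
        have : b + 1 ≠ d := by omega
        simp_all
      by_cases h4 : b + 1 = c ∧ b ∉ l
      · have h5 : b + 1 = c ∧ b ∉ removeBox d l := ⟨h4.1, by rw [hb' h4.1]; exact h4.2⟩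
        simp only [addBox, if_pos h4, if_pos h5, removeBox, hcd, if_false]
      · have h5 : ¬ (b + 1 = c ∧ b ∉ removeBox d l) := by
          intro h5
          rw [hb' h5.1] at h5
          exact h4 h5
        simp only [addBox, if_neg h4, if_neg h5, removeBox, h, if_false]
        rw [ih hl' hd']
        simp only [CanAdd, List.mem_cons] at hc ⊢
        by_contra hne
        apply h5
        have : ¬ c = 1 := by tauto
        have h6 : c - 1 = b := by tauto
        refine ⟨by omega, ?_⟩
        rw [← h6]
        tauto

/-- The shortened row is the only row of length `d - 1`, so the box returns to it. -/
theorem addBox_removeBox {l : List ℕ} {d : ℕ} (hd : d ∈ l) (h2 : 2 ≤ d) (h : d - 1 ∉ l) :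
    addBox d (removeBox d l) = l := by
  induction l with
  | nil => simp at hd
  | cons b l ih =>
    simp only [List.mem_cons, not_or] at h
    by_cases hb : b = d
    · subst hb
      have : ¬ b = 1 := by omega
      have h3 : b - 1 + 1 = b ∧ b - 1 ∉ l := ⟨by omega, h.2⟩
      simp only [removeBox, this, if_true, if_false, addBox, if_pos h3]
    · have h3 : ¬ (b + 1 = d ∧ b ∉ removeBox d l) := by omega
      simp only [removeBox, hb, if_false, addBox, if_neg h3]
      rw [ih (by grind) h.2]

theorem removeBox_addBox {l : List ℕ} (hl : 0 ∉ l) {c : ℕ} (hc : CanAdd c l) (h : c ∉ l) :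
    removeBox c (addBox c l) = l := by
  induction l with
  | nil =>
    simp only [CanAdd, List.not_mem_nil, or_false] at hc
    subst hc
    rfl
  | cons b l ih =>
    simp only [List.mem_cons, not_or] at h hl
    by_cases hb : b + 1 = c ∧ b ∉ l
    · have : ¬ c = 1 := by omega
      simp only [addBox, if_pos hb, removeBox, if_true, this, if_false]
      congr 1
      omega
    · simp only [addBox, if_neg hb, removeBox, Ne.symm h.1, if_false]
      rw [ih hl.2 ?_ h.2]
      simp only [CanAdd, List.mem_cons] at hc ⊢
      grind

/-- Compare the lowest row of length `d` with the topmost row of length `d - 1`. If the latter is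
higher, the operations act on these two rows independently; if it is lower, each side undoes its own
first step and gives `l`. -/
theorem removeBox_addBox_self {l : List ℕ} (hl : 0 ∉ l) {d : ℕ} (hd : d ∈ l) (hc : CanAdd d l) :
    removeBox d (addBox d l) = addBox d (removeBox d l) := by
  induction l with
  | nil => simp at hd
  | cons b l ih =>
    have hl' : 0 ∉ l := by grind
    have hb0 : b ≠ 0 := by grind
    by_cases hb : b = d
    · subst hb
      have h2 : ¬ (b + 1 = b ∧ b ∉ l) := by omega
      have h3 : ¬ (b - 1 + 1 = b ∧ b - 1 ∉ l) ∨ b = 1 := by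
        simp only [CanAdd, List.mem_cons] at hc
        rcases hc with hc | hc | hc
        · exact Or.inr hc
        · omega
        · exact Or.inl fun h => h.2 hc
      by_cases h1 : b = 1
      · subst h1
        simp [addBox, removeBox]
      · simp only [addBox, if_neg h2, removeBox, h1, if_true, if_false, if_neg (h3.resolve_right h1)]
    · have hd' : d ∈ l := by grind
      by_cases h4 : b + 1 = d ∧ b ∉ l
      · have h2 : 2 ≤ d := by omega
        have h5 : ¬ (b + 1 = d ∧ b ∉ removeBox d l) := by
          rintro ⟨-, h5⟩
          have := count_removeBox hl' hd' (Nat.pos_of_ne_zero hb0)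
          rw [← List.count_eq_zero] at h5
          rw [if_neg hb, if_pos h4.1] at this
          omega
        have : ¬ d = 1 := by omega
        simp only [addBox, if_pos h4, removeBox, if_true, this, if_false, hb, if_neg h5]
        rw [addBox_removeBox hd' h2]
        · congr 1; omega
        · rw [← h4.1]; simpa using h4.2
      · have h5 : ¬ (b + 1 = d ∧ b ∉ removeBox d l) := by
          rintro ⟨h6, h5⟩
          have := count_removeBox hl' hd' (Nat.pos_of_ne_zero hb0)
          rw [← List.count_eq_zero] at h5
          rw [if_neg hb, if_pos h6] at this
          omega
        simp only [addBox, if_neg h4, removeBox, hb, if_neg h5, if_false]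
        rw [ih hl' hd']
        simp only [CanAdd, List.mem_cons] at hc ⊢
        grind

theorem bump_le (l : List ℕ) (d : ℕ) : bump l d ≤ d := Nat.findGreatest_le d

theorem canAdd_bump {l : List ℕ} {d : ℕ} (hd : 0 < d) : CanAdd (bump l d) l :=
  Nat.findGreatest_spec (P := fun c => CanAdd c l) hd (Or.inl rfl)

theorem le_bump {l : List ℕ} {c d : ℕ} (hcd : c ≤ d) (hc : CanAdd c l) : c ≤ bump l d :=
  Nat.le_findGreatest (P := fun c => CanAdd c l) hcd hc

theorem le_of_mem_newColumn {l : List ℕ} {x : ℕ} (hx : x ∈ l) : x < newColumn l := by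
  induction l with
  | nil => simp at hx
  | cons b l ih =>
    simp only [newColumn, List.foldr_cons] at ih ⊢
    rcases List.mem_cons.1 hx with rfl | h
    · omega
    · have := ih h
      omega

theorem canAdd_newColumn (l : List ℕ) : CanAdd (newColumn l) l := by
  simp only [CanAdd, newColumn, Nat.add_sub_cancel, Nat.add_eq_right]
  induction l with
  | nil => simp
  | cons b l ih =>
    simp only [List.foldr_cons, List.mem_cons]
    rcases le_total b (l.foldr max 0) with h | h
    · rw [max_eq_right h]; tauto
    · rw [max_eq_left h]; tauto

theorem CanAdd.le_newColumn {l : List ℕ} {c : ℕ} (hc : CanAdd c l) : c ≤ newColumn l := by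
  rcases hc with rfl | h
  · simp [newColumn]
  · have := le_of_mem_newColumn h
    omega

theorem newColumn_eq {l : List ℕ} {c : ℕ} (hc : CanAdd c l) (h : ∀ x ∈ l, x < c) :
    newColumn l = c := by
  refine le_antisymm ?_ hc.le_newColumn
  rcases canAdd_newColumn l with h1 | h1
  · rw [h1]
    rcases hc with rfl | hc
    · rfl
    · exact Nat.one_le_iff_ne_zero.2 (by rintro rfl; exact absurd (h _ hc) (by omega))
  · have := h _ h1
    omega

theorem mem_of_mem_addBox {l : List ℕ} (hl : 0 ∉ l) {c d : ℕ} (hc : CanAdd c l)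
    (hd : d ∈ addBox c l) (hcd : c ≠ d) : d ∈ l := by
  have hd0 : 0 < d := Nat.pos_of_ne_zero fun h => zero_notMem_addBox hl hc (h ▸ hd)
  have := count_addBox hl hc hd0
  rw [← List.count_pos_iff] at hd ⊢
  rw [if_neg (Ne.symm hcd)] at this
  omega

theorem head?_addBox {b : ℕ} {l : List ℕ} {c : ℕ} :
    (addBox c (b :: l)).head? = some (if b + 1 = c ∧ b ∉ l then c else b) := by
  simp only [addBox]
  split <;> rfl

/-! ### The local rules -/

/-- A letter passes a different letter. -/
theorem square_ne {l : List ℕ} (hl : 0 ∉ l) {c d : ℕ} (hcd : c ≠ d) (hd : CanRemove d l)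
    (hc : CanAdd c (removeBox d l)) :
    CanAdd c l ∧ CanRemove d (addBox c l) ∧
      removeBox d (addBox c l) = addBox c (removeBox d l) := by
  have hl' := zero_notMem_removeBox hl d
  have hd0 := hd.pos hl
  -- Removing a box in column `d` creates only a row of length `d - 1`, which serves column `d` and
  -- not `c`.
  have hca : CanAdd c l := by
    rw [canAdd_iff hl'] at hc
    rw [canAdd_iff hl]
    refine hc.imp id fun h => ⟨h.1, ?_⟩
    have := count_removeBox hl hd.1 (x := c - 1) (by omega)
    rw [if_neg (by omega : ¬ c - 1 + 1 = d)] at this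
    omega
  refine ⟨hca, ⟨?_, ?_⟩, removeBox_addBox_of_ne hl hd.1 hcd hc⟩
  · have h1 := count_addBox hl hca hd0
    have h2 := count_removeBox hl hd.1 hd0
    have h3 := List.count_pos_iff.2 hd.1
    rw [← List.count_pos_iff]
    rw [canAdd_iff hl'] at hc
    -- For `c = d + 1` the new box consumes a row of length `d`; addability after the removal
    -- provides another one.
    by_cases h : d + 1 = c
    · subst h
      simp only [Nat.add_sub_cancel] at hc
      simp at h1 h2
      omega
    · simp [h] at h1
      omega
  · intro h1
    subst h1
    have h2 := hd.2 rfl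
    rcases l with _ | ⟨b, l⟩
    · simp at h2
    · simp only [List.head?_cons, Option.some.injEq] at h2
      subst h2
      rw [head?_addBox, if_neg]
      rintro ⟨h3, h4⟩
      subst h3
      simp [removeBox, CanAdd, h4] at hc

/-- A letter bumps an equal letter. -/
theorem square_bump {l : List ℕ} (hl : 0 ∉ l) {d : ℕ} (hd : CanRemove d l)
    (hc : CanAdd d (removeBox d l)) (h2 : d = 1 ∨ 2 ≤ bump l d) :
    CanRemove (bump l d) (addBox (bump l d) l) ∧
      removeBox (bump l d) (addBox (bump l d) l) = addBox d (removeBox d l) := by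
  have hd0 := hd.pos hl
  have hb := canAdd_bump (l := l) hd0
  refine ⟨⟨mem_addBox hl hb, ?_⟩, ?_⟩
  · intro h1
    have : d = 1 := by omega
    subst this
    rw [h1]
    have h2 := hd.2 rfl
    rcases l with _ | ⟨b, l⟩
    · simp at h2
    · simp only [List.head?_cons, Option.some.injEq] at h2
      subst h2
      simp [head?_addBox]
  -- After a strict bump, no column above `bump l d` and up to `d` can receive a box. So neither
  -- `bump l d` nor `d - 1` is a row length, and both sides equal `l`.
  · rcases (bump_le l d).eq_or_lt with h | h
    · rw [h] at hb ⊢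
      exact removeBox_addBox_self hl hd.1 hb
    · have hb0 := hb.pos hl
      rw [removeBox_addBox hl hb, addBox_removeBox hd.1 (by omega)]
      · intro h'
        have := le_bump le_rfl (Or.inr h' : CanAdd d l)
        omega
      · intro h'
        have : bump l d + 1 ≤ bump l d := le_bump h (Or.inr (by simpa using h'))
        omega

/-- The inverse of `square_ne`. -/
theorem square_ne_inv {l : List ℕ} (hl : 0 ∉ l) {c d : ℕ} (hcd : c ≠ d) (hc : CanAdd c l)
    (hd : CanRemove d (addBox c l)) :
    CanRemove d l ∧ CanAdd c (removeBox d l) ∧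
      removeBox d (addBox c l) = addBox c (removeBox d l) := by
  have hl' := zero_notMem_removeBox hl d
  have hdl := mem_of_mem_addBox hl hc hd.1 hcd
  have hd0 : 0 < d := Nat.pos_of_ne_zero fun h => hl (h ▸ hdl)
  have hca : CanAdd c (removeBox d l) := by
    rw [canAdd_iff hl] at hc
    rw [canAdd_iff hl']
    refine hc.imp id fun h => ⟨h.1, ?_⟩
    have h1 := count_removeBox hl hdl (x := c - 1) (by omega)
    rw [if_neg (by omega : ¬ c - 1 + 1 = d)] at h1
    by_cases h3 : c - 1 = d
    · have h2 := count_addBox hl (by rw [canAdd_iff hl]; exact Or.inr h) hd0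
      rw [if_neg (Ne.symm hcd), if_pos (by omega : d + 1 = c)] at h2
      have h4 := List.count_pos_iff.2 hd.1
      rw [if_pos h3] at h1
      rw [h3] at h1 ⊢
      omega
    · rw [if_neg h3] at h1
      omega
  refine ⟨⟨hdl, ?_⟩, hca, removeBox_addBox_of_ne hl hdl hcd hca⟩
  intro h1
  have h2 := hd.2 h1
  rcases l with _ | ⟨b, l⟩
  · simp at hdl
  · rw [head?_addBox] at h2
    split at h2
    · simp at h2; omega
    · simpa using h2

/-- The inverse of `square_bump`. -/
theorem square_bump_inv {l : List ℕ} (hl : 0 ∉ l) {c d : ℕ} (hc : CanAdd c l)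
    (hd : CanRemove c (addBox c l)) (hdl : d ∈ removeBox c (addBox c l)) (hcd : c ≤ d)
    (hmin : ∀ x ∈ removeBox c (addBox c l), c ≤ x → d ≤ x) :
    CanRemove d l ∧ CanAdd d (removeBox d l) ∧
      removeBox c (addBox c l) = addBox d (removeBox d l) ∧ bump l d = c ∧ (c = 1 → d = 1) := by
  have hc0 := hc.pos hl
  have hl1 := zero_notMem_addBox hl hc
  -- If `c` is a row length of `l`, it is still one after adding and removing, so minimality gives
  -- `d = c`. Otherwise adding and removing cancel, and `d` is the next row length of `l` above `c`,
  -- reached by a strict bump.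
  by_cases h : c ∈ l
  · have hcm : c ∈ removeBox c (addBox c l) := by
      have h1 := count_addBox hl hc hc0
      have h2 := count_removeBox hl1 (mem_addBox hl hc) hc0
      have h3 := List.count_pos_iff.2 h
      rw [← List.count_pos_iff]
      simp at h1 h2
      omega
    have : d = c := le_antisymm (hmin c hcm le_rfl) hcd
    subst this
    refine ⟨⟨h, ?_⟩, ?_, removeBox_addBox_self hl h hc, ?_, id⟩
    · intro h1
      have h2 := hd.2 h1
      rcases l with _ | ⟨b, l⟩
      · simp at h
      · rw [head?_addBox] at h2
        subst h1
        simp at h2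
        simp only [List.head?_cons, Option.some.injEq]
        grind
    · by_cases h1 : d = 1
      · exact Or.inl h1
      · refine Or.inr ?_
        have h2 := count_removeBox hl h (x := d - 1) (by omega)
        rw [if_neg (by omega : ¬ d - 1 = d), if_pos (by omega : d - 1 + 1 = d)] at h2
        rw [← List.count_pos_iff]
        omega
    · exact le_antisymm (bump_le _ _) (le_bump le_rfl hc)
  · rw [removeBox_addBox hl hc h] at hdl hmin ⊢
    have hne : c ≠ d := by rintro rfl; exact h hdl
    have h1 : d - 1 ∉ l := fun h' => by
      have := hmin _ h' (by omega)
      omega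
    refine ⟨⟨hdl, by omega⟩, Or.inr ?_, (addBox_removeBox hdl (by omega) h1).symm, ?_, ?_⟩
    · have h2 := count_removeBox hl hdl (x := d - 1) (by omega)
      rw [if_neg (by omega : ¬ d - 1 = d), if_pos (by omega : d - 1 + 1 = d)] at h2
      rw [← List.count_pos_iff]
      omega
    · refine le_antisymm ?_ (le_bump hcd hc)
      by_contra h3
      rcases canAdd_bump (l := l) (d := d) (by omega) with h4 | h4
      · omega
      · have := hmin _ h4 (by omega)
        have := bump_le l d
        omega
    · intro h1
      subst h1
      have h2 := hd.2 rfl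
      rcases l with _ | ⟨b, l⟩
      · simp at hdl
      · rw [head?_addBox] at h2
        simp at h2
        grind

/-- A row of length `c` in `l` would survive adding and removing. So there is none, the two
operations cancel, and every row of `l` is shorter than `c`. -/
theorem newColumn_inv {l : List ℕ} (hl : 0 ∉ l) {c : ℕ} (hc : CanAdd c l)
    (h : ∀ x ∈ removeBox c (addBox c l), x < c) :
    c = newColumn l ∧ removeBox c (addBox c l) = l := by
  have hc0 := hc.pos hl
  have hl1 := zero_notMem_addBox hl hc
  have hcl : c ∉ l := by
    intro h3
    have h1 := count_addBox hl hc hc0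
    have h2 := count_removeBox hl1 (mem_addBox hl hc) hc0
    have h3 := List.count_pos_iff.2 h3
    have : c ∈ removeBox c (addBox c l) := by
      rw [← List.count_pos_iff]
      simp at h1 h2
      omega
    exact lt_irrefl _ (h _ this)
  have h4 := removeBox_addBox hl hc hcl
  rw [h4] at h
  exact ⟨(newColumn_eq hc h).symm, h4⟩

theorem newColumn_square {l : List ℕ} (hl : 0 ∉ l) :
    CanRemove (newColumn l) (addBox (newColumn l) l) ∧
      removeBox (newColumn l) (addBox (newColumn l) l) = l := by
  have hc := canAdd_newColumn l
  refine ⟨⟨mem_addBox hl hc, ?_⟩, removeBox_addBox hl hc fun h => ?_⟩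
  · intro h1
    rcases l with _ | ⟨b, l⟩
    · rfl
    · have := le_of_mem_newColumn (List.mem_cons_self (a := b) (l := l))
      simp only [List.mem_cons, not_or] at hl
      omega
  · exact lt_irrefl _ (le_of_mem_newColumn h)

/-! ### Insertion -/

/-- `e` is the word of columns (last letter first) of a dual immaculate recording tableau whose
shape is `l`. -/
def IsColumnWord : List ℕ → List ℕ → Prop
  | l, [] => l = []
  | l, d :: e => CanRemove d l ∧ IsColumnWord (removeBox d l) e ∧ (d = 1 ∨ ∃ h ∈ e.head?, h < d)

/-- Lengthen the part with index `r` of a composition by `1`. -/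
def lengthen : ℕ → List ℕ → List ℕ
  | 0, [] => [1]
  | 0, g :: s => (g + 1) :: s
  | _ + 1, [] => [1]
  | r + 1, g :: s => g :: lengthen r s

/-- The strip lengths of a column word, last strip first. -/
def stripSizes : List ℕ → List ℕ
  | [] => []
  | d :: e => if d = 1 then 1 :: stripSizes e else lengthen 0 (stripSizes e)

/-- Insert a new letter at the end of the strip with index `r` (or, if there is no such strip, as a
new first strip). The result is the new column word and the column of the new box. -/
def insertStep : List ℕ → List ℕ → ℕ → List ℕ × ℕ
  | l, e, 0 => (newColumn l :: e, newColumn l)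
  | l, [], _ + 1 => ([newColumn l], newColumn l)
  | l, d :: e, r + 1 =>
    let p := insertStep (removeBox d l) e (if d = 1 then r else r + 1)
    if p.2 = d then (bump l d :: p.1, bump l d) else (d :: p.1, p.2)

/-- What the induction for `insertStep` carries along. -/
structure InsertSpec (l e : List ℕ) (r : ℕ) (e' : List ℕ) (c : ℕ) : Prop where
  canAdd : CanAdd c l
  word : IsColumnWord (addBox c l) e'
  head : ∃ h, e'.head? = some h ∧ (c = h ∨ CanRemove h l ∧ CanAdd c (removeBox h l))
  old_head : 0 < r → ∃ h h', e.head? = some h ∧ e'.head? = some h' ∧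
    (h' = h ∨ h' = bump l h) ∧ (h' = 1 ↔ h = 1)
  sizes : stripSizes e' = lengthen r (stripSizes e)
  eq_one : c = 1 ↔ r = e.count 1

/-- The earliest letter has no predecessor that could be smaller, so it is `1`. -/
theorem IsColumnWord.count_pos {l : List ℕ} (hl : 0 ∉ l) {e : List ℕ} (h : IsColumnWord l e)
    (hne : e ≠ []) : 0 < e.count 1 := by
  induction e generalizing l with
  | nil => exact absurd rfl hne
  | cons d e ih =>
    obtain ⟨h1, h2, h3⟩ := h
    rcases h3 with rfl | ⟨x, hx, -⟩
    · simp
    · have := ih (zero_notMem_removeBox hl d) h2 (by rintro rfl; simp at hx)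
      simp only [List.count_cons]
      omega

theorem IsColumnWord.eq_nil_iff {l : List ℕ} {e : List ℕ} (h : IsColumnWord l e) :
    l = [] ↔ e = [] := by
  cases e with
  | nil => simpa [IsColumnWord] using h
  | cons d e => 
    have := h.1.1
    simp only [reduceCtorEq, iff_false]
    rintro rfl
    simp at this

theorem stripSizes_ne_nil {e : List ℕ} (h : e ≠ []) : stripSizes e ≠ [] := by
  cases e with
  | nil => exact absurd rfl h
  | cons d e =>
    simp only [stripSizes]
    split
    · simp
    · cases stripSizes e <;> simp [lengthen]

theorem newColumn_eq_one_iff {l : List ℕ} (hl : 0 ∉ l) : newColumn l = 1 ↔ l = [] := by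
  constructor
  · intro h
    rcases l with _ | ⟨b, l⟩
    · rfl
    · have := le_of_mem_newColumn (List.mem_cons_self (a := b) (l := l))
      simp only [List.mem_cons, not_or] at hl
      omega
  · rintro rfl
    rfl

/-- The last letter of `e` is a row length of `l`, so the new column exceeds it and continues the
last strip. On the empty shape the new column is `1` and starts a strip. -/
theorem insertSpec_zero {l e : List ℕ} (hl : 0 ∉ l) (he : IsColumnWord l e) :
    InsertSpec l e 0 (newColumn l :: e) (newColumn l) := by
  have hsq := newColumn_square hl
  have h1 : newColumn l = 1 ↔ e = [] := by
    rw [← he.eq_nil_iff, newColumn_eq_one_iff hl]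
  refine ⟨canAdd_newColumn l, ⟨hsq.1, ?_, ?_⟩, ⟨_, rfl, Or.inl rfl⟩,
    fun h => absurd h (lt_irrefl _), ?_, ?_⟩
  · rw [hsq.2]; exact he
  · rcases e with _ | ⟨h, e⟩
    · exact Or.inl (h1.2 rfl)
    · exact Or.inr ⟨h, rfl, le_of_mem_newColumn he.1.1⟩
  · rcases e with _ | ⟨h, e⟩
    · simp [stripSizes, h1.2, lengthen]
    · simp [stripSizes, h1]
  · rw [h1]
    constructor
    · rintro rfl; rfl
    · intro h
      by_contra hne
      have := he.count_pos hl hne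
      omega

theorem lengthen_comm {s : List ℕ} (hs : s ≠ []) (r : ℕ) :
    lengthen 0 (lengthen (r + 1) s) = lengthen (r + 1) (lengthen 0 s) := by
  cases s with
  | nil => exact absurd rfl hs
  | cons g s => rfl

/-- The local rules take care of the shapes. The delicate point is that a letter other than `1` must
stay larger than its predecessor: `old_head` says that the predecessor does not grow, and `head`
keeps a bumped letter above it. -/
theorem insertStep_spec {l e : List ℕ} {r : ℕ} (hl : 0 ∉ l) (he : IsColumnWord l e)
    (hr : r ≤ e.count 1) :
    InsertSpec l e r (insertStep l e r).1 (insertStep l e r).2 := by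
  induction e generalizing l r with
  | nil =>
    have : r = 0 := by simpa using hr
    subst this
    exact insertSpec_zero hl he
  | cons d e ih =>
    rcases r with _ | r
    · simpa only [insertStep] using insertSpec_zero hl he
    obtain ⟨hd, hV, hasc⟩ := he
    have hl' := zero_notMem_removeBox hl d
    have hd0 := hd.pos hl
    simp only [insertStep]
    set r' := if d = 1 then r else r + 1 with hr'
    have hr2 : r' ≤ e.count 1 := by
      simp only [List.count_cons, beq_iff_eq] at hr
      split_ifs at hr hr' <;> omega
    have H := ih hl' hV hr2
    set e1 := (insertStep (removeBox d l) e r').1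
    set c1 := (insertStep (removeBox d l) e r').2
    obtain ⟨h1, hh1, hh2⟩ := H.head
    -- If `d ≠ 1`, the inner strip index is positive, so the inner head can only drop and the old
    -- strip inequality persists.
    have hlow : d = 1 ∨ h1 < d := by
      refine hasc.imp id ?_
      rintro ⟨h, hh, hlt⟩
      by_cases hd1 : d = 1
      · have h0 : h ≠ 0 := by
          rcases e with _ | ⟨x, e⟩
          · simp at hh
          · have := hV.1.pos hl'
            simp at hh
            omega
        omega
      · obtain ⟨x, x', hx, hx', hle, -⟩ := H.old_head (by rw [hr', if_neg hd1]; omega)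
        have hle : x' ≤ x := by
          have := bump_le (removeBox d l) x
          omega
        rw [hh1] at hx'
        rw [hx] at hh
        simp at hx' hh
        omega
    have hone : r' = e.count 1 ↔ r + 1 = (d :: e).count 1 := by
      simp only [List.count_cons, beq_iff_eq]
      split_ifs at hr' ⊢ <;> omega
    have hsz : ∀ x, (x = 1 ↔ d = 1) →
        stripSizes (x :: e1) = lengthen (r + 1) (stripSizes (d :: e)) := by
      intro x hx
      simp only [stripSizes, hx, H.sizes]
      by_cases hd1 : d = 1
      · simp [hr', hd1, lengthen]
      · have : e ≠ [] := by
          rintro rfl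
          simp [hd1] at hasc
        simp only [hr', hd1, if_false]
        exact lengthen_comm (stripSizes_ne_nil this) r
    by_cases hcd : c1 = d
    · rw [if_pos hcd]
      have hca := H.canAdd
      rw [hcd] at hca hh2
      -- A row of length `h1` in `l` makes column `h1 + 1 ≤ d` addable, so the bump stops above
      -- `h1`. If `h1 + 1 = d`, one such row of `removeBox d l` is the shortened one, and `hadd`
      -- supplies another.
      have hlow' : d = 1 ∨ h1 < bump l d := by
        by_cases hd1 : d = 1
        · exact Or.inl hd1
        · have hlt := hlow.resolve_left hd1
          obtain ⟨hrem, hadd⟩ := hh2.resolve_left (by omega)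
          have h10 := hrem.pos hl'
          refine Or.inr (le_bump hlt (Or.inr ?_))
          simp only [Nat.succ_eq_add_one, Nat.add_sub_cancel]
          have e1 := count_removeBox hl hd.1 h10
          have e2 := count_removeBox hl' hrem.1 h10
          have e3 := List.count_pos_iff.2 hrem.1
          rw [canAdd_iff (zero_notMem_removeBox hl' _)] at hadd
          rw [← List.count_pos_iff]
          by_cases h4 : h1 + 1 = d
          · rw [if_pos h4] at e1
            rw [(by omega : d - 1 = h1)] at hadd
            simp only [if_true] at e2
            rw [if_neg (by omega)] at e2
            omega
          · rw [if_neg h4] at e1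
            omega
      have hb0 := (canAdd_bump (l := l) hd0).pos hl
      have hble := bump_le l d
      have h10 : 0 < h1 := by
        rcases hh2 with h | h
        · omega
        · exact h.1.pos hl'
      have hb1 : bump l d = 1 ↔ d = 1 := by omega
      have hsq := square_bump hl hd hca (by omega)
      refine ⟨canAdd_bump hd0, ⟨hsq.1, ?_, ?_⟩, ⟨_, rfl, Or.inl rfl⟩, fun _ =>
        ⟨d, _, rfl, rfl, Or.inr rfl, hb1⟩, hsz _ hb1, ?_⟩
      · rw [hsq.2]
        have := H.word
        rwa [hcd] at this
      · rw [hb1]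
        exact hlow'.imp id fun h => ⟨h1, hh1, h⟩
      · rw [hb1, ← hone, ← H.eq_one, hcd]
    · rw [if_neg hcd]
      have hsq := square_ne hl hcd hd H.canAdd
      refine ⟨hsq.1, ⟨hsq.2.1, ?_, hlow.imp id fun h => ⟨h1, hh1, h⟩⟩, ⟨d, rfl, Or.inr
        ⟨hd, H.canAdd⟩⟩, fun _ => ⟨d, d, rfl, rfl, Or.inl rfl, Iff.rfl⟩, hsz d Iff.rfl, ?_⟩
      · rw [hsq.2.2]
        exact H.word
      · rw [← hone]
        exact H.eq_one

/-! ### Descents under two successive insertions -/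

theorem insertStep_zero (l e : List ℕ) : insertStep l e 0 = (newColumn l :: e, newColumn l) := by
  cases e <;> rfl

theorem insertStep_cons (l : List ℕ) (d : ℕ) (e : List ℕ) (r : ℕ) :
    insertStep l (d :: e) (r + 1) =
      let p := insertStep (removeBox d l) e (if d = 1 then r else r + 1)
      if p.2 = d then (bump l d :: p.1, bump l d) else (d :: p.1, p.2) := rfl

/-- Successive insertions: the second new box is weakly left of the first one if and only if the
second letter enters a strip with larger index. -/
theorem insertStep_descent {l e : List ℕ} {r s : ℕ} (hl : 0 ∉ l) (he : IsColumnWord l e)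
    (hr : r ≤ e.count 1)
    (hs : s ≤ (insertStep l e r).1.count 1) :
    (insertStep (addBox (insertStep l e r).2 l) (insertStep l e r).1 s).2 ≤ (insertStep l e r).2 ↔
      r < s := by
  induction e generalizing l r s with
  | nil =>
    have : r = 0 := by simpa using hr
    subst this
    have hl0 := he.eq_nil_iff.2 rfl
    subst hl0
    rw [insertStep_zero] at hs ⊢
    rcases s with _ | _ | s
    · simp [insertStep, newColumn, addBox]
    · simp [insertStep, newColumn, addBox, removeBox, bump, CanAdd]
    · simp [newColumn] at hs
  | cons d e ih =>
    have hspec := insertStep_spec hl he hr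
    -- Index `0` places the second box to the right of every row, including the one just lengthened.
    rcases s with _ | s
    · simp only [Nat.not_lt_zero, iff_false, not_le]
      rw [insertStep_zero]
      exact le_of_mem_newColumn (mem_addBox hl hspec.canAdd)
    rcases r with _ | r
    · rw [insertStep_zero] at hs hspec ⊢
      simp only [Nat.zero_lt_succ, iff_true] at hs ⊢
      -- Peeling off the letter just added restores `l`, so the second insertion recurs into the
      -- original pair. Its column is at most `newColumn l`, and a bump only lowers it.
      rw [insertStep_cons, (newColumn_square hl).2]
      have hs' : (if newColumn l = 1 then s else s + 1) ≤ (d :: e).count 1 := by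
        rw [List.count_cons] at hs
        simp only [beq_iff_eq] at hs
        split_ifs at hs ⊢ <;> omega
      have := (insertStep_spec hl he hs').canAdd.le_newColumn
      dsimp only
      set q := insertStep l (d :: e) (if newColumn l = 1 then s else s + 1)
      split
      · exact bump_le _ _
      · exact this
    obtain ⟨hd, hV, hasc⟩ := he
    have hl' := zero_notMem_removeBox hl d
    have hd0 := hd.pos hl
    have hr' : (if d = 1 then r else r + 1) ≤ e.count 1 := by
      simp only [List.count_cons, beq_iff_eq] at hr
      split_ifs at hr ⊢ <;> omega
    have H := insertStep_spec hl' hV hr'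
    have IH := @ih _ (if d = 1 then r else r + 1) (if d = 1 then s else s + 1) hl' hV hr'
    obtain ⟨_, d', hx, hd', -, hd1⟩ := hspec.old_head (Nat.succ_pos r)
    simp only [List.head?_cons, Option.some.injEq] at hx
    subst hx
    rw [insertStep_cons] at hs hd' hspec ⊢
    set r' := if d = 1 then r else r + 1 with hr'
    set e1 := (insertStep (removeBox d l) e r').1
    set c1 := (insertStep (removeBox d l) e r').2
    change s + 1 ≤ (if c1 = d then (bump l d :: e1, bump l d) else (d :: e1, c1)).1.count 1 at hs
    change (if c1 = d then (bump l d :: e1, bump l d) else (d :: e1, c1)).1.head? = _ at hd'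
    change InsertSpec l (d :: e) (r + 1) (if c1 = d then (bump l d :: e1, bump l d)
      else (d :: e1, c1)).1 (if c1 = d then (bump l d :: e1, bump l d) else (d :: e1, c1)).2
      at hspec
    change (insertStep (addBox (if c1 = d then (bump l d :: e1, bump l d) else (d :: e1, c1)).2 l)
      (if c1 = d then (bump l d :: e1, bump l d) else (d :: e1, c1)).1 (s + 1)).2 ≤
      (if c1 = d then (bump l d :: e1, bump l d) else (d :: e1, c1)).2 ↔ _
    -- A common form for both local rules: the outer column `c` is at most the inner column `c1`,
    -- with equality unless a bump occurs.
    obtain ⟨c, hc1, hc2, hc3, hc4⟩ : ∃ c, (if c1 = d then (bump l d :: e1, bump l d) else (d :: e1, c1))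
        = (d' :: e1, c) ∧ c ≤ c1 ∧ (c1 ≠ d → c = c1) ∧ (c1 = d → c = bump l d) := by
      by_cases h : c1 = d
      · simp only [h, if_true, List.head?_cons, Option.some.injEq] at hd' ⊢
        exact ⟨bump l d, by rw [hd'], bump_le _ _, by simp, by simp⟩
      · simp only [h, if_false, List.head?_cons, Option.some.injEq] at hd' ⊢
        exact ⟨c1, by rw [hd'], le_rfl, by simp, by simp⟩
    rw [hc1] at hs hspec ⊢
    dsimp only at hs ⊢
    have hs' : (if d = 1 then s else s + 1) ≤ e1.count 1 := by
      rw [List.count_cons] at hs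
      simp only [beq_iff_eq, hd1] at hs
      split_ifs at hs ⊢ <;> omega
    -- The square of shapes: inside, the second insertion sees exactly the result of the first inner
    -- insertion, so the induction hypothesis applies.
    have hsq : removeBox d' (addBox c l) = addBox c1 (removeBox d l) := by
      by_cases h : c1 = d
      · have h2 := hc4 h
        rw [if_pos h] at hc1
        simp only [Prod.mk.injEq, List.cons.injEq] at hc1
        have hca := H.canAdd
        change CanAdd c1 _ at hca
        rw [h] at hca ⊢
        rw [h2, ← hc1.1.1]
        have := (canAdd_bump (l := l) hd0).pos hl
        exact (square_bump hl hd hca (by omega)).2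
      · rw [hc3 h]
        rw [if_neg h] at hc1
        simp only [Prod.mk.injEq, List.cons.injEq] at hc1
        rw [← hc1.1.1]
        exact (square_ne hl h hd H.canAdd).2.2
    have IH := IH hs'
    rw [insertStep_cons, hsq]
    simp only [hd1]
    have hspec2 := insertStep_spec (zero_notMem_addBox hl' H.canAdd) H.word hs'
    change InsertSpec (addBox c1 _) e1 _ (insertStep (addBox c1 (removeBox d l)) e1 _).1 (insertStep (addBox c1 (removeBox d l)) e1 _).2 at hspec2
    set c2 := (insertStep (addBox c1 (removeBox d l)) e1 (if d = 1 then s else s + 1)).2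
    have hrs : r' < (if d = 1 then s else s + 1) ↔ r + 1 < s + 1 := by
      rw [hr']
      split <;> omega
    rw [← hrs, ← IH]
    constructor
    · intro h
      by_contra hlt
      push Not at hlt
      by_cases h2 : c2 = d'
      · rw [if_pos h2] at h
        -- The first insertion left a row of length `c`, so column `c + 1 ≤ d'` is addable and even
        -- a bumped second box stays right of `c`.
        have : c + 1 ≤ bump (addBox c l) d' :=
          le_bump (by omega) (Or.inr (by simpa using mem_addBox hl hspec.canAdd))
        dsimp only at h
        omega
      · rw [if_neg h2] at h
        dsimp only at h
        omega
    · intro h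
      have h3 : c2 ≤ c := by
        by_cases h1 : c1 = d
        · rcases (bump_le l d).eq_or_lt with h4 | h4
          · have := hc4 h1
            omega
          -- After a strict bump, restoring the box in column `d` gives back `l`. So `c2` is addable
          -- to `l` and at most `d`, hence at most `bump l d`.
          · rw [hc4 h1]
            refine le_bump (by omega) ?_
            have hca := hspec2.canAdd
            rw [h1, addBox_removeBox hd.1] at hca
            · exact hca
            · have := (canAdd_bump (l := l) hd0).pos hl
              omega
            · intro h'
              have := le_bump le_rfl (Or.inr h' : CanAdd d l)
              omega
        · rw [hc3 h1]
          exact h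
      by_cases h2 : c2 = d'
      · rw [if_pos h2]
        have := bump_le (addBox c l) d'
        dsimp only
        omega
      · rw [if_neg h2]
        exact h3

/-! ### Invertibility of the insertion -/

/-- The new column and the last letter tell which rule was applied last: distinct letters passed
each other, equal letters come from a bump or from an insertion at index `0`. Undo that rule and
recur. -/
theorem exists_insertStep {l e' : List ℕ} {c : ℕ} (hl : 0 ∉ l) (hc : CanAdd c l)
    (he' : IsColumnWord (addBox c l) e') :
    ∃ e r, IsColumnWord l e ∧ r ≤ e.count 1 ∧ insertStep l e r = (e', c) := by
  induction e' generalizing l c with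
  | nil =>
    have := mem_addBox hl hc
    rw [show addBox c l = [] from he'] at this
    simp at this
  | cons d' e1 ih =>
    obtain ⟨hd', hV, hasc⟩ := he'
    have hc0 := hc.pos hl
    -- the strip index is determined by that of the inner insertion
    have finish : ∀ d e r, CanRemove d l → IsColumnWord (removeBox d l) e → r ≤ e.count 1 →
        (d ≠ 1 → 0 < r) → (d = 1 ∨ ∃ h ∈ e.head?, h < d) →
        (∀ p, insertStep (removeBox d l) e r = p →
          (if p.2 = d then (bump l d :: p.1, bump l d) else (d :: p.1, p.2)) = (d' :: e1, c)) →
        ∃ e r, IsColumnWord l e ∧ r ≤ e.count 1 ∧ insertStep l e r = (d' :: e1, c) := by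
      intro d e r h1 h2 h3 h4 h5 h6
      refine ⟨d :: e, if d = 1 then r + 1 else r, ⟨h1, h2, h5⟩, ?_, ?_⟩
      · rw [List.count_cons]
        simp only [beq_iff_eq]
        clear h5 h6
        split_ifs <;> omega
      · obtain ⟨r', hr'⟩ : ∃ r', (if d = 1 then r + 1 else r) = r' + 1 :=
          ⟨(if d = 1 then r + 1 else r) - 1, by clear h5 h6; split_ifs <;> omega⟩
        rw [hr', insertStep_cons]
        have : (if d = 1 then r' else r' + 1) = r := by
          clear h5 h6
          split_ifs at hr' ⊢ <;> omega
        rw [this]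
        exact h6 _ rfl
    by_cases hcd : c = d'
    · subst hcd
      -- A bump to `c` came from the shortest row of length at least `c`. If no row is that long,
      -- `c` was the new column of an insertion at index `0`.
      by_cases hex : ∃ x, x ∈ removeBox c (addBox c l) ∧ c ≤ x
      · classical
        set d := Nat.find hex with hdef
        obtain ⟨hd1, hd2⟩ := Nat.find_spec hex
        obtain ⟨h1, h2, h3, h4, h5⟩ := square_bump_inv hl hc hd' hd1 hd2
          (fun x hx hcx => Nat.find_min' hex ⟨hx, hcx⟩)
        rw [← hdef] at h1 h2 h3 h4 h5 hd1 hd2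
        have hl' := zero_notMem_removeBox hl d
        rw [h3] at hV
        obtain ⟨e, r, he, hr, hstep⟩ := ih hl' h2 hV
        have hspec := insertStep_spec hl' he hr
        rw [hstep] at hspec
        -- Inner index `0` would make `d ≥ c` the letter preceding `c`, which the strip condition
        -- forbids.
        have hr0 : d ≠ 1 → 0 < r := by
          intro hd
          by_contra h0
          have : r = 0 := by omega
          subst this
          rw [insertStep_zero] at hstep
          simp only [Prod.mk.injEq] at hstep
          obtain ⟨x, hx, hlt⟩ := hasc.resolve_left (fun h => hd (h5 h))
          rw [← hstep.1] at hx
          simp at hx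
          omega
        refine finish d e r h1 he hr hr0 ?_ ?_
        · by_cases hd : d = 1
          · exact Or.inl hd
          · refine Or.inr ?_
            obtain ⟨x, hx, hlt⟩ := hasc.resolve_left (fun h => hd (h5 h))
            obtain ⟨h, h', hh, hh', hor, -⟩ := hspec.old_head (hr0 hd)
            refine ⟨h, hh, ?_⟩
            simp only [Option.mem_def] at hx
            rw [hx] at hh'
            simp only [Option.some.injEq] at hh'
            rcases hor with hor | hor
            · omega
            · by_contra hge
              have := le_bump (not_lt.1 hge) h2
              omega
        · intro p hp
          rw [hstep] at hp
          subst hp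
          simp [h4]
      · push Not at hex
        obtain ⟨h1, h2⟩ := newColumn_inv hl hc hex
        refine ⟨e1, 0, ?_, Nat.zero_le _, ?_⟩
        · rwa [h2] at hV
        · rw [insertStep_zero, ← h1]
    · obtain ⟨h1, h2, h3⟩ := square_ne_inv hl hcd hc hd'
      have hl' := zero_notMem_removeBox hl d'
      rw [h3] at hV
      obtain ⟨e, r, he, hr, hstep⟩ := ih hl' h2 hV
      have hspec := insertStep_spec hl' he hr
      rw [hstep] at hspec
      have hd0 := h1.pos hl
      have hca : d' ≠ 1 → CanAdd d' (removeBox d' l) := by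
        intro hd
        refine Or.inr ?_
        have h2 := count_removeBox hl h1.1 (x := d' - 1) (by omega)
        rw [if_neg (by omega : ¬ d' - 1 = d'), if_pos (by omega : d' - 1 + 1 = d')] at h2
        rw [← List.count_pos_iff]
        omega
      have hr0 : d' ≠ 1 → 0 < r := by
        intro hd
        by_contra h0
        have : r = 0 := by omega
        subst this
        rw [insertStep_zero] at hstep
        simp only [Prod.mk.injEq] at hstep
        obtain ⟨x, hx, hlt⟩ := hasc.resolve_left hd
        rw [← hstep.1] at hx
        simp only [List.head?_cons, Option.mem_def, Option.some.injEq] at hx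
        have := (hca hd).le_newColumn
        omega
      refine finish d' e r h1 he hr hr0 ?_ ?_
      · refine (eq_or_ne d' 1).imp id fun hd => ?_
        obtain ⟨x, hx, hlt⟩ := hasc.resolve_left hd
        obtain ⟨h, h', hh, hh', hor, -⟩ := hspec.old_head (hr0 hd)
        refine ⟨h, hh, ?_⟩
        simp only [Option.mem_def] at hx
        rw [hx] at hh'
        simp only [Option.some.injEq] at hh'
        rcases hor with hor | hor
        · omega
        · by_contra hge
          have := le_bump (not_lt.1 hge) (hca hd)
          omega
      · intro p hp
        rw [hstep] at hp
        subst hp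
        simp [hcd]

/-- Index `0` is recognized by the last letter `newColumn l`, since positive indices give a last
letter bounded by a row length. For positive indices, a bump happened exactly when the last letter
equals the new column, and then `bump l` determines the row length that was bumped. -/
theorem insertStep_injective {l e f : List ℕ} {r s : ℕ} (hl : 0 ∉ l) (he : IsColumnWord l e)
    (hf : IsColumnWord l f) (hr : r ≤ e.count 1) (hs : s ≤ f.count 1)
    (h : insertStep l e r = insertStep l f s) : e = f ∧ r = s := by
  have key : ∀ {l d e s}, 0 ∉ l → IsColumnWord l (d :: e) →
      (insertStep l (d :: e) (s + 1)).1.head? ≠ some (newColumn l) := by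
    intro l d e s hl he h
    have h1 := le_of_mem_newColumn he.1.1
    have h2 := bump_le l d
    rw [insertStep_cons] at h
    dsimp only at h
    set q := insertStep (removeBox d l) e (if d = 1 then s else s + 1)
    by_cases h' : q.2 = d
    · rw [if_pos h'] at h
      simp at h
      omega
    · rw [if_neg h'] at h
      simp at h
      omega
  induction e generalizing l f r s with
  | nil =>
    have hf' : f = [] := hf.eq_nil_iff.1 (he.eq_nil_iff.2 rfl)
    subst hf'
    simp only [List.count_nil] at hr hs
    exact ⟨rfl, by omega⟩
  | cons d e ih =>
    rcases f with _ | ⟨g, f⟩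
    · have := he.eq_nil_iff.1 (hf.eq_nil_iff.2 rfl)
      simp at this
    rcases r with _ | r <;> rcases s with _ | s
    · rw [insertStep_zero, insertStep_zero] at h
      simp only [Prod.mk.injEq, List.cons.injEq] at h
      simp [h]
    · refine absurd ?_ (key (s := s) hl hf)
      rw [← h, insertStep_zero]
      rfl
    · refine absurd ?_ (key (s := r) hl he)
      rw [h, insertStep_zero]
      rfl
    · have hd0 := he.1.pos hl
      have hg0 := hf.1.pos hl
      have hr' : (if d = 1 then r else r + 1) ≤ e.count 1 := by
        simp only [List.count_cons, beq_iff_eq] at hr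
        split_ifs at hr ⊢ <;> omega
      have hs' : (if g = 1 then s else s + 1) ≤ f.count 1 := by
        simp only [List.count_cons, beq_iff_eq] at hs
        split_ifs at hs ⊢ <;> omega
      have main : d = g → insertStep (removeBox d l) e (if d = 1 then r else r + 1) =
          insertStep (removeBox g l) f (if g = 1 then s else s + 1) →
          d :: e = g :: f ∧ r + 1 = s + 1 := by
        rintro rfl heq
        obtain ⟨h1, h2⟩ := ih (zero_notMem_removeBox hl d) he.2.1 hf.2.1 hr' hs' heq
        refine ⟨by rw [h1], ?_⟩
        split_ifs at h2 <;> omega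
      -- A row of length `d < g` makes column `d + 1` addable, so `bump l g` exceeds `d` and hence
      -- `bump l d`.
      have hlt : ∀ {d g}, d ∈ l → bump l d = bump l g → ¬ d < g := by
        intro d g hd h1 h2
        have : d + 1 ≤ bump l g := le_bump h2 (Or.inr (by simpa using hd))
        have := bump_le l d
        omega
      rw [insertStep_cons, insertStep_cons] at h
      dsimp only at h
      generalize insertStep (removeBox d l) e (if d = 1 then r else r + 1) = p at h main
      generalize insertStep (removeBox g l) f (if g = 1 then s else s + 1) = q at h main
      by_cases hp : p.2 = d <;> by_cases hq : q.2 = g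
      · rw [if_pos hp, if_pos hq] at h
        simp only [Prod.mk.injEq, List.cons.injEq] at h
        have hdg : d = g := le_antisymm (not_lt.1 (hlt hf.1.1 h.2.symm))
          (not_lt.1 (hlt he.1.1 h.2))
        exact main hdg (Prod.ext h.1.2 (by omega))
      · rw [if_pos hp, if_neg hq] at h
        simp only [Prod.mk.injEq, List.cons.injEq] at h
        omega
      · rw [if_neg hp, if_pos hq] at h
        simp only [Prod.mk.injEq, List.cons.injEq] at h
        omega
      · rw [if_neg hp, if_neg hq] at h
        simp only [Prod.mk.injEq, List.cons.injEq] at h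
        exact main h.1.1 (Prod.ext h.1.2 h.2)

/-! ### Lengths of strips and of rows -/

theorem length_lengthen_zero {s : List ℕ} (hs : s ≠ []) : (lengthen 0 s).length = s.length := by
  cases s with
  | nil => exact absurd rfl hs
  | cons g s => rfl

theorem IsColumnWord.ne_nil_of_ne_one {l e : List ℕ} {d : ℕ} (h : IsColumnWord l (d :: e))
    (hd : d ≠ 1) : e ≠ [] := by
  rintro rfl
  have := h.2.2.resolve_left hd
  simp at this

theorem IsColumnWord.length_stripSizes {l e : List ℕ} (h : IsColumnWord l e) :
    (stripSizes e).length = e.count 1 := by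
  induction e generalizing l with
  | nil => rfl
  | cons d e ih =>
    have := ih h.2.1
    by_cases hd : d = 1
    · simp [stripSizes, hd, this]
    · simp only [stripSizes, hd, if_false, List.count_cons, beq_iff_eq]
      rw [length_lengthen_zero (stripSizes_ne_nil (h.ne_nil_of_ne_one hd)), this]
      rfl

theorem length_removeBox {l : List ℕ} {d : ℕ} (hd : d ∈ l) :
    (removeBox d l).length + (if d = 1 then 1 else 0) = l.length := by
  induction l with
  | nil => simp at hd
  | cons b l ih =>
    simp only [removeBox]
    by_cases hb : b = d
    · simp only [hb, if_true]
      split <;> simp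
    · simp only [hb, if_false, List.length_cons]
      have := ih (by grind)
      omega

theorem IsColumnWord.length_eq {l e : List ℕ} (h : IsColumnWord l e) : l.length = e.count 1 := by
  induction e generalizing l with
  | nil => simp [show l = [] from h]
  | cons d e ih =>
    have h1 := ih h.2.1
    have h2 := length_removeBox h.1.1
    simp only [List.count_cons, beq_iff_eq]
    omega

theorem countP_removeBox {l : List ℕ} {d : ℕ} (hd : d ∈ l) :
    (removeBox d l).countP (2 ≤ ·) + (if d = 2 then 1 else 0) = l.countP (2 ≤ ·) := by
  induction l with
  | nil => simp at hd
  | cons b l ih =>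
    simp only [removeBox]
    by_cases hb : b = d
    · subst hb
      simp only [if_true]
      split
      · simp [*]
      · simp only [List.countP_cons, decide_eq_true_eq]
        split_ifs <;> omega
    · simp only [hb, if_false, List.countP_cons]
      have := ih (by grind)
      omega

theorem IsColumnWord.countP_eq {l e : List ℕ} (h : IsColumnWord l e) :
    l.countP (2 ≤ ·) = e.count 2 := by
  induction e generalizing l with
  | nil => simp [show l = [] from h]
  | cons d e ih =>
    have h1 := ih h.2.1
    have h2 := countP_removeBox h.1.1
    simp only [List.count_cons, beq_iff_eq]
    omega

theorem one_le_of_mem_stripSizes {e : List ℕ} : ∀ x ∈ stripSizes e, 1 ≤ x := by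
  induction e with
  | nil => simp [stripSizes]
  | cons d e ih =>
    simp only [stripSizes]
    split
    · simpa using ih
    · rcases h : stripSizes e with _ | ⟨g, s⟩
      · simp [lengthen]
      · rw [h] at ih
        simp only [lengthen, List.mem_cons, forall_eq_or_imp] at ih ⊢
        exact ⟨by omega, ih.2⟩

/-- A letter `2` needs a smaller predecessor, hence a `1`, so it is the second letter of its strip:
a strip contains at most one `2`, and only if it is long enough. The second half is what the
induction needs to see that a `2` lengthens a strip of length `1`. -/
theorem IsColumnWord.count_two_le {l e : List ℕ} (hl : 0 ∉ l) (h : IsColumnWord l e) :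
    e.count 2 ≤ (stripSizes e).countP (2 ≤ ·) ∧ ((stripSizes e).head? = some 1 ↔ e.head? = some 1) := by
  induction e generalizing l with
  | nil => simp [stripSizes]
  | cons d e ih =>
    have hl' := zero_notMem_removeBox hl d
    obtain ⟨h1, h2⟩ := ih hl' h.2.1
    have hd0 := h.1.pos hl
    by_cases hd : d = 1
    · simp [stripSizes, hd, h1]
    · have hne := h.ne_nil_of_ne_one hd
      obtain ⟨x, hx, hxd⟩ := h.2.2.resolve_left hd
      simp only [stripSizes, hd, if_false]
      rcases hs : stripSizes e with _ | ⟨g, s⟩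
      · exact absurd hs (stripSizes_ne_nil hne)
      · have hg : 1 ≤ g := one_le_of_mem_stripSizes g (by rw [hs]; simp)
        rw [hs] at h1 h2
        simp only [List.countP_cons, decide_eq_true_eq] at h1
        simp only [List.head?_cons, Option.some.injEq, Option.mem_def] at h2 hx
        simp only [lengthen, List.countP_cons, List.count_cons, beq_iff_eq, decide_eq_true_eq,
          List.head?_cons, Option.some.injEq, hd, iff_false]
        rw [hx] at h2
        simp only [Option.some.injEq] at h2
        have hx0 : x ≠ 0 := by
          rcases e with _ | ⟨y, e⟩
          · simp at hx
          · have := h.2.1.1.pos hl'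
            simp at hx
            omega
        split_ifs at h1 ⊢ <;> omega

theorem forall_mem_iff_countP {l : List ℕ} : (∀ x ∈ l, 2 ≤ x) ↔ l.countP (2 ≤ ·) = l.length := by
  rw [List.countP_eq_length]
  simp

/-- If all rows have length at least `2` then so do all strips. -/
theorem IsColumnWord.two_le_stripSizes {l e : List ℕ} (hl : 0 ∉ l) (h : IsColumnWord l e)
    (h2 : ∀ x ∈ l, 2 ≤ x) : ∀ x ∈ stripSizes e, 2 ≤ x := by
  rw [forall_mem_iff_countP] at h2 ⊢
  -- Rows and strips are both counted by the letters `1`, and rows of length at least two by the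
  -- letters `2`. If every row is that long, the inequality leaves no room for a short strip.
  have h3 := (h.count_two_le hl).1
  have h4 := (stripSizes e).countP_le_length (p := (2 ≤ ·))
  rw [h.countP_eq, h.length_eq] at h2
  rw [h.length_stripSizes] at h4 ⊢
  omega

/-- Only the bottom row can be deleted, so the top row stays the same row as long as the shape is
nonempty, and it never gets longer under removal. -/
theorem getLast?_removeBox {l : List ℕ} {d : ℕ} (hd : CanRemove d l) {x : ℕ}
    (hx : (removeBox d l).getLast? = some x) : ∃ y, l.getLast? = some y ∧ x ≤ y := by
  obtain ⟨hd, h1⟩ := hd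
  induction l generalizing x with
  | nil => simp at hd
  | cons b l ih =>
    simp only [removeBox] at hx
    by_cases hb : b = d
    · simp only [hb, if_true] at hx
      split at hx
      · exact ⟨x, by simp [List.getLast?_cons, hx], le_rfl⟩
      · rw [List.getLast?_cons] at hx ⊢
        simp only [Option.some.injEq] at hx ⊢
        refine ⟨_, rfl, ?_⟩
        cases h : l.getLast? <;> simp_all
        omega
    · simp only [hb, if_false] at hx
      have hd1 : d ≠ 1 := by
        rintro rfl
        simp at h1
        exact hb h1
      have hdl : d ∈ l := by grind
      rcases hne : (removeBox d l).getLast? with _ | z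
      · rw [List.getLast?_eq_none_iff] at hne
        have := length_removeBox hdl
        rw [if_neg hd1, hne] at this
        rcases l with _ | ⟨y, l⟩
        · simp at hdl
        · simp at this
      · rw [List.getLast?_cons, hne] at hx
        simp at hx
        subst hx
        obtain ⟨y, hy, hle⟩ := ih hne hdl (fun h => absurd h hd1)
        exact ⟨y, by simp [List.getLast?_cons, hy], hle⟩

/-- If the first strip has length at least `2` then so does the top row. -/
theorem IsColumnWord.two_le_getLast {l e : List ℕ} (hl : 0 ∉ l) (h : IsColumnWord l e) {x : ℕ}
    (hx : (stripSizes e).getLast? = some x) (h2 : 2 ≤ x) :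
    ∃ y, l.getLast? = some y ∧ 2 ≤ y := by
  induction e generalizing l x with
  | nil => simp [stripSizes] at hx
  | cons d e ih =>
    have hl' := zero_notMem_removeBox hl d
    have step : ∀ x, (stripSizes e).getLast? = some x → 2 ≤ x →
        ∃ y, l.getLast? = some y ∧ 2 ≤ y := by
      intro x hx h2
      obtain ⟨y, hy, hy2⟩ := ih hl' h.2.1 hx h2
      obtain ⟨z, hz, hyz⟩ := getLast?_removeBox h.1 hy
      exact ⟨z, hz, hy2.trans hyz⟩
    have hlen := h.length_eq
    have hlen2 := h.length_stripSizes
    have hd0 := h.1.pos hl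
    -- With one strip so far, a letter `d ≠ 1` leaves a single row, whose length is `d`. With more
    -- strips, the last letter does not affect the first strip.
    rcases hs : stripSizes e with _ | ⟨g, _ | ⟨g', s⟩⟩
    · have he : e = [] := by
        by_contra hne
        exact stripSizes_ne_nil hne hs
      subst he
      have hd1 : d = 1 := by
        by_contra hd1
        exact h.ne_nil_of_ne_one hd1 rfl
      simp [stripSizes, hd1] at hx
      omega
    · rw [hs] at step
      by_cases hd1 : d = 1
      · simp only [stripSizes, hd1, if_true, hs] at hx
        exact step x (by simpa using hx) h2
      · simp only [stripSizes, hd1, if_false, hs, lengthen, List.length_cons,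
          List.length_nil] at hlen2
        rw [← hlen2] at hlen
        have h3 := h.1.1
        rcases l with _ | ⟨b, _ | _⟩
        · simp at hlen
        · simp only [List.mem_singleton] at h3
          exact ⟨b, rfl, by omega⟩
        · simp at hlen
    · rw [hs] at step
      refine step x ?_ h2
      simp only [stripSizes, hs, lengthen] at hx
      split at hx <;> simpa [List.getLast?_cons] using hx

/-- For shapes of peak compositions, all rows have length at least `2` if and only if all strips
do. -/
theorem IsColumnWord.forall_two_le_iff {l e : List ℕ} (hl : 0 ∉ l) (h : IsColumnWord l e)
    (hp : ∀ x ∈ l.dropLast, 2 ≤ x) : (∀ x ∈ l, 2 ≤ x) ↔ ∀ x ∈ stripSizes e, 2 ≤ x := by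
  refine ⟨h.two_le_stripSizes hl, fun h2 => ?_⟩
  rcases e.eq_nil_or_concat with rfl | ⟨e', d, he⟩
  · simp [show l = [] from h]
  · have hne : stripSizes e ≠ [] := stripSizes_ne_nil (by rw [he]; simp)
    -- Only the top row is not covered by `hp`, and the first strip controls it.
    obtain ⟨y, hy, hy2⟩ := h.two_le_getLast hl (List.getLast?_eq_getLast_of_ne_nil hne)
      (h2 _ (List.getLast_mem hne))
    intro x hx
    rw [← List.dropLast_append_getLast? y hy] at hx
    rcases List.mem_append.1 hx with h3 | h3
    · exact hp x h3
    · simp only [List.mem_singleton] at h3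
      omega

/-! ### Words of standard tableaux -/

/-- The row lengths of the diagram that is filled by adding boxes to the rows of a word (last
letter first). -/
def rowShape : List ℕ → List ℕ
  | [] => []
  | r :: w => lengthen r (rowShape w)

/-- Words (last letter first) of the rows of the entries of a standard filling in which the entries
up to any bound fill the diagram of a peak composition. -/
def IsRowWord : List ℕ → Prop
  | [] => True
  | r :: w => IsRowWord w ∧ r ≤ (rowShape w).length ∧
      (r = (rowShape w).length → ∀ x ∈ rowShape w, 2 ≤ x)

/-- The shape of a word of columns (last letter first). -/
def columnShape : List ℕ → List ℕ
  | [] => []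
  | c :: w => addBox c (columnShape w)

/-- Words (last letter first) of the columns of the entries of a standard peak Young composition
tableau. -/
def IsYoungWord : List ℕ → Prop
  | [] => True
  | c :: w => IsYoungWord w ∧ CanAdd c (columnShape w) ∧ (c = 1 → ∀ x ∈ columnShape w, 2 ≤ x)

/-- The positions `i` such that `R` relates the letters in positions `i` and `i + 1` of a word (last
letter first). -/
def descentSet (R : ℕ → ℕ → Prop) [DecidableRel R] : List ℕ → Finset ℕ
  | [] => ∅
  | [_] => ∅
  | b :: a :: w => if R a b then insert (w.length + 1) (descentSet R (a :: w))
      else descentSet R (a :: w)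

/-- Insertion of a word of rows: the column word of the recording tableau, and the column word of
the insertion tableau. -/
def insertWord : List ℕ → List ℕ × List ℕ
  | [] => ([], [])
  | r :: w =>
    let p := insertWord w
    let q := insertStep (columnShape p.2) p.1 r
    (q.1, q.2 :: p.2)

theorem IsYoungWord.zero_notMem {w : List ℕ} (hw : IsYoungWord w) : 0 ∉ columnShape w := by
  induction w with
  | nil => simp [columnShape]
  | cons c w ih => exact zero_notMem_addBox (ih hw.1) hw.2.1

theorem addBox_one {l : List ℕ} (hl : 0 ∉ l) : addBox 1 l = l ++ [1] := by
  induction l with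
  | nil => rfl
  | cons b l ih =>
    simp only [List.mem_cons, not_or] at hl
    have : ¬ (b + 1 = 1 ∧ b ∉ l) := by omega
    simp only [addBox, if_neg this, ih hl.2, List.cons_append]

theorem dropLast_addBox {l : List ℕ} {c : ℕ} (hc : c - 1 ∈ l) (h2 : 2 ≤ c)
    (hp : ∀ x ∈ l.dropLast, 2 ≤ x) : ∀ x ∈ (addBox c l).dropLast, 2 ≤ x := by
  induction l with
  | nil => simp at hc
  | cons b l ih =>
    by_cases hb : b + 1 = c ∧ b ∉ l
    · simp only [addBox, if_pos hb]
      rcases l with _ | ⟨x, l⟩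
      · simp
      · simp only [List.dropLast_cons_cons, List.mem_cons, forall_eq_or_imp] at hp ⊢
        exact ⟨h2, hp.2⟩
    · have hcl : c - 1 ∈ l := by
        rcases List.mem_cons.1 hc with h | h
        · by_contra h'
          exact hb ⟨by omega, by rwa [← h]⟩
        · exact h
      simp only [addBox, if_neg hb]
      rcases l with _ | ⟨x, l⟩
      · simp at hcl
      · simp only [List.dropLast_cons_cons, List.mem_cons, forall_eq_or_imp] at hp
        have := ih hcl hp.2
        have hne : addBox c (x :: l) ≠ [] := by
          simp only [addBox]
          split <;> simp
        rw [List.dropLast_cons_of_ne_nil hne]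
        simp only [List.mem_cons, forall_eq_or_imp]
        exact ⟨hp.1, this⟩

theorem IsYoungWord.dropLast {w : List ℕ} (hw : IsYoungWord w) :
    ∀ x ∈ (columnShape w).dropLast, 2 ≤ x := by
  induction w with
  | nil => simp [columnShape]
  | cons c w ih =>
    obtain ⟨h1, h2, h3⟩ := hw
    have hz := h1.zero_notMem
    simp only [columnShape]
    by_cases hc : c = 1
    · subst hc
      rw [addBox_one hz]
      simpa using h3 rfl
    · have := h2.pos hz
      exact dropLast_addBox (h2.resolve_left hc) (by omega) (ih h1)

/-! ### Insertion of whole words -/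

/-- Strip lengths follow the row lengths, so a row index is a valid strip index. A new row
corresponds to a new strip and to a new box in column `1`, where the two peak conditions agree by
`IsColumnWord.forall_two_le_iff`. -/
theorem insertWord_spec {w : List ℕ} (hw : IsRowWord w) :
    IsYoungWord (insertWord w).2 ∧ IsColumnWord (columnShape (insertWord w).2) (insertWord w).1 ∧
      stripSizes (insertWord w).1 = rowShape w := by
  induction w with
  | nil => exact ⟨trivial, rfl, rfl⟩
  | cons r w ih =>
    obtain ⟨h1, h2, h3⟩ := hw
    obtain ⟨hY, hC, hs⟩ := ih h1
    have hz := hY.zero_notMem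
    have hlen := hC.length_stripSizes
    rw [hs] at hlen
    have H := insertStep_spec hz hC (hlen ▸ h2)
    refine ⟨⟨hY, H.canAdd, fun h => ?_⟩, H.word, ?_⟩
    · rw [hC.forall_two_le_iff hz hY.dropLast, hs]
      exact h3 (by rw [hlen]; exact H.eq_one.1 h)
    · rw [rowShape, ← hs]
      exact H.sizes

theorem insertWord_injective {v w : List ℕ} (hv : IsRowWord v) (hw : IsRowWord w)
    (h : insertWord v = insertWord w) : v = w := by
  induction v generalizing w with
  | nil =>
    rcases w with _ | ⟨s, w⟩
    · rfl
    · simp [insertWord] at h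
  | cons r v ih =>
    rcases w with _ | ⟨s, w⟩
    · simp [insertWord] at h
    · obtain ⟨hY, hC, hs⟩ := insertWord_spec hv.1
      obtain ⟨hY', hC', hs'⟩ := insertWord_spec hw.1
      have hlen := hC.length_stripSizes
      rw [hs] at hlen
      have hlen' := hC'.length_stripSizes
      rw [hs'] at hlen'
      simp only [insertWord, Prod.mk.injEq, List.cons.injEq] at h
      obtain ⟨h1, h2, h3⟩ := h
      rw [← h3] at h1 h2 hC'
      obtain ⟨h4, h5⟩ := insertStep_injective hY.zero_notMem hC hC' (hlen ▸ hv.2.1)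
        (hlen' ▸ hw.2.1) (Prod.ext h1 h2)
      rw [h5, ih hv.1 hw.1 (Prod.ext h4 h3)]

theorem exists_insertWord {e u : List ℕ} (hu : IsYoungWord u)
    (he : IsColumnWord (columnShape u) e) : ∃ w, IsRowWord w ∧ insertWord w = (e, u) := by
  induction u generalizing e with
  | nil => exact ⟨[], trivial, by rw [insertWord, he.eq_nil_iff.1 rfl]⟩
  | cons c u ih =>
    obtain ⟨h1, h2, h3⟩ := hu
    have hz := h1.zero_notMem
    obtain ⟨e', r, he', hr, hstep⟩ := exists_insertStep hz h2 he
    obtain ⟨w, hw, hwe⟩ := ih h1 he'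
    obtain ⟨hY, hC, hs⟩ := insertWord_spec hw
    have H := insertStep_spec hz he' hr
    rw [hwe] at hC hs
    rw [hstep] at H
    have hlen := hC.length_stripSizes
    rw [hs] at hlen
    refine ⟨r :: w, ⟨hw, hlen ▸ hr, fun h => ?_⟩, ?_⟩
    · rw [← hs, ← hC.forall_two_le_iff hz h1.dropLast]
      exact h3 (H.eq_one.2 (by rw [h, hlen]))
    · simp only [insertWord, hwe, hstep]

theorem length_insertWord (w : List ℕ) : (insertWord w).2.length = w.length := by
  induction w with
  | nil => rfl
  | cons r w ih => simp [insertWord, ih]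

theorem descentSet_insertWord {w : List ℕ} (hw : IsRowWord w) :
    descentSet (· ≥ ·) (insertWord w).2 = descentSet (· < ·) w := by
  induction w with
  | nil => rfl
  | cons s w ih =>
    rcases w with _ | ⟨r, w⟩
    · rfl
    · have ih := ih hw.1
      obtain ⟨hY, hC, hs⟩ := insertWord_spec hw.1.1
      obtain ⟨hY', hC', hs'⟩ := insertWord_spec hw.1
      have hlen := hC.length_stripSizes
      rw [hs] at hlen
      have hlen' := hC'.length_stripSizes
      rw [hs'] at hlen'
      have := insertStep_descent (s := s) hY.zero_notMem hC (hlen ▸ hw.1.2.1)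
        (by have := hw.2.1; rw [hlen'] at this; exact this)
      have h0 : (insertWord (s :: r :: w)).2 =
          (insertStep (addBox (insertStep (columnShape (insertWord w).2) (insertWord w).1 r).2
            (columnShape (insertWord w).2)) (insertStep (columnShape (insertWord w).2)
            (insertWord w).1 r).1 s).2 ::
          (insertStep (columnShape (insertWord w).2) (insertWord w).1 r).2 ::
          (insertWord w).2 := rfl
      have h1 : (insertWord (r :: w)).2 =
          (insertStep (columnShape (insertWord w).2) (insertWord w).1 r).2 ::
          (insertWord w).2 := rfl
      rw [h1] at ih
      rw [h0, descentSet, descentSet, ih, length_insertWord]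
      exact if_congr this rfl rfl

/-- Insertion as a bijection. -/
noncomputable def insertEquiv (a : List ℕ) :
    {w : List ℕ // IsRowWord w ∧ rowShape w = a} ≃
      {p : List ℕ × List ℕ // IsYoungWord p.2 ∧ IsColumnWord (columnShape p.2) p.1 ∧
        stripSizes p.1 = a} :=
  Equiv.ofBijective
    (fun w => ⟨insertWord w.1, by
      have := insertWord_spec w.2.1
      exact ⟨this.1, this.2.1, this.2.2.trans w.2.2⟩⟩) (by
    constructor
    · intro v w h
      exact Subtype.ext (insertWord_injective v.2.1 w.2.1 (congrArg Subtype.val h))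
    · rintro ⟨⟨e, u⟩, hu, he, hs⟩
      obtain ⟨w, hw, h⟩ := exists_insertWord hu he
      refine ⟨⟨w, hw, ?_⟩, Subtype.ext h⟩
      rw [← (insertWord_spec hw).2.2, h]
      exact hs)

theorem insertEquiv_snd (a : List ℕ) (w : {w : List ℕ // IsRowWord w ∧ rowShape w = a}) :
    descentSet (· ≥ ·) (insertEquiv a w).1.2 = descentSet (· < ·) w.1 :=
  descentSet_insertWord w.2.1

section
/-! ### Row words of standard fillings -/

/-- The word `f (k - 1), …, f 1, f 0`. -/
def wordOf (f : ℕ → ℕ) : ℕ → List ℕ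
  | 0 => []
  | k + 1 => f k :: wordOf f k

theorem length_wordOf (f : ℕ → ℕ) (k : ℕ) : (wordOf f k).length = k := by
  induction k with
  | zero => rfl
  | succ k ih => simp [wordOf, ih]

theorem wordOf_congr {f g : ℕ → ℕ} {k : ℕ} (h : ∀ i < k, f i = g i) : wordOf f k = wordOf g k := by
  induction k with
  | zero => rfl
  | succ k ih => rw [wordOf, wordOf, h k (by omega), ih fun i hi => h i (by omega)]

theorem eq_of_wordOf_eq {f g : ℕ → ℕ} {k : ℕ} (h : wordOf f k = wordOf g k) :
    ∀ i < k, f i = g i := by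
  induction k with
  | zero => simp
  | succ k ih =>
    simp only [wordOf, List.cons.injEq] at h
    intro i hi
    rcases Nat.lt_succ_iff_lt_or_eq.1 hi with hi | rfl
    · exact ih h.2 i hi
    · exact h.1

theorem exists_wordOf (w : List ℕ) : ∃ f, wordOf f w.length = w := by
  induction w with
  | nil => exact ⟨id, rfl⟩
  | cons a w ih =>
    obtain ⟨f, hf⟩ := ih
    refine ⟨Function.update f w.length a, ?_⟩
    rw [List.length_cons, wordOf, Function.update_self]
    congr 1
    rw [← hf, length_wordOf]
    exact wordOf_congr fun i hi => Function.update_of_ne (by omega) _ _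

theorem count_wordOf_mono (f : ℕ → ℕ) (r : ℕ) : Monotone fun k => (wordOf f k).count r :=
  monotone_nat_of_le_succ fun k => by simp [wordOf, List.count_cons]

theorem descentSet_wordOf (R : ℕ → ℕ → Prop) [DecidableRel R] (f : ℕ → ℕ) (n : ℕ) :
    descentSet R (wordOf f n) = (Finset.Icc 1 (n - 1)).filter fun i => R (f (i - 1)) (f i) := by
  induction n with
  | zero => rfl
  | succ n ih =>
    rcases n with _ | n
    · rfl
    · have h1 : descentSet R (wordOf f (n + 1 + 1)) = if R (f n) (f (n + 1)) then
          insert (n + 1) (descentSet R (wordOf f (n + 1))) else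
          descentSet R (wordOf f (n + 1)) := by
        rw [wordOf, wordOf, descentSet, length_wordOf]
      rw [h1, ih]
      ext i
      simp only [Nat.add_sub_cancel, Finset.mem_filter, Finset.mem_Icc]
      split_ifs with h
      · simp only [Finset.mem_insert, Finset.mem_filter, Finset.mem_Icc]
        constructor
        · rintro (rfl | h2)
          · exact ⟨by omega, h⟩
          · exact ⟨by omega, h2.2⟩
        · rintro ⟨h2, h3⟩
          by_cases hi : i = n + 1
          · exact Or.inl hi
          · exact Or.inr ⟨by omega, h3⟩
      · simp only [Finset.mem_filter, Finset.mem_Icc]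
        constructor
        · rintro ⟨h2, h3⟩
          exact ⟨by omega, h3⟩
        · rintro ⟨h2, h3⟩
          refine ⟨⟨h2.1, ?_⟩, h3⟩
          by_contra hi
          have : i = n + 1 := by omega
          subst this
          exact h h3

variable {n : ℕ} {β : Composition n}

theorem mem_diagram {c r : ℕ} : (c, r + 1) ∈ diagram β ↔ 1 ≤ c ∧ c ≤ β.blocks.getD r 0 := by
  simp only [diagram, Finset.mem_biUnion, Finset.mem_univ, true_and, Finset.mem_product,
    Finset.mem_Icc, Finset.mem_singleton, Nat.add_right_cancel_iff]
  constructor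
  · rintro ⟨i, h, rfl⟩
    have : (i : ℕ) < β.blocks.length := i.2
    rw [List.getD_eq_getElem _ _ this]
    exact h
  · rintro ⟨h1, h2⟩
    have hr : r < β.blocks.length := by
      by_contra hr
      rw [List.getD_eq_default _ _ (by omega)] at h2
      omega
    rw [List.getD_eq_getElem _ _ hr] at h2
    exact ⟨⟨r, hr⟩, ⟨h1, h2⟩, rfl⟩

theorem zero_notMem_diagram (c : ℕ) : (c, 0) ∉ diagram β := by
  simp [diagram]

theorem Box.one_le_row (b : Box β) : 1 ≤ b.row := by
  obtain ⟨⟨c, r⟩, h⟩ := b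
  rcases r with _ | r
  · exact absurd h (zero_notMem_diagram c)
  · simp [Box.row]

theorem Box.one_le_col (b : Box β) : 1 ≤ b.col := by
  obtain ⟨⟨c, r⟩, h⟩ := b
  rcases r with _ | r
  · exact absurd h (zero_notMem_diagram c)
  · exact (mem_diagram.1 h).1

theorem Box.ext {b b' : Box β} (h1 : b.col = b'.col) (h2 : b.row = b'.row) : b = b' :=
  Subtype.ext (Prod.ext h1 h2)

theorem Box.exists_of_le (b : Box β) {c : ℕ} (h1 : 1 ≤ c) (h2 : c ≤ b.col) :
    ∃ d : Box β, d.col = c ∧ d.row = b.row := by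
  obtain ⟨⟨c', r⟩, h⟩ := b
  rcases r with _ | r
  · exact absurd h (zero_notMem_diagram c')
  · refine ⟨⟨(c, r + 1), mem_diagram.2 ⟨h1, ?_⟩⟩, rfl, rfl⟩
    exact le_trans h2 (mem_diagram.1 h).2

/-- Row-increasing standard fillings. -/
structure IsRowStandard (Q : Filling β (Entry n)) : Prop where
  bijective : Function.Bijective Q
  row_increasing : ∀ b b' : Box β, b.row = b'.row → b.col < b'.col → Q b < Q b'

/-- The row (counted from `0`) of the entry `k + 1`. -/
def rowAt (Q : Filling β (Entry n)) (k : ℕ) : ℕ :=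
  ∑ b : Box β with (Q b : ℕ) = k + 1, (b.row - 1)

/-- The column of the entry `k + 1`. -/
def colAt (Q : Filling β (Entry n)) (k : ℕ) : ℕ :=
  ∑ b : Box β with (Q b : ℕ) = k + 1, b.col

theorem filter_entry_eq {Q : Filling β (Entry n)} (hQ : Function.Injective Q) {b : Box β} {k : ℕ}
    (hb : (Q b : ℕ) = k) : (Finset.univ.filter fun b : Box β => (Q b : ℕ) = k) = {b} := by
  ext b'
  simp only [Finset.mem_filter, Finset.mem_univ, true_and, Finset.mem_singleton]
  constructor
  · intro h
    exact hQ (Subtype.ext (h.trans hb.symm))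
  · rintro rfl
    exact hb

theorem rowAt_eq {Q : Filling β (Entry n)} (hQ : Function.Injective Q) {b : Box β} {k : ℕ}
    (hb : (Q b : ℕ) = k + 1) : rowAt Q k + 1 = b.row := by
  rw [rowAt, filter_entry_eq hQ hb, Finset.sum_singleton]
  have := b.one_le_row
  omega

theorem colAt_eq {Q : Filling β (Entry n)} (hQ : Function.Injective Q) {b : Box β} {k : ℕ}
    (hb : (Q b : ℕ) = k + 1) : colAt Q k = b.col := by
  rw [colAt, filter_entry_eq hQ hb, Finset.sum_singleton]

theorem exists_entry {Q : Filling β (Entry n)} (hQ : Function.Surjective Q) {k : ℕ} (hk : k < n) :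
    ∃ b, (Q b : ℕ) = k + 1 := by
  obtain ⟨b, hb⟩ := hQ ⟨k + 1, by simp; omega⟩
  exact ⟨b, by rw [hb]⟩

theorem exists_entry_eq (Q : Filling β (Entry n)) (b : Box β) :
    ∃ k, k < n ∧ (Q b : ℕ) = k + 1 := by
  have := Finset.mem_Icc.1 (Q b).2
  exact ⟨Q b - 1, by omega, by omega⟩

theorem count_rowAt {Q : Filling β (Entry n)} (hQ : Function.Bijective Q) (r : ℕ) {k : ℕ}
    (hk : k ≤ n) : (wordOf (rowAt Q) k).count r =
      (Finset.univ.filter fun b : Box β => b.row = r + 1 ∧ (Q b : ℕ) ≤ k).card := by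
  induction k with
  | zero =>
    rw [wordOf, List.count_nil, eq_comm, Finset.card_eq_zero, Finset.filter_eq_empty_iff]
    rintro b - ⟨-, h⟩
    have := Finset.mem_Icc.1 (Q b).2
    omega
  | succ k ih =>
    obtain ⟨b, hb⟩ := exists_entry hQ.2 hk
    have hrow := rowAt_eq hQ.1 hb
    rw [wordOf, List.count_cons, ih (by omega)]
    simp only [beq_iff_eq]
    have hiff : ∀ b' : Box β, (Q b' : ℕ) = k + 1 → b' = b := fun b' h =>
      hQ.1 (Subtype.ext (h.trans hb.symm))
    split_ifs with h
    · have : (Finset.univ.filter fun b : Box β => b.row = r + 1 ∧ (Q b : ℕ) ≤ k + 1) =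
          insert b (Finset.univ.filter fun b : Box β => b.row = r + 1 ∧ (Q b : ℕ) ≤ k) := by
        ext b'
        simp only [Finset.mem_filter, Finset.mem_univ, true_and, Finset.mem_insert]
        constructor
        · rintro ⟨h1, h2⟩
          by_cases h3 : (Q b' : ℕ) = k + 1
          · exact Or.inl (hiff b' h3)
          · exact Or.inr ⟨h1, by omega⟩
        · rintro (rfl | h1)
          · exact ⟨by omega, by omega⟩
          · exact ⟨h1.1, by omega⟩
      rw [this, Finset.card_insert_of_notMem]
      simp only [Finset.mem_filter, Finset.mem_univ, true_and, not_and]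
      omega
    · rw [add_zero]
      congr 1
      ext b'
      simp only [Finset.mem_filter, Finset.mem_univ, true_and]
      refine ⟨fun h1 => ⟨h1.1, by omega⟩, fun h1 => ⟨h1.1, ?_⟩⟩
      by_contra h2
      have := hiff b' (by omega)
      subst this
      omega

theorem eq_Icc_of_downward {S : Finset ℕ} (h0 : ∀ x ∈ S, 1 ≤ x)
    (h : ∀ x ∈ S, ∀ y, 1 ≤ y → y ≤ x → y ∈ S) : S = Finset.Icc 1 S.card := by
  have : S = Finset.Icc 1 (S.sup id) := by
    ext x
    rw [Finset.mem_Icc]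
    constructor
    · intro hx
      exact ⟨h0 x hx, Finset.le_sup (f := id) hx⟩
    · rintro ⟨h1, h2⟩
      have hne : S.Nonempty := by
        rw [Finset.nonempty_iff_ne_empty]
        rintro rfl
        simp at h2
        omega
      obtain ⟨y, hy, hy'⟩ := Finset.exists_mem_eq_sup S hne id
      exact h y hy x h1 (by rw [hy'] at h2; exact h2)
  conv_rhs => rw [this]
  rw [Nat.card_Icc, Nat.add_sub_cancel]
  exact this

/-- The boxes of a row that are filled first are the first ones of the row. -/
theorem IsRowStandard.exists_le_iff {Q : Filling β (Entry n)} (hQ : IsRowStandard Q) {c r k : ℕ}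
    (hc : 1 ≤ c) (hk : k ≤ n) :
    (∃ b : Box β, b.col = c ∧ b.row = r + 1 ∧ (Q b : ℕ) ≤ k) ↔
      c ≤ (wordOf (rowAt Q) k).count r := by
  set S := (Finset.univ.filter fun b : Box β => b.row = r + 1 ∧ (Q b : ℕ) ≤ k).image Box.col
    with hS
  have hmem : ∀ c, c ∈ S ↔ ∃ b : Box β, b.col = c ∧ b.row = r + 1 ∧ (Q b : ℕ) ≤ k := by
    intro c
    simp only [hS, Finset.mem_image, Finset.mem_filter, Finset.mem_univ, true_and]
    constructor
    · rintro ⟨b, h1, h2⟩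
      exact ⟨b, h2, h1⟩
    · rintro ⟨b, h2, h1⟩
      exact ⟨b, h1, h2⟩
  have hcard : S.card = (wordOf (rowAt Q) k).count r := by
    rw [count_rowAt hQ.bijective r hk, hS, Finset.card_image_of_injOn]
    intro b hb b' hb' h
    simp only [Finset.coe_filter, Finset.mem_univ, true_and, Set.mem_ofPred_eq] at hb hb'
    exact Box.ext h (hb.1.trans hb'.1.symm)
  have hIcc := eq_Icc_of_downward (S := S) (fun x hx => by
    obtain ⟨b, rfl, -⟩ := (hmem x).1 hx
    exact b.one_le_col) (fun x hx y hy hyx => by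
    obtain ⟨b, rfl, h1, h2⟩ := (hmem x).1 hx
    obtain ⟨d, hd1, hd2⟩ := b.exists_of_le hy hyx
    refine (hmem y).2 ⟨d, hd1, hd2.trans h1, ?_⟩
    rcases hyx.eq_or_lt with h | h
    · rwa [Box.ext (hd1.trans h) hd2]
    · have := hQ.row_increasing d b hd2 (by omega)
      exact le_trans (le_of_lt this) h2)
  rw [← hmem, hIcc, Finset.mem_Icc, hcard]
  exact ⟨And.right, fun h => ⟨hc, h⟩⟩

theorem IsRowStandard.count_eq {Q : Filling β (Entry n)} (hQ : IsRowStandard Q) (r : ℕ) :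
    (wordOf (rowAt Q) n).count r = β.blocks.getD r 0 := by
  have : ∀ c, 1 ≤ c → (c ≤ (wordOf (rowAt Q) n).count r ↔ c ≤ β.blocks.getD r 0) := by
    intro c hc
    rw [← hQ.exists_le_iff hc le_rfl]
    constructor
    · rintro ⟨⟨⟨x, y⟩, h⟩, rfl, hy, -⟩
      simp only [Box.row] at hy
      subst hy
      exact (mem_diagram.1 h).2
    · intro h
      refine ⟨⟨(c, r + 1), mem_diagram.2 ⟨hc, h⟩⟩, rfl, rfl, ?_⟩
      exact (Finset.mem_Icc.1 (Q _).2).2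
  apply le_antisymm
  · rcases Nat.eq_zero_or_pos ((wordOf (rowAt Q) n).count r) with h | h
    · omega
    · exact (this _ h).1 le_rfl
  · rcases Nat.eq_zero_or_pos (β.blocks.getD r 0) with h | h
    · omega
    · exact (this _ h).2 le_rfl

/-- Rows are filled from left to right, so the column is determined by the number of earlier letters
for the same row; the rows alone encode the filling. -/
theorem IsRowStandard.colAt_eq_count {Q : Filling β (Entry n)} (hQ : IsRowStandard Q) {k : ℕ}
    (hk : k < n) : colAt Q k = (wordOf (rowAt Q) k).count (rowAt Q k) + 1 := by
  obtain ⟨b, hb⟩ := exists_entry hQ.bijective.2 hk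
  rw [colAt_eq hQ.bijective.1 hb]
  have hr := rowAt_eq hQ.bijective.1 hb
  have hc := b.one_le_col
  have h1 := (hQ.exists_le_iff (r := rowAt Q k) hc (show k + 1 ≤ n from hk)).1 ⟨b, rfl, hr.symm, hb.le⟩
  rw [wordOf, List.count_cons_self] at h1
  refine le_antisymm h1 ?_
  by_contra h2
  obtain ⟨d, hd1, hd2, hd3⟩ := (hQ.exists_le_iff hc hk.le).2 (by omega :
    b.col ≤ (wordOf (rowAt Q) k).count (rowAt Q k))
  have : d = b := Box.ext hd1 (hd2.trans hr)
  subst this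
  omega

theorem IsRowStandard.eq_of_rowAt {Q Q' : Filling β (Entry n)} (hQ : IsRowStandard Q)
    (hQ' : IsRowStandard Q') (h : ∀ k < n, rowAt Q k = rowAt Q' k) : Q = Q' := by
  funext b
  obtain ⟨k, hk, hb⟩ := exists_entry_eq Q b
  obtain ⟨b', hb'⟩ := exists_entry hQ'.bijective.2 hk
  have h1 : b = b' := by
    refine Box.ext ?_ ?_
    · rw [← colAt_eq hQ.bijective.1 hb, ← colAt_eq hQ'.bijective.1 hb', hQ.colAt_eq_count hk,
        hQ'.colAt_eq_count hk, h k hk, wordOf_congr fun i hi => h i (by omega)]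
    · rw [← rowAt_eq hQ.bijective.1 hb, ← rowAt_eq hQ'.bijective.1 hb', h k hk]
  subst h1
  exact Subtype.ext (hb.trans hb'.symm)

theorem exists_filling {f : ℕ → ℕ} (hf : ∀ r, (wordOf f n).count r = β.blocks.getD r 0) :
    ∃ Q : Filling β (Entry n), IsRowStandard Q ∧ ∀ k < n, rowAt Q k = f k := by
  -- Entry `k + 1` goes into the next free box of its row; the prescribed multiplicities keep it
  -- inside the diagram.
  let g : Fin n → Box β := fun k => ⟨((wordOf f k).count (f k) + 1, f k + 1),
    mem_diagram.2 ⟨by omega, by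
      rw [← hf]
      refine le_trans ?_ (count_wordOf_mono f (f k) (show (k : ℕ) + 1 ≤ n from k.2))
      simp [wordOf]⟩⟩
  have hlt : ∀ i j : Fin n, i < j → f i = f j →
      (wordOf f i).count (f i) < (wordOf f j).count (f j) := by
    intro i j hij h
    rw [← h]
    refine lt_of_lt_of_le ?_ (count_wordOf_mono f (f i) (show (i : ℕ) + 1 ≤ j from hij))
    simp [wordOf]
  have hg : Function.Injective g := by
    intro i j hij
    simp only [g, Subtype.mk.injEq, Prod.mk.injEq, Nat.add_right_cancel_iff] at hij
    rcases lt_trichotomy i j with h | h | h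
    · have := hlt i j h hij.2
      omega
    · exact h
    · have := hlt j i h hij.2.symm
      omega
  have hgb : Function.Bijective g :=
    (Fintype.bijective_iff_injective_and_card g).2 ⟨hg, by rw [Fintype.card_fin, card_box]⟩
  let e := Equiv.ofBijective g hgb
  let Q : Filling β (Entry n) := fun b => ⟨(e.symm b : ℕ) + 1, by
    have := (e.symm b).2
    simp only [Finset.mem_Icc]
    omega⟩
  have hQg : ∀ k : Fin n, (Q (g k) : ℕ) = k + 1 := by
    intro k
    have : e.symm (g k) = k := e.symm_apply_apply k
    simp only [Q, this]
  have hQb : Function.Bijective Q := by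
    constructor
    · intro b b' h
      simp only [Q, Subtype.mk.injEq, Nat.add_right_cancel_iff] at h
      exact e.symm.injective (Fin.ext h)
    · rintro ⟨k, hk⟩
      have hk' := Finset.mem_Icc.1 hk
      refine ⟨g ⟨k - 1, by omega⟩, Subtype.ext ?_⟩
      rw [hQg]
      simp only
      omega
  refine ⟨Q, ⟨hQb, ?_⟩, ?_⟩
  · intro b b' hr hc
    obtain ⟨i, rfl⟩ := hgb.2 b
    obtain ⟨j, rfl⟩ := hgb.2 b'
    rw [← Subtype.coe_lt_coe, hQg, hQg]
    simp only [g, Box.row, Box.col] at hr hc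
    rcases lt_trichotomy i j with h | h | h
    · have : (i : ℕ) < j := h
      omega
    · subst h
      omega
    · have := hlt j i h (by omega)
      omega
  · intro k hk
    have := rowAt_eq hQb.1 (hQg ⟨k, hk⟩)
    simp only [g, Box.row] at this
    omega

/-- Row-increasing standard fillings correspond to words with given letter multiplicities. -/
noncomputable def fillingEquiv (β : Composition n) :
    {Q : Filling β (Entry n) // IsRowStandard Q} ≃
      {w : List ℕ // w.length = n ∧ ∀ r, w.count r = β.blocks.getD r 0} :=
  Equiv.ofBijective (fun Q => ⟨wordOf (rowAt Q.1) n, length_wordOf _ _, Q.2.count_eq⟩) (by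
    constructor
    · intro Q Q' h
      exact Subtype.ext (Q.2.eq_of_rowAt Q'.2 (eq_of_wordOf_eq (congrArg Subtype.val h)))
    · rintro ⟨w, hw, hc⟩
      obtain ⟨f, hf⟩ := exists_wordOf w
      rw [hw] at hf
      subst hf
      obtain ⟨Q, hQ, hQf⟩ := exists_filling hc
      exact ⟨⟨Q, hQ⟩, Subtype.ext (wordOf_congr hQf)⟩)

end

section
/-! ### Shapes of words -/

theorem zero_notMem_lengthen {s : List ℕ} (hs : 0 ∉ s) (r : ℕ) : 0 ∉ lengthen r s := by
  induction s generalizing r with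
  | nil => cases r <;> simp [lengthen]
  | cons g s ih =>
    simp only [List.mem_cons, not_or] at hs
    cases r <;> simp [lengthen, hs, ih hs.2]

theorem zero_notMem_rowShape (w : List ℕ) : 0 ∉ rowShape w := by
  induction w with
  | nil => simp [rowShape]
  | cons r w ih => exact zero_notMem_lengthen ih r

theorem getD_lengthen {s : List ℕ} {r : ℕ} (hr : r ≤ s.length) (x : ℕ) :
    (lengthen r s).getD x 0 = s.getD x 0 + if r = x then 1 else 0 := by
  induction s generalizing r x with
  | nil =>
    have : r = 0 := by simpa using hr
    subst this
    rcases x with _ | x <;> simp [lengthen]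
  | cons g s ih =>
    rcases r with _ | r
    · rcases x with _ | x <;> simp [lengthen]
    · rcases x with _ | x
      · simp [lengthen]
      · simp only [List.length_cons, Nat.add_le_add_iff_right] at hr
        simpa [lengthen] using ih hr x

theorem IsRowWord.getD_rowShape {w : List ℕ} (hw : IsRowWord w) (x : ℕ) :
    (rowShape w).getD x 0 = w.count x := by
  induction w with
  | nil => simp [rowShape]
  | cons r w ih =>
    rw [rowShape, getD_lengthen hw.2.1, ih hw.1, List.count_cons]
    simp

theorem getD_eq_zero_iff {s : List ℕ} (hs : 0 ∉ s) {r : ℕ} : s.getD r 0 = 0 ↔ s.length ≤ r := by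
  constructor
  · intro h
    by_contra hr
    rw [List.getD_eq_getElem _ _ (not_le.1 hr)] at h
    exact hs (h ▸ List.getElem_mem _)
  · exact fun h => List.getD_eq_default _ _ h

theorem eq_of_getD_eq {s t : List ℕ} (hs : 0 ∉ s) (ht : 0 ∉ t)
    (h : ∀ r, s.getD r 0 = t.getD r 0) : s = t := by
  have hlen : s.length = t.length := by
    apply le_antisymm
    · rw [← getD_eq_zero_iff hs, h, getD_eq_zero_iff ht]
    · rw [← getD_eq_zero_iff ht, ← h, getD_eq_zero_iff hs]
  refine List.ext_getElem hlen fun i h1 h2 => ?_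
  have := h i
  rwa [List.getD_eq_getElem _ _ h1, List.getD_eq_getElem _ _ h2] at this

theorem zero_notMem_blocks {n : ℕ} (β : Composition n) : 0 ∉ β.blocks :=
  fun h => absurd (β.blocks_pos h) (lt_irrefl 0)

/-- The bound on `r` in `IsRowWord` comes for free: an empty row below a newly opened one would
violate the demand for two boxes. -/
theorem isRowWord_cons {r : ℕ} {w : List ℕ} : IsRowWord (r :: w) ↔
    IsRowWord w ∧ (w.count r = 0 → ∀ x < r, 2 ≤ w.count x) := by
  simp only [IsRowWord]
  refine and_congr_right fun hw => ?_
  have hz := zero_notMem_rowShape w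
  have hc := hw.getD_rowShape
  constructor
  · rintro ⟨h1, h2⟩ h3 x hx
    rw [← hc, getD_eq_zero_iff hz] at h3
    have hx' : x < (rowShape w).length := by omega
    rw [← hc, List.getD_eq_getElem _ _ hx']
    exact h2 (by omega) _ (List.getElem_mem _)
  · intro h
    have hr : r ≤ (rowShape w).length := by
      by_contra hr
      have := h (by rw [← hc, getD_eq_zero_iff hz]; omega) _ (not_le.1 hr)
      rw [← hc, (getD_eq_zero_iff hz).2 le_rfl] at this
      omega
    refine ⟨hr, fun h1 x hx => ?_⟩
    obtain ⟨i, hi, rfl⟩ := List.mem_iff_getElem.1 hx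
    have := h (by rw [← hc, getD_eq_zero_iff hz]; omega) i (by omega)
    rwa [← hc, List.getD_eq_getElem _ _ hi] at this

theorem isRowWord_wordOf {f : ℕ → ℕ} {n : ℕ} : IsRowWord (wordOf f n) ↔
    ∀ k < n, (wordOf f k).count (f k) = 0 → ∀ x < f k, 2 ≤ (wordOf f k).count x := by
  induction n with
  | zero => simp [wordOf, IsRowWord]
  | succ n ih =>
    rw [wordOf, isRowWord_cons, ih]
    constructor
    · rintro ⟨h1, h2⟩ k hk
      rcases Nat.lt_succ_iff_lt_or_eq.1 hk with hk | rfl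
      · exact h1 k hk
      · exact h2
    · exact fun h => ⟨fun k hk => h k (by omega), h n (by omega)⟩

theorem IsRowWord.rowShape_eq_iff {w : List ℕ} (hw : IsRowWord w) {n : ℕ} (β : Composition n) :
    rowShape w = β.blocks ↔ ∀ r, w.count r = β.blocks.getD r 0 := by
  constructor
  · intro h r
    rw [← hw.getD_rowShape, h]
  · intro h
    refine eq_of_getD_eq (zero_notMem_rowShape w) (zero_notMem_blocks β) fun r => ?_
    rw [hw.getD_rowShape, h]

theorem sum_lengthen (r : ℕ) (s : List ℕ) (hr : r ≤ s.length) :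
    (lengthen r s).sum = s.sum + 1 := by
  induction s generalizing r with
  | nil =>
    have : r = 0 := by simpa using hr
    subst this
    rfl
  | cons g s ih =>
    rcases r with _ | r
    · simp only [lengthen, List.sum_cons]
      omega
    · simp only [List.length_cons, Nat.add_le_add_iff_right] at hr
      simp only [lengthen, List.sum_cons, ih r hr]
      omega

theorem IsRowWord.sum_rowShape {w : List ℕ} (hw : IsRowWord w) : (rowShape w).sum = w.length := by
  induction w with
  | nil => rfl
  | cons r w ih => rw [rowShape, sum_lengthen _ _ hw.2.1, ih hw.1, List.length_cons]

/-! ### Standard peak immaculate tableaux -/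

variable {n : ℕ} {β : Composition n}

/-- Standard peak immaculate tableaux: entries increase in rows, and every entry of the first column
is larger than the first two entries of each lower row. -/
structure IsSPIT (Q : Filling β (Entry n)) : Prop extends IsRowStandard Q where
  peak : ∀ b : Box β, b.col = 1 → ∀ r, 1 ≤ r → r < b.row →
    ∃ d : Box β, d.col = 2 ∧ d.row = r ∧ Q d < Q b

theorem IsRowStandard.isSPIT_iff {Q : Filling β (Entry n)} (hQ : IsRowStandard Q) :
    IsSPIT Q ↔ IsRowWord (wordOf (rowAt Q) n) := by
  rw [isRowWord_wordOf]
  constructor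
  · intro h k hk h0 x hx
    obtain ⟨b, hb⟩ := exists_entry hQ.bijective.2 hk
    have hr := rowAt_eq hQ.bijective.1 hb
    have hc := colAt_eq hQ.bijective.1 hb
    rw [hQ.colAt_eq_count hk, h0] at hc
    obtain ⟨d, hd1, hd2, hd3⟩ := h.peak b hc.symm (x + 1) (by omega) (by omega)
    rw [← Subtype.coe_lt_coe, hb] at hd3
    exact (hQ.exists_le_iff (by omega) hk.le).1 ⟨d, hd1, hd2, by omega⟩
  · intro h
    refine ⟨hQ, fun b hb1 r hr1 hr2 => ?_⟩
    obtain ⟨k, hk, hb⟩ := exists_entry_eq Q b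
    have hr := rowAt_eq hQ.bijective.1 hb
    have hc := colAt_eq hQ.bijective.1 hb
    rw [hQ.colAt_eq_count hk, hb1] at hc
    have := h k hk (by omega) (r - 1) (by omega)
    obtain ⟨d, hd1, hd2, hd3⟩ := (hQ.exists_le_iff (by omega) hk.le).2 this
    refine ⟨d, hd1, by omega, ?_⟩
    rw [← Subtype.coe_lt_coe, hb]
    omega

/-- Standard peak immaculate tableaux correspond to row words. -/
noncomputable def spitEquiv (β : Composition n) :
    {Q : Filling β (Entry n) // IsSPIT Q} ≃ {w : List ℕ // IsRowWord w ∧ rowShape w = β.blocks} :=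
  Equiv.ofBijective (fun Q => ⟨wordOf (rowAt Q.1) n, Q.2.toIsRowStandard.isSPIT_iff.1 Q.2, by
    rw [(Q.2.toIsRowStandard.isSPIT_iff.1 Q.2).rowShape_eq_iff]
    exact Q.2.toIsRowStandard.count_eq⟩) (by
    constructor
    · intro Q Q' h
      exact Subtype.ext (Q.2.toIsRowStandard.eq_of_rowAt Q'.2.toIsRowStandard
        (eq_of_wordOf_eq (congrArg Subtype.val h)))
    · rintro ⟨w, hw, hs⟩
      have hlen : w.length = n := by rw [← hw.sum_rowShape, hs, β.blocks_sum]
      obtain ⟨⟨Q, hQ⟩, hQw⟩ := (fillingEquiv β).surjective ⟨w, hlen, (hw.rowShape_eq_iff β).1 hs⟩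
      have hQw : wordOf (rowAt Q) n = w := congrArg Subtype.val hQw
      exact ⟨⟨Q, hQ.isSPIT_iff.2 (hQw ▸ hw)⟩, Subtype.ext hQw⟩)

/-- The `i` such that `i + 1` is in a higher row than `i`. -/
def descentAbove (Q : Filling β (Entry n)) : Finset ℕ :=
  (Finset.Icc 1 (n - 1)).filter fun i =>
    ∃ b b' : Box β, (Q b : ℕ) = i ∧ (Q b' : ℕ) = i + 1 ∧ b.row < b'.row

theorem descentAbove_eq {Q : Filling β (Entry n)} (hQ : Function.Bijective Q) :
    descentAbove Q = descentSet (· < ·) (wordOf (rowAt Q) n) := by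
  rw [descentSet_wordOf, descentAbove]
  refine Finset.filter_congr fun i hi => ?_
  rw [Finset.mem_Icc] at hi
  obtain ⟨b, hb⟩ := exists_entry hQ.2 (show i - 1 < n by omega)
  obtain ⟨b', hb'⟩ := exists_entry hQ.2 (show i < n by omega)
  have h1 := rowAt_eq hQ.1 hb
  have h2 := rowAt_eq hQ.1 hb'
  constructor
  · rintro ⟨d, d', hd, hd', hlt⟩
    have h3 : d = b := hQ.1 (Subtype.ext (by omega))
    have h4 : d' = b' := hQ.1 (Subtype.ext (by omega))
    subst h3 h4
    omega
  · intro h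
    exact ⟨b, b', by omega, hb', by omega⟩

theorem descentLeft_eq {Q : Filling β (Entry n)} (hQ : Function.Bijective Q) :
    descentLeft Q = descentSet (· ≥ ·) (wordOf (colAt Q) n) := by
  rw [descentSet_wordOf, descentLeft]
  refine Finset.filter_congr fun i hi => ?_
  rw [Finset.mem_Icc] at hi
  obtain ⟨b, hb⟩ := exists_entry hQ.2 (show i - 1 < n by omega)
  obtain ⟨b', hb'⟩ := exists_entry hQ.2 (show i < n by omega)
  have h1 := colAt_eq hQ.1 hb
  have h2 := colAt_eq hQ.1 hb'
  constructor
  · rintro ⟨d, d', hd, hd', hlt⟩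
    have h3 : d = b := hQ.1 (Subtype.ext (by omega))
    have h4 : d' = b' := hQ.1 (Subtype.ext (by omega))
    subst h3 h4
    omega
  · intro h
    exact ⟨b, b', by omega, hb', by omega⟩

theorem length_lengthen {s : List ℕ} {r : ℕ} (hr : r ≤ s.length) :
    (lengthen r s).length = max s.length (r + 1) := by
  induction s generalizing r with
  | nil =>
    have : r = 0 := by simpa using hr
    subst this
    rfl
  | cons g s ih =>
    rcases r with _ | r
    · simp [lengthen]
    · simp only [List.length_cons, Nat.add_le_add_iff_right] at hr
      simp only [lengthen, List.length_cons, ih hr]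
      omega

theorem IsRowWord.two_le_getD {w : List ℕ} (hw : IsRowWord w) {i : ℕ}
    (hi : i + 1 < (rowShape w).length) : 2 ≤ (rowShape w).getD i 0 := by
  induction w with
  | nil => simp [rowShape] at hi
  | cons r w ih =>
    obtain ⟨h1, h2, h3⟩ := hw
    rw [rowShape, length_lengthen h2] at hi
    rw [rowShape, getD_lengthen h2]
    by_cases hr : r = (rowShape w).length
    · have hi' : i < (rowShape w).length := by omega
      rw [List.getD_eq_getElem _ _ hi']
      have := h3 hr _ (List.getElem_mem hi')
      omega
    · have := ih h1 (by omega)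
      omega

theorem IsRowWord.dropLast {w : List ℕ} (hw : IsRowWord w) :
    ∀ x ∈ (rowShape w).dropLast, 1 < x := by
  intro x hx
  obtain ⟨i, hi, rfl⟩ := List.mem_iff_getElem.1 hx
  have hi' : i + 1 < (rowShape w).length := by
    simp only [List.length_dropLast] at hi
    omega
  have := hw.two_le_getD hi'
  rw [List.getD_eq_getElem _ _ (by omega)] at this
  rw [List.getElem_dropLast]
  exact this

/-- The entries up to any bound fill the diagram of a peak composition. -/
theorem IsSPIT.isPeakDiagram {Q : Filling β (Entry n)} (hQ : IsSPIT Q) {k : ℕ} (hk : k ≤ n) :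
    IsPeakDiagram ((Finset.univ.filter fun b : Box β => (Q b : ℕ) ≤ k).image Subtype.val) := by
  have hw : IsRowWord (wordOf (rowAt Q) k) := by
    have := hQ.toIsRowStandard.isSPIT_iff.1 hQ
    rw [isRowWord_wordOf] at this ⊢
    exact fun i hi => this i (by omega)
  refine ⟨(rowShape (wordOf (rowAt Q) k)).sum, ⟨rowShape (wordOf (rowAt Q) k), fun {i} hi =>
    Nat.pos_of_ne_zero fun h => zero_notMem_rowShape _ (h ▸ hi), rfl⟩, hw.dropLast, ?_⟩
  ext ⟨c, r⟩
  simp only [Finset.mem_image, Finset.mem_filter, Finset.mem_univ, true_and]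
  rcases r with _ | r
  · refine iff_of_false (zero_notMem_diagram c) ?_
    rintro ⟨b, -, hb⟩
    exact zero_notMem_diagram (β := β) c (hb ▸ b.2)
  · rw [mem_diagram]
    simp only
    rw [hw.getD_rowShape]
    constructor
    · rintro ⟨h1, h2⟩
      obtain ⟨b, rfl, h3, h4⟩ := (hQ.toIsRowStandard.exists_le_iff h1 hk).2 h2
      exact ⟨b, h4, Prod.ext rfl h3⟩
    · rintro ⟨b, h1, h2⟩
      have h3 : Box.col b = c := congrArg Prod.fst h2
      have h4 : Box.row b = r + 1 := congrArg Prod.snd h2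
      have h5 : 1 ≤ c := h3 ▸ Box.one_le_col b
      exact ⟨h5, (hQ.toIsRowStandard.exists_le_iff h5 hk).1 ⟨b, h3, h4, h1⟩⟩

theorem IsPeak.two_mem_diagram {m : ℕ} {γ : Composition m} (hγ : IsPeak γ) {c r r' : ℕ}
    (h : (c, r) ∈ diagram γ) (hr' : 1 ≤ r') (hr : r' < r) : (2, r') ∈ diagram γ := by
  obtain ⟨s, rfl⟩ : ∃ s, r = s + 1 := ⟨r - 1, by omega⟩
  obtain ⟨s', rfl⟩ : ∃ s', r' = s' + 1 := ⟨r' - 1, by omega⟩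
  rw [mem_diagram] at h ⊢
  refine ⟨by omega, ?_⟩
  have hs : s < γ.blocks.length := by
    by_contra hs
    rw [List.getD_eq_default _ _ (by omega)] at h
    omega
  rw [List.getD_eq_getElem _ _ (by omega)]
  refine hγ _ ?_
  have : s' < γ.blocks.dropLast.length := by simp; omega
  rw [← List.getElem_dropLast this]
  exact List.getElem_mem _

/-- Use the hypothesis at the entry of a box in the first column: the rows below it are not the last
row of that peak diagram, so they already contain a second box. -/
theorem IsRowStandard.isSPIT {Q : Filling β (Entry n)} (hQ : IsRowStandard Q)
    (h : ∀ k ≤ n, IsPeakDiagram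
      ((Finset.univ.filter fun b : Box β => (Q b : ℕ) ≤ k).image Subtype.val)) : IsSPIT Q := by
  refine ⟨hQ, fun b hb r hr1 hr2 => ?_⟩
  obtain ⟨m, γ, hγ, hdiag⟩ := h (Q b) (Finset.mem_Icc.1 (Q b).2).2
  have hbm : b.1 ∈ diagram γ := by
    rw [hdiag]
    exact Finset.mem_image_of_mem _ (by simp)
  have := hγ.two_mem_diagram (c := b.col) (r := b.row) hbm hr1 hr2
  rw [hdiag] at this
  obtain ⟨d, hd, hd'⟩ := Finset.mem_image.1 this
  simp only [Finset.mem_filter, Finset.mem_univ, true_and] at hd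
  have h1 : Box.col d = 2 := congrArg Prod.fst hd'
  have h2 : Box.row d = r := congrArg Prod.snd hd'
  refine ⟨d, h1, h2, lt_of_le_of_ne hd fun he => ?_⟩
  have := hQ.bijective.1 he
  subst this
  omega

theorem IsSPIT.first_col {Q : Filling β (Entry n)} (hQ : IsSPIT Q) {b b' : Box β}
    (hb : b.col = 1) (hb' : b'.col = 1) (h : b.row < b'.row) : Q b < Q b' := by
  obtain ⟨d, hd1, hd2, hd3⟩ := hQ.peak b' hb' b.row b.one_le_row h
  exact (hQ.row_increasing b d hd2.symm (by omega)).trans hd3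

end

section
/-! ### Standard peak Young composition tableaux -/

/-- The columns of the boxes that are added according to a row word. -/
def columnWord : List ℕ → List ℕ
  | [] => []
  | r :: w => (w.count r + 1) :: columnWord w

/-- Row words of standard peak Young composition tableaux: a box is only added to the topmost row of
its length. -/
def IsYoungRowWord : List ℕ → Prop
  | [] => True
  | r :: w => IsYoungRowWord w ∧ (w.count r = 0 → ∀ x < r, 2 ≤ w.count x) ∧
      (0 < w.count r → ∀ x > r, w.count x ≠ w.count r)

theorem IsYoungRowWord.isRowWord {w : List ℕ} (hw : IsYoungRowWord w) : IsRowWord w := by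
  induction w with
  | nil => trivial
  | cons r w ih => exact isRowWord_cons.2 ⟨ih hw.1, hw.2.1⟩

/-- Row `r` is the topmost row of its length, hence the one that `addBox` selects. -/
theorem addBox_eq_lengthen {s : List ℕ} {r : ℕ} (hr : r < s.length)
    (h : ∀ x > r, s.getD x 0 ≠ s.getD r 0) : addBox (s.getD r 0 + 1) s = lengthen r s := by
  induction s generalizing r with
  | nil => simp at hr
  | cons g s ih =>
    have hmem : ∀ v, v ∈ s → ∃ x, s.getD x 0 = v := by
      intro v hv
      obtain ⟨i, hi, rfl⟩ := List.mem_iff_getElem.1 hv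
      exact ⟨i, List.getD_eq_getElem _ _ hi⟩
    rcases r with _ | r
    · have : g ∉ s := fun hg => by
        obtain ⟨x, hx⟩ := hmem g hg
        exact h (x + 1) (by omega) (by simpa using hx)
      simp [addBox, this, lengthen]
    · simp only [List.length_cons, Nat.add_lt_add_iff_right] at hr
      have hin : s.getD r 0 ∈ s := by
        rw [List.getD_eq_getElem _ _ hr]
        exact List.getElem_mem _
      have hb : ¬ (g + 1 = s.getD r 0 + 1 ∧ g ∉ s) := by
        rintro ⟨h1, h2⟩
        rw [Nat.add_right_cancel_iff.1 h1] at h2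
        exact h2 hin
      simp only [List.getD_cons_succ, addBox, if_neg hb, lengthen]
      rw [ih hr fun x hx => by simpa using h (x + 1) (by omega)]

theorem lengthen_length (s : List ℕ) : lengthen s.length s = s ++ [1] := by
  induction s with
  | nil => rfl
  | cons g s ih => simp [lengthen, ih]

theorem IsYoungRowWord.addBox_rowShape {r : ℕ} {w : List ℕ} (hw : IsYoungRowWord (r :: w)) :
    addBox (w.count r + 1) (rowShape w) = lengthen r (rowShape w) := by
  have hT := hw.isRowWord
  have hz := zero_notMem_rowShape w
  obtain ⟨h1, h2, h3⟩ := hw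
  have hc := h1.isRowWord.getD_rowShape
  by_cases h0 : w.count r = 0
  · have : r = (rowShape w).length := by
      have := hT.2.1
      rw [← hc, getD_eq_zero_iff hz] at h0
      omega
    rw [h0, addBox_one hz, this, lengthen_length]
  · rw [← hc]
    refine addBox_eq_lengthen ?_ fun x hx => ?_
    · rw [← hc, getD_eq_zero_iff hz] at h0
      omega
    · rw [hc, hc]
      exact h3 (by omega) x hx

theorem IsYoungRowWord.columnShape_eq {w : List ℕ} (hw : IsYoungRowWord w) :
    columnShape (columnWord w) = rowShape w := by
  induction w with
  | nil => rfl
  | cons r w ih => rw [columnWord, columnShape, ih hw.1, hw.addBox_rowShape, rowShape]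

theorem IsYoungRowWord.isYoungWord {w : List ℕ} (hw : IsYoungRowWord w) :
    IsYoungWord (columnWord w) := by
  induction w with
  | nil => trivial
  | cons r w ih =>
    have hz := zero_notMem_rowShape w
    have hc := hw.1.isRowWord.getD_rowShape
    have hT := hw.isRowWord
    refine ⟨ih hw.1, ?_, ?_⟩
    · rw [hw.1.columnShape_eq]
      by_cases h0 : w.count r = 0
      · exact Or.inl (by omega)
      · refine Or.inr ?_
        rw [Nat.add_sub_cancel, ← hc]
        rw [← hc, getD_eq_zero_iff hz] at h0
        rw [List.getD_eq_getElem _ _ (not_le.1 h0)]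
        exact List.getElem_mem _
    · intro h0
      rw [hw.1.columnShape_eq]
      refine hT.2.2 ?_
      have h0 : w.count r = 0 := by omega
      rw [← hc, getD_eq_zero_iff hz] at h0
      exact le_antisymm hT.2.1 h0

/-- By induction the earlier letters agree, and the last column gives the current length of the
chosen row. The row is then unique: the topmost row of that length or, for length `0`, the first
empty row. -/
theorem columnWord_injective {v w : List ℕ} (hv : IsYoungRowWord v) (hw : IsYoungRowWord w)
    (h : columnWord v = columnWord w) : v = w := by
  induction v generalizing w with
  | nil =>
    rcases w with _ | ⟨s, w⟩
    · rfl
    · simp [columnWord] at h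
  | cons r v ih =>
    rcases w with _ | ⟨s, w⟩
    · simp [columnWord] at h
    · simp only [columnWord, List.cons.injEq, Nat.add_right_cancel_iff] at h
      have := ih hv.1 hw.1 h.2
      subst this
      congr 1
      rcases Nat.eq_zero_or_pos (v.count r) with h0 | h0
      · rcases lt_trichotomy r s with hlt | rfl | hlt
        · have := hw.2.1 (by omega) r hlt
          omega
        · rfl
        · have := hv.2.1 h0 s hlt
          omega
      · rcases lt_trichotomy r s with hlt | rfl | hlt
        · exact absurd h.1.symm (hv.2.2 h0 s hlt)
        · rfl
        · exact absurd h.1 (hw.2.2 (by omega) r hlt)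

theorem exists_columnWord {u : List ℕ} (hu : IsYoungWord u) :
    ∃ w, IsYoungRowWord w ∧ columnWord w = u := by
  induction u with
  | nil => exact ⟨[], trivial, rfl⟩
  | cons c u ih =>
    obtain ⟨h1, h2, h3⟩ := hu
    obtain ⟨w, hw, rfl⟩ := ih h1
    have hz := zero_notMem_rowShape w
    have hc := hw.isRowWord.getD_rowShape
    rw [hw.columnShape_eq] at h2 h3
    have hc0 := h2.pos hz
    by_cases hc1 : c = 1
    · have hlen : w.count (rowShape w).length = 0 := by
        rw [← hc, getD_eq_zero_iff hz]
      refine ⟨(rowShape w).length :: w, ⟨hw, fun _ x hx => ?_, fun h => ?_⟩, ?_⟩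
      · rw [← hc, List.getD_eq_getElem _ _ hx]
        exact h3 hc1 _ (List.getElem_mem _)
      · omega
      · rw [columnWord, hlen, hc1]
    · have hmem := h2.resolve_left hc1
      have hex : ∃ i, i ≤ (rowShape w).length ∧ w.count i = c - 1 := by
        obtain ⟨i, hi, hi2⟩ := List.mem_iff_getElem.1 hmem
        exact ⟨i, hi.le, by rw [← hc, List.getD_eq_getElem _ _ hi, hi2]⟩
      obtain ⟨i, hi, hi2⟩ := hex
      -- The topmost row of length `c - 1`.
      set r := Nat.findGreatest (fun i => w.count i = c - 1) (rowShape w).length with hr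
      have hr2 : w.count r = c - 1 :=
        Nat.findGreatest_spec (P := fun i => w.count i = c - 1) hi hi2
      refine ⟨r :: w, ⟨hw, by omega, fun _ x hx hxe => ?_⟩, ?_⟩
      · rw [hr2] at hxe
        have hxl : x ≤ (rowShape w).length := by
          by_contra hxl
          have : w.count x = 0 := by
            rw [← hc, getD_eq_zero_iff hz]
            omega
          omega
        have := Nat.le_findGreatest (P := fun i => w.count i = c - 1) hxl hxe
        omega
      · rw [columnWord, hr2]
        congr 1
        omega

variable {n : ℕ} {β : Composition n}

theorem isYoungRowWord_wordOf {f : ℕ → ℕ} {n : ℕ} : IsYoungRowWord (wordOf f n) ↔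
    IsRowWord (wordOf f n) ∧ ∀ k < n, 0 < (wordOf f k).count (f k) →
      ∀ x > f k, (wordOf f k).count x ≠ (wordOf f k).count (f k) := by
  induction n with
  | zero => simp [wordOf, IsRowWord, IsYoungRowWord]
  | succ n ih =>
    rw [wordOf, isRowWord_cons, IsYoungRowWord, ih]
    constructor
    · rintro ⟨⟨h1, h2⟩, h3, h4⟩
      refine ⟨⟨h1, h3⟩, fun k hk => ?_⟩
      rcases Nat.lt_succ_iff_lt_or_eq.1 hk with hk | rfl
      · exact h2 k hk
      · exact h4
    · exact fun h => ⟨⟨h.1.1, fun k hk => h.2 k (by omega)⟩, h.1.2, h.2 n (by omega)⟩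

theorem columnWord_wordOf {Q : Filling β (Entry n)} (hQ : IsRowStandard Q) {k : ℕ} (hk : k ≤ n) :
    columnWord (wordOf (rowAt Q) k) = wordOf (colAt Q) k := by
  induction k with
  | zero => rfl
  | succ k ih => rw [wordOf, wordOf, columnWord, ih (by omega), hQ.colAt_eq_count hk]

/-- Seen at the moment when a box enters column `c + 1`, condition (4) says that a higher row that
has reached column `c` has also passed it, that is, no higher row has length exactly `c`. -/
theorem IsRowStandard.isSPYCT_iff {Q : Filling β (Entry n)} (hQ : IsRowStandard Q) :
    IsSPYCT Q ↔ IsYoungRowWord (wordOf (rowAt Q) n) := by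
  rw [isYoungRowWord_wordOf, ← hQ.isSPIT_iff]
  constructor
  · intro h
    refine ⟨hQ.isSPIT h.peak, fun k hk h0 x hx heq => ?_⟩
    obtain ⟨b', hb'⟩ := exists_entry hQ.bijective.2 hk
    have hr := rowAt_eq hQ.bijective.1 hb'
    have hc := colAt_eq hQ.bijective.1 hb'
    rw [hQ.colAt_eq_count hk] at hc
    obtain ⟨b, hb1, hb2, hb3⟩ := (hQ.exists_le_iff h0 hk.le).2 heq.ge
    obtain ⟨d, hd1, hd2, hd3⟩ := h.young b b' (by omega) (by omega)
      (by rw [← Subtype.coe_lt_coe, hb']; omega)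
    rw [← Subtype.coe_lt_coe, hb'] at hd3
    have := (hQ.exists_le_iff (r := x) d.one_le_col hk.le).1 ⟨d, rfl, by omega, by omega⟩
    omega
  · rintro ⟨h1, h2⟩
    refine ⟨hQ.bijective, hQ.row_increasing, fun b b' hb hb' h => h1.first_col hb hb' h,
      fun k hk => h1.isPeakDiagram hk, fun b b' hbc hbr hlt => ?_⟩
    obtain ⟨k, hk, hb'⟩ := exists_entry_eq Q b'
    have hr := rowAt_eq hQ.bijective.1 hb'
    have hc := colAt_eq hQ.bijective.1 hb'
    rw [hQ.colAt_eq_count hk] at hc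
    rw [← Subtype.coe_lt_coe, hb'] at hlt
    have hbr' := b.one_le_row
    have hbc' := b.one_le_col
    have h3 := (hQ.exists_le_iff (r := b.row - 1) hbc' hk.le).1 ⟨b, rfl, by omega, by omega⟩
    have h4 := h2 k hk (by omega) (b.row - 1) (by omega)
    obtain ⟨d, hd1, hd2, hd3⟩ := (hQ.exists_le_iff (r := b.row - 1) (c := b.col + 1) (by omega)
      hk.le).2 (by omega)
    refine ⟨d, hd1, by omega, ?_⟩
    rw [← Subtype.coe_lt_coe, hb']
    omega

theorem IsSPYCT.isRowStandard {Q : Filling β (Entry n)} (hQ : IsSPYCT Q) : IsRowStandard Q :=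
  ⟨hQ.bijective, hQ.row_increasing⟩

/-- Standard peak Young composition tableaux correspond to column words. -/
noncomputable def spyctEquiv (β : Composition n) :
    {Q : Filling β (Entry n) // IsSPYCT Q} ≃
      {u : List ℕ // IsYoungWord u ∧ columnShape u = β.blocks} :=
  Equiv.ofBijective (fun Q => ⟨wordOf (colAt Q.1) n, by
    have hw := Q.2.isRowStandard.isSPYCT_iff.1 Q.2
    rw [← columnWord_wordOf Q.2.isRowStandard le_rfl]
    refine ⟨hw.isYoungWord, ?_⟩
    rw [hw.columnShape_eq, hw.isRowWord.rowShape_eq_iff]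
    exact Q.2.isRowStandard.count_eq⟩) (by
    constructor
    · intro Q Q' h
      have h : wordOf (colAt Q.1) n = wordOf (colAt Q'.1) n := congrArg Subtype.val h
      rw [← columnWord_wordOf Q.2.isRowStandard le_rfl,
        ← columnWord_wordOf Q'.2.isRowStandard le_rfl] at h
      exact Subtype.ext (Q.2.isRowStandard.eq_of_rowAt Q'.2.isRowStandard (eq_of_wordOf_eq
        (columnWord_injective (Q.2.isRowStandard.isSPYCT_iff.1 Q.2)
          (Q'.2.isRowStandard.isSPYCT_iff.1 Q'.2) h)))
    · rintro ⟨u, hu, hs⟩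
      obtain ⟨w, hw, rfl⟩ := exists_columnWord hu
      rw [hw.columnShape_eq] at hs
      have hlen : w.length = n := by rw [← hw.isRowWord.sum_rowShape, hs, β.blocks_sum]
      obtain ⟨⟨Q, hQ⟩, hQw⟩ := (fillingEquiv β).surjective
        ⟨w, hlen, (hw.isRowWord.rowShape_eq_iff β).1 hs⟩
      have hQw : wordOf (rowAt Q) n = w := congrArg Subtype.val hQw
      refine ⟨⟨Q, hQ.isSPYCT_iff.2 (hQw ▸ hw)⟩, Subtype.ext ?_⟩
      change wordOf (colAt Q) n = columnWord w
      rw [← hQw, columnWord_wordOf hQ le_rfl])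

end

section
/-! ### Dual immaculate recording tableaux -/

/-- Row words of dual immaculate recording tableaux with `m` rows. -/
def IsRecordingWord (m : ℕ) : List ℕ → Prop
  | [] => True
  | r :: w => IsRecordingWord m w ∧ r < m ∧
      (w.count r = 0 → ∀ x, r < x → x < m → 0 < w.count x) ∧
      (∀ x < r, w.count x ≠ w.count r + 1) ∧
      (w.count r + 1 = 1 ∨ ∃ h ∈ (columnWord w).head?, h < w.count r + 1)

/-- The upper `l.length` of `m` rows have the lengths `l`, and the other rows are empty. -/
def HasUpperShape (m : ℕ) (l w : List ℕ) : Prop :=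
  (∀ i, w.count (m - l.length + i) = l.getD i 0) ∧ ∀ x < m - l.length, w.count x = 0

/-- Rows are opened from the top downwards, so the nonempty rows are always the uppermost ones. -/
theorem IsRecordingWord.upper {m : ℕ} {w : List ℕ} (hw : IsRecordingWord m w) {x y : ℕ}
    (hxy : x < y) (hy : y < m) (hx : 0 < w.count x) : 0 < w.count y := by
  induction w with
  | nil => simp at hx
  | cons r w ih =>
    rw [List.count_cons] at hx ⊢
    by_cases h0 : 0 < w.count x
    · have := ih hw.1 h0
      omega
    · simp only [beq_iff_eq] at hx
      have hr : r = x := by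
        by_contra hr
        rw [if_neg hr] at hx
        omega
      subst hr
      have := hw.2.2.1 (by omega) y hxy hy
      omega

theorem removeBox_getD {l : List ℕ} {d i : ℕ} (h2 : 2 ≤ d) (hi : l.getD i 0 = d)
    (h : ∀ j < i, l.getD j 0 ≠ d) :
    (removeBox d l).length = l.length ∧
      ∀ j, (removeBox d l).getD j 0 + (if i = j then 1 else 0) = l.getD j 0 := by
  induction l generalizing i with
  | nil =>
    simp at hi
    omega
  | cons b l ih =>
    rcases i with _ | i
    · simp only [List.getD_cons_zero] at hi
      subst hi
      have : b ≠ 1 := by omega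
      simp only [removeBox, if_true, this, if_false, List.length_cons, true_and]
      rintro (_ | j)
      · simp only [List.getD_cons_zero, if_true]
        omega
      · simp
    · have hb : b ≠ d := by simpa using h 0 (by omega)
      obtain ⟨h3, h4⟩ := ih (i := i) (by simpa using hi) fun j hj => by
        simpa using h (j + 1) (by omega)
      simp only [removeBox, hb, if_false, List.length_cons, h3, true_and]
      rintro (_ | j)
      · simp
      · simpa using h4 j

theorem exists_first_getD {l : List ℕ} {d : ℕ} (hd : d ∈ l) :
    ∃ i < l.length, l.getD i 0 = d ∧ ∀ j < i, l.getD j 0 ≠ d := by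
  classical
  have hex : ∃ i, i < l.length ∧ l.getD i 0 = d := by
    obtain ⟨i, hi, h⟩ := List.mem_iff_getElem.1 hd
    exact ⟨i, hi, by rw [List.getD_eq_getElem _ _ hi, h]⟩
  obtain ⟨h1, h2⟩ := Nat.find_spec hex
  refine ⟨Nat.find hex, h1, h2, fun j hj hjd => Nat.find_min hex hj ⟨by omega, hjd⟩⟩

/-- Read backwards, the last box leaves the lowest row of its length, and a row that disappears is
the lowest nonempty one. These are the choices made by `removeBox` and `CanRemove`. -/
theorem IsRecordingWord.isColumnWord {m : ℕ} {l w : List ℕ} (hw : IsRecordingWord m w)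
    (hl : 0 ∉ l) (hlm : l.length ≤ m) (h : HasUpperShape m l w) :
    IsColumnWord l (columnWord w) := by
  induction w generalizing l with
  | nil =>
    rcases l with _ | ⟨b, l⟩
    · rfl
    · have := h.1 0
      simp at this
      simp [← this] at hl
  | cons r w ih =>
    obtain ⟨h1, h2, h3, h4, h5⟩ := hw
    obtain ⟨hs1, hs2⟩ := h
    have hr : m - l.length ≤ r := by
      by_contra hr
      have := hs2 r (not_le.1 hr)
      simp at this
    obtain ⟨i, rfl⟩ := Nat.exists_eq_add_of_le hr
    have hi := hs1 i
    rw [List.count_cons_self] at hi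
    have hil : i < l.length := by omega
    by_cases h0 : w.count (m - l.length + i) = 0
    · have hi0 : i = 0 := by
        by_contra hi0
        have h6 := hs1 0
        rw [List.count_cons_of_ne (by omega), List.getD_eq_getElem _ _ (by omega)] at h6
        have h7 : l[0] ≠ 0 := fun h => hl (h ▸ List.getElem_mem _)
        have := h1.upper (x := m - l.length + 0) (y := m - l.length + i) (by omega) (by omega)
          (by omega)
        omega
      subst hi0
      rcases l with _ | ⟨b, l⟩
      · simp at hil
      · simp only [h0, List.getD_cons_zero] at hi
        subst hi
        simp only [List.length_cons, List.mem_cons, not_or] at hs1 hs2 h0 hl hlm h5 ⊢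
        rw [columnWord]
        refine ⟨⟨by rw [h0]; simp, fun _ => rfl⟩, ?_, h5⟩
        simp only [h0, removeBox, if_true]
        refine ih h1 hl.2 (by omega) ⟨fun j => ?_, fun x hx => ?_⟩
        · have := hs1 (j + 1)
          rw [List.count_cons_of_ne (by omega), List.getD_cons_succ] at this
          rw [← this]
          congr 1
          omega
        · by_cases hx' : x = m - (l.length + 1) + 0
          · rw [hx', h0]
          · have := hs2 x (by omega)
            rwa [List.count_cons_of_ne (by omega)] at this
    · set d := w.count (m - l.length + i) + 1 with hd
      have hlow : ∀ j < i, l.getD j 0 ≠ d := by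
        intro j hj
        have := hs1 j
        rw [List.count_cons_of_ne (by omega)] at this
        rw [← this]
        exact h4 _ (by omega)
      have hmem : d ∈ l := by
        rw [hi, List.getD_eq_getElem _ _ hil]
        exact List.getElem_mem _
      obtain ⟨h6, h7⟩ := removeBox_getD (by omega) hi.symm hlow
      change IsColumnWord l (d :: columnWord w)
      refine ⟨⟨hmem, by omega⟩, ?_, h5⟩
      refine ih h1 (zero_notMem_removeBox hl _) (by omega) ⟨fun j => ?_, fun x hx => ?_⟩
      · rw [h6]
        have h8 := h7 j
        rw [← hs1 j, List.count_cons] at h8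
        simp only [beq_iff_eq, Nat.add_left_cancel_iff] at h8
        omega
      · rw [h6] at hx
        have := hs2 x hx
        rwa [List.count_cons_of_ne (by omega)] at this

theorem exists_recordingWord {m : ℕ} {l e : List ℕ} (he : IsColumnWord l e) (hl : 0 ∉ l)
    (hlm : l.length ≤ m) : ∃ w, IsRecordingWord m w ∧ HasUpperShape m l w ∧ columnWord w = e := by
  induction e generalizing l with
  | nil =>
    have : l = [] := he
    subst this
    exact ⟨[], trivial, ⟨by simp, by simp⟩, rfl⟩
  | cons d e ih =>
    obtain ⟨hd, hV, hasc⟩ := he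
    have hd0 := hd.pos hl
    have hlen := length_removeBox hd.1
    obtain ⟨w, hw, ⟨hs1, hs2⟩, rfl⟩ := ih hV (zero_notMem_removeBox hl d) (by omega)
    by_cases hd1 : d = 1
    · subst hd1
      have hhead := hd.2 rfl
      rcases l with _ | ⟨b, l⟩
      · simp at hhead
      simp only [List.head?_cons, Option.some.injEq] at hhead
      subst hhead
      simp only [removeBox, if_true] at hs1 hs2
      simp only [List.mem_cons, not_or, List.length_cons] at hl hlm
      have h0 : w.count (m - (l.length + 1)) = 0 := hs2 _ (by omega)
      refine ⟨(m - (l.length + 1)) :: w, ⟨hw, by omega, fun _ x hx hxm => ?_, fun x hx => ?_,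
        by rw [h0]; exact Or.inl rfl⟩, ⟨?_, ?_⟩, ?_⟩
      · obtain ⟨j, rfl⟩ := Nat.exists_eq_add_of_le (show m - l.length ≤ x by omega)
        rw [hs1, List.getD_eq_getElem _ _ (by omega)]
        exact Nat.pos_of_ne_zero fun h => hl.2 (h ▸ List.getElem_mem _)
      · have := hs2 x (by omega)
        omega
      · rintro (_ | j)
        · simp [h0]
        · rw [List.count_cons_of_ne (by simp), List.getD_cons_succ, ← hs1]
          simp only [List.length_cons]
          congr 1
          omega
      · intro x hx
        simp only [List.length_cons] at hx
        rw [List.count_cons_of_ne (by omega)]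
        exact hs2 x (by omega)
      · rw [columnWord, h0]
    · obtain ⟨i, hil, hi, hlow⟩ := exists_first_getD hd.1
      obtain ⟨h6, h7⟩ := removeBox_getD (by omega) hi hlow
      rw [h6] at hs1 hs2
      have hcount : w.count (m - l.length + i) + 1 = d := by
        have := h7 i
        rw [if_pos rfl] at this
        rw [hs1, this, hi]
      refine ⟨(m - l.length + i) :: w, ⟨hw, by omega, by omega, fun x hx => ?_,
        by rw [hcount]; exact hasc⟩, ⟨fun j => ?_, fun x hx => ?_⟩, ?_⟩
      · rw [hcount]
        by_cases hx' : x < m - l.length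
        · rw [hs2 x hx']
          omega
        · obtain ⟨j, rfl⟩ := Nat.exists_eq_add_of_le (not_lt.1 hx')
          have h8 := h7 j
          rw [if_neg (by omega), add_zero] at h8
          rw [hs1, h8]
          exact hlow j (by omega)
      · rw [List.count_cons, ← h7 j, hs1]
        simp
      · rw [List.count_cons_of_ne (by omega)]
        exact hs2 x hx
      · rw [columnWord, hcount]

/-- With equal final shapes and equal last columns, two different last rows would have the same
final length. The lower one would then have had this length before the higher one reached it, which
is forbidden. -/
theorem IsRecordingWord.eq {m : ℕ} {v w : List ℕ} (hv : IsRecordingWord m v)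
    (hw : IsRecordingWord m w) (hc : ∀ x, v.count x = w.count x)
    (h : columnWord v = columnWord w) : v = w := by
  induction v generalizing w with
  | nil =>
    rcases w with _ | ⟨s, w⟩
    · rfl
    · simp [columnWord] at h
  | cons r v ih =>
    rcases w with _ | ⟨s, w⟩
    · simp [columnWord] at h
    · simp only [columnWord, List.cons.injEq] at h
      have hrs : r = s := by
        rcases lt_trichotomy r s with hlt | heq | hlt
        · have h1 := hw.2.2.2.1 r hlt
          have h2 := hc r
          rw [List.count_cons_self, List.count_cons_of_ne (by omega)] at h2
          omega
        · exact heq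
        · have h1 := hv.2.2.2.1 s hlt
          have h2 := hc s
          rw [List.count_cons_self, List.count_cons_of_ne (by omega)] at h2
          omega
      subst hrs
      rw [ih hv.1 hw.1 (fun x => ?_) h.2]
      have := hc x
      rw [List.count_cons, List.count_cons] at this
      omega

/-! ### Strips -/

/-- The strips with lengths `s` (last strip first) start at the letters `1` of `f`. -/
def StartsAtOnes (f : ℕ → ℕ) : List ℕ → Prop
  | [] => True
  | g :: s => StartsAtOnes f s ∧ f s.sum = 1 ∧ ∀ t, s.sum < t → t < s.sum + g → f t ≠ 1

theorem StartsAtOnes.stripSizes_eq {f : ℕ → ℕ} {s : List ℕ} (hs : 0 ∉ s) (h : StartsAtOnes f s) :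
    stripSizes (wordOf f s.sum) = s := by
  induction s with
  | nil => rfl
  | cons g s ih =>
    simp only [List.mem_cons, not_or] at hs
    obtain ⟨h1, h2, h3⟩ := h
    obtain ⟨g, rfl⟩ : ∃ k, g = k + 1 := ⟨g - 1, by omega⟩
    have ih := ih hs.2 h1
    clear hs
    rw [List.sum_cons, add_comm]
    induction g with
    | zero => rw [← add_assoc, wordOf, stripSizes, if_pos h2, ih]
    | succ g ihg =>
      rw [← add_assoc, wordOf, stripSizes, if_neg (h3 _ (by omega) (by omega)),
        ihg fun t ht ht' => h3 t ht (by omega)]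
      rfl

theorem startsAtOnes_stripSizes {f : ℕ → ℕ} {k : ℕ} (h0 : 0 < k → f 0 = 1) :
    StartsAtOnes f (stripSizes (wordOf f k)) ∧ (stripSizes (wordOf f k)).sum = k := by
  induction k with
  | zero => exact ⟨trivial, rfl⟩
  | succ k ih =>
    obtain ⟨h1, h2⟩ := ih fun _ => h0 (by omega)
    rw [wordOf, stripSizes]
    split_ifs with h
    · refine ⟨⟨h1, by rwa [h2], fun t ht ht' => by omega⟩, ?_⟩
      rw [List.sum_cons, h2, add_comm]
    · rcases hs : stripSizes (wordOf f k) with _ | ⟨g, s⟩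
      · rw [hs] at h2
        simp only [List.sum_nil] at h2
        subst h2
        exact absurd (h0 (by omega)) h
      · rw [hs] at h1 h2
        simp only [List.sum_cons] at h2
        refine ⟨⟨h1.1, h1.2.1, fun t ht ht' => ?_⟩, ?_⟩
        · by_cases htk : t = k
          · rwa [htk]
          · exact h1.2.2 t ht (by omega)
        · simp only [lengthen, List.sum_cons]
          omega

/-- A condition on the partial sums of a reversed list. -/
def StripCondition (P : ℕ → ℕ → Prop) : List ℕ → Prop
  | [] => True
  | g :: s => StripCondition P s ∧ P s.sum g

theorem stripCondition_iff (P : ℕ → ℕ → Prop) (s : List ℕ) : StripCondition P s ↔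
    ∀ i (hi : i < s.reverse.length), P (s.reverse.take i).sum s.reverse[i] := by
  induction s with
  | nil => simp [StripCondition]
  | cons g s ih =>
    rw [StripCondition, ih]
    constructor
    · rintro ⟨h1, h2⟩ i hi
      simp only [List.reverse_cons, List.length_append, List.length_cons, List.length_nil] at hi ⊢
      by_cases hi' : i < s.reverse.length
      · rw [List.take_append_of_le_length hi'.le, List.getElem_append_left hi']
        exact h1 i hi'
      · have : i = s.reverse.length := by omega
        subst this
        rw [List.take_left, List.getElem_append_right le_rfl]
        simpa using h2
    · intro h
      refine ⟨fun i hi => ?_, ?_⟩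
      · have := h i (by simp at hi ⊢; omega)
        simp only [List.reverse_cons] at this
        rwa [List.take_append_of_le_length hi.le, List.getElem_append_left hi] at this
      · have := h s.reverse.length (by simp)
        simp only [List.reverse_cons] at this
        rw [List.take_left, List.getElem_append_right le_rfl] at this
        simpa using this

variable {n : ℕ} {β : Composition n}

/-- Reversal is what makes `α.blocks` list the strips last one first, as `stripSizes` does; partial
sums of the reverse are sums of tails of `α.blocks`. -/
theorem hasRowStripShape_iff (Q : Filling β (Entry n)) (α : Composition n) :
    HasRowStripShape Q α.reverse ↔
      StripCondition (fun a j => IsRowStrip Q (a + 1) j) α.blocks := by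
  rw [stripCondition_iff]
  constructor
  · intro h i hi
    exact h ⟨i, hi⟩
  · intro h i
    exact h i i.2

theorem IsRowStandard.stepsRight_iff {Q : Filling β (Entry n)} (hQ : IsRowStandard Q) {i : ℕ} :
    StepsRight Q i ↔ 0 < i ∧ i < n ∧ colAt Q (i - 1) < colAt Q i := by
  constructor
  · rintro ⟨b, b', h1, h2, h3⟩
    have hb := Finset.mem_Icc.1 (Q b).2
    have hb' := Finset.mem_Icc.1 (Q b').2
    refine ⟨by omega, by omega, ?_⟩
    rwa [colAt_eq hQ.bijective.1 (b := b) (by omega), colAt_eq hQ.bijective.1 h2]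
  · rintro ⟨h1, h2, h3⟩
    obtain ⟨b, hb⟩ := exists_entry hQ.bijective.2 (show i - 1 < n by omega)
    obtain ⟨b', hb'⟩ := exists_entry hQ.bijective.2 h2
    refine ⟨b, b', by omega, hb', ?_⟩
    rwa [colAt_eq hQ.bijective.1 hb, colAt_eq hQ.bijective.1 hb'] at h3

theorem IsRowStandard.one_le_colAt {Q : Filling β (Entry n)} (hQ : IsRowStandard Q) {k : ℕ}
    (hk : k < n) : 1 ≤ colAt Q k := by
  rw [hQ.colAt_eq_count hk]
  omega

/-- The conditions on row strips, in terms of columns. -/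
theorem IsRowStandard.strips_iff {Q : Filling β (Entry n)} (hQ : IsRowStandard Q)
    (α : Composition n) :
    ((∀ a j, IsRowStrip Q a j → ∀ b : Box β, (Q b : ℕ) = a → b.col = 1) ∧
      HasRowStripShape Q α.reverse) ↔
    (∀ k < n, colAt Q k = 1 ∨ 0 < k ∧ colAt Q (k - 1) < colAt Q k) ∧
      stripSizes (wordOf (colAt Q) n) = α.blocks := by
  rw [hasRowStripShape_iff]
  constructor
  · rintro ⟨h1, h2⟩
    -- Induction over the tails `s` of `α.blocks`; `s.sum` is the number of entries before the next
    -- strip.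
    have key : ∀ s : List ℕ, s.sum ≤ n → 0 ∉ s →
        StripCondition (fun a j => IsRowStrip Q (a + 1) j) s →
        (∀ k < s.sum, colAt Q k = 1 ∨ 0 < k ∧ colAt Q (k - 1) < colAt Q k) ∧
          StartsAtOnes (colAt Q) s := by
      intro s
      induction s with
      | nil => simp [StartsAtOnes]
      | cons g s ih =>
        rintro hsn hs0 ⟨h3, h4⟩
        simp only [List.mem_cons, not_or] at hs0
        rw [List.sum_cons] at hsn ⊢
        obtain ⟨ih1, ih2⟩ := ih (by omega) hs0.2 h3
        have hstart : colAt Q s.sum = 1 := by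
          obtain ⟨b, hb⟩ := exists_entry hQ.bijective.2 (show s.sum < n by omega)
          rw [colAt_eq hQ.bijective.1 hb]
          exact h1 _ _ h4 b hb
        have hstep : ∀ t, s.sum < t → t < s.sum + g → colAt Q (t - 1) < colAt Q t :=
          fun t ht ht' => (hQ.stepsRight_iff.1 (h4.steps t (by omega) (by omega))).2.2
        refine ⟨fun k hk => ?_, ih2, hstart, fun t ht ht' => ?_⟩
        · rcases lt_trichotomy k s.sum with hlt | heq | hgt
          · exact ih1 k hlt
          · exact Or.inl (heq ▸ hstart)
          · exact Or.inr ⟨by omega, hstep k hgt (by omega)⟩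
        · have := hstep t ht ht'
          have := hQ.one_le_colAt (show t - 1 < n by omega)
          omega
    obtain ⟨h3, h4⟩ := key α.blocks α.blocks_sum.le (zero_notMem_blocks α) h2
    rw [α.blocks_sum] at h3
    refine ⟨h3, ?_⟩
    have := h4.stripSizes_eq (zero_notMem_blocks α)
    rwa [α.blocks_sum] at this
  · rintro ⟨h1, h2⟩
    have h0 : 0 < n → colAt Q 0 = 1 := fun hn => (h1 0 hn).resolve_right (by omega)
    obtain ⟨h3, -⟩ := startsAtOnes_stripSizes h0
    rw [h2] at h3
    refine ⟨fun a j h b hb => ?_, ?_⟩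
    · have ha := Finset.mem_Icc.1 (Q b).2
      rw [← colAt_eq hQ.bijective.1 (b := b) (k := a - 1) (by omega)]
      by_contra hc
      obtain ⟨h4, h5⟩ := (h1 (a - 1) (by omega)).resolve_left hc
      exact h.maximal_left (hQ.stepsRight_iff.2 ⟨h4, by omega, h5⟩)
    -- The last hypothesis on `s` says that the next entry starts in column `1`; this is what makes
    -- the last strip of `s` maximal on the right.
    · have key : ∀ s : List ℕ, s.sum ≤ n → 0 ∉ s → StartsAtOnes (colAt Q) s →
          (s.sum < n → colAt Q s.sum = 1) →
          StripCondition (fun a j => IsRowStrip Q (a + 1) j) s := by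
        intro s
        induction s with
        | nil => intros; trivial
        | cons g s ih =>
          rintro hsn hs0 ⟨h3, h4, h5⟩ h6
          simp only [List.mem_cons, not_or] at hs0
          rw [List.sum_cons] at hsn h6
          refine ⟨ih (by omega) hs0.2 h3 fun _ => h4, by omega, by omega, by omega, ?_, ?_, ?_⟩
          · intro i hi hi'
            rw [hQ.stepsRight_iff]
            refine ⟨by omega, by omega, ?_⟩
            exact ((h1 i (by omega)).resolve_left (h5 i (by omega) (by omega))).2
          · rw [hQ.stepsRight_iff]
            rintro ⟨h7, h8, h9⟩
            simp only [Nat.add_sub_cancel] at h7 h8 h9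
            have := hQ.one_le_colAt (show s.sum - 1 < n by omega)
            omega
          · rw [hQ.stepsRight_iff]
            rintro ⟨h7, h8, h9⟩
            have h10 : s.sum + 1 + g - 1 = g + s.sum := by omega
            rw [h10] at h7 h8 h9
            have := hQ.one_le_colAt (show g + s.sum - 1 < n by omega)
            have := h6 h8
            omega
      exact key α.blocks α.blocks_sum.le (zero_notMem_blocks α) h3
        fun h => absurd h (by rw [α.blocks_sum]; exact lt_irrefl n)

end

/-! ### Recording tableaux as column words -/

section
variable {n : ℕ} {β : Composition n}

theorem isRecordingWord_wordOf {m : ℕ} {f : ℕ → ℕ} {n : ℕ} : IsRecordingWord m (wordOf f n) ↔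
    ∀ k < n, f k < m ∧
      ((wordOf f k).count (f k) = 0 → ∀ x, f k < x → x < m → 0 < (wordOf f k).count x) ∧
      (∀ x < f k, (wordOf f k).count x ≠ (wordOf f k).count (f k) + 1) ∧
      ((wordOf f k).count (f k) + 1 = 1 ∨
        ∃ h ∈ (columnWord (wordOf f k)).head?, h < (wordOf f k).count (f k) + 1) := by
  induction n with
  | zero => simp [wordOf, IsRecordingWord]
  | succ n ih =>
    rw [wordOf, IsRecordingWord, ih]
    constructor
    · rintro ⟨h1, h2⟩ k hk
      rcases Nat.lt_succ_iff_lt_or_eq.1 hk with hk | rfl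
      · exact h1 k hk
      · exact h2
    · exact fun h => ⟨fun k hk => h k (by omega), h n (by omega)⟩

theorem head?_wordOf (f : ℕ → ℕ) (k x : ℕ) : x ∈ (wordOf f k).head? ↔ 0 < k ∧ f (k - 1) = x := by
  rcases k with _ | k <;> simp [wordOf]

theorem IsRowStandard.rowAt_lt {Q : Filling β (Entry n)} (hQ : IsRowStandard Q) {k : ℕ}
    (hk : k < n) : rowAt Q k < β.length := by
  obtain ⟨b, hb⟩ := exists_entry hQ.bijective.2 hk
  have hr := rowAt_eq hQ.bijective.1 hb
  have hm : (b.col, rowAt Q k + 1) ∈ diagram β := by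
    rw [hr]
    exact b.2
  rw [mem_diagram] at hm
  by_contra h
  rw [List.getD_eq_default _ _ (not_lt.1 h)] at hm
  omega

theorem exists_box {x : ℕ} (hx : x < β.length) : ∃ b : Box β, b.col = 1 ∧ b.row = x + 1 := by
  refine ⟨⟨(1, x + 1), mem_diagram.2 ⟨le_rfl, ?_⟩⟩, rfl, rfl⟩
  rw [List.getD_eq_getElem _ _ hx]
  exact β.one_le_blocks (List.getElem_mem _)

/-- Seen at the moment when a box enters column `c`, condition (4) says that no lower row has length
exactly `c`, and the condition on the first column says that all higher rows are already open. -/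
theorem IsRowStandard.isDIRT_iff {Q : Filling β (Entry n)} (hQ : IsRowStandard Q)
    (α : Composition n) : (IsDIRT Q ∧ HasRowStripShape Q α.reverse) ↔
      IsRecordingWord β.length (wordOf (rowAt Q) n) ∧
        stripSizes (columnWord (wordOf (rowAt Q) n)) = α.blocks := by
  have hcol : ∀ k < n, ((wordOf (rowAt Q) k).count (rowAt Q k) + 1 = 1 ∨
      ∃ h ∈ (columnWord (wordOf (rowAt Q) k)).head?,
        h < (wordOf (rowAt Q) k).count (rowAt Q k) + 1) ↔
      (colAt Q k = 1 ∨ 0 < k ∧ colAt Q (k - 1) < colAt Q k) := by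
    intro k hk
    rw [columnWord_wordOf hQ hk.le, ← hQ.colAt_eq_count hk]
    simp only [head?_wordOf]
    refine or_congr_right ⟨?_, ?_⟩
    · rintro ⟨h, ⟨h1, rfl⟩, h2⟩
      exact ⟨h1, h2⟩
    · rintro ⟨h1, h2⟩
      exact ⟨_, ⟨h1, rfl⟩, h2⟩
  have hstrip := hQ.strips_iff α
  rw [columnWord_wordOf hQ le_rfl, isRecordingWord_wordOf]
  constructor
  · rintro ⟨h, hs⟩
    obtain ⟨h1, h2⟩ := hstrip.1 ⟨h.strips_start, hs⟩
    refine ⟨fun k hk => ⟨hQ.rowAt_lt hk, ?_, ?_, (hcol k hk).2 (h1 k hk)⟩, h2⟩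
    · intro h0 x hx hxm
      obtain ⟨b', hb'⟩ := exists_entry hQ.bijective.2 hk
      have hr := rowAt_eq hQ.bijective.1 hb'
      have hc := colAt_eq hQ.bijective.1 hb'
      rw [hQ.colAt_eq_count hk] at hc
      obtain ⟨b, hb1, hb2⟩ := exists_box hxm
      have := h.first_col b b' hb1 (by omega) (by omega)
      rw [← Subtype.coe_lt_coe, hb'] at this
      exact (hQ.exists_le_iff le_rfl hk.le).1 ⟨b, hb1, hb2, by omega⟩
    · intro x hx heq
      obtain ⟨b, hb⟩ := exists_entry hQ.bijective.2 hk
      have hr := rowAt_eq hQ.bijective.1 hb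
      have hc := colAt_eq hQ.bijective.1 hb
      rw [hQ.colAt_eq_count hk] at hc
      obtain ⟨b', hb1, hb2, hb3⟩ := (hQ.exists_le_iff (c := b.col) b.one_le_col hk.le).2
        (show b.col ≤ (wordOf (rowAt Q) k).count x by omega)
      obtain ⟨d, hd1, hd2, hd3⟩ := h.recording b b' hb1.symm (by omega)
        (by rw [← Subtype.coe_lt_coe, hb]; omega)
      rw [← Subtype.coe_lt_coe, hb] at hd3
      have := (hQ.exists_le_iff (r := x) d.one_le_col hk.le).1 ⟨d, rfl, by omega, by omega⟩
      omega
  · rintro ⟨h1, h2⟩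
    obtain ⟨h3, h4⟩ := hstrip.2 ⟨fun k hk => (hcol k hk).1 (h1 k hk).2.2.2, h2⟩
    refine ⟨⟨hQ.bijective, hQ.row_increasing, h3, fun b b' hb1 hb1' hlt => ?_,
      fun b b' hcc hlt hQlt => ?_⟩, h4⟩
    · obtain ⟨k, hk, hb'⟩ := exists_entry_eq Q b'
      have hr := rowAt_eq hQ.bijective.1 hb'
      have hc := colAt_eq hQ.bijective.1 hb'
      rw [hQ.colAt_eq_count hk] at hc
      have hrow := b.one_le_row
      obtain ⟨kb, hkb, hb⟩ := exists_entry_eq Q b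
      have hrb := rowAt_eq hQ.bijective.1 hb
      have hlb := hQ.rowAt_lt hkb
      have h5 := (h1 k hk).2.1 (by omega) (b.row - 1) (by omega) (by omega)
      obtain ⟨d, hd1, hd2, hd3⟩ := (hQ.exists_le_iff le_rfl hk.le).2 h5
      have : d = b := Box.ext (by omega) (by omega)
      subst this
      rw [← Subtype.coe_lt_coe, hb']
      omega
    · obtain ⟨k, hk, hb⟩ := exists_entry_eq Q b
      have hr := rowAt_eq hQ.bijective.1 hb
      have hc := colAt_eq hQ.bijective.1 hb
      rw [hQ.colAt_eq_count hk] at hc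
      rw [← Subtype.coe_lt_coe, hb] at hQlt
      have hrow := b'.one_le_row
      have h5 := (hQ.exists_le_iff (r := b'.row - 1) b'.one_le_col hk.le).1
        ⟨b', rfl, by omega, by omega⟩
      have h6 := (h1 k hk).2.2.1 (b'.row - 1) (by omega)
      obtain ⟨d, hd1, hd2, hd3⟩ := (hQ.exists_le_iff (r := b'.row - 1) (c := b.col + 1)
        (by omega) hk.le).2 (by omega)
      refine ⟨d, hd1, by omega, ?_⟩
      rw [← Subtype.coe_lt_coe, hb]
      omega

theorem IsRowStandard.hasUpperShape {Q : Filling β (Entry n)} (hQ : IsRowStandard Q) :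
    HasUpperShape β.length β.blocks (wordOf (rowAt Q) n) := by
  constructor
  · intro i
    rw [hQ.count_eq]
    congr 1
    change β.length - β.length + i = i
    omega
  · intro x hx
    change x < β.length - β.length at hx
    omega

theorem length_columnWord (w : List ℕ) : (columnWord w).length = w.length := by
  induction w with
  | nil => rfl
  | cons r w ih => simp [columnWord, ih]

theorem sum_removeBox {l : List ℕ} {d : ℕ} (hd : d ∈ l) (h0 : 0 < d) :
    (removeBox d l).sum + 1 = l.sum := by
  induction l with
  | nil => simp at hd
  | cons b l ih =>
    simp only [removeBox]
    by_cases hb : b = d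
    · subst hb
      by_cases h1 : b = 1
      · simp [h1, add_comm]
      · simp only [if_true, h1, if_false, List.sum_cons]
        omega
    · have := ih (by grind)
      simp only [hb, if_false, List.sum_cons]
      omega

theorem IsColumnWord.sum_eq {l e : List ℕ} (h : IsColumnWord l e) (hl : 0 ∉ l) :
    l.sum = e.length := by
  induction e generalizing l with
  | nil => simp [show l = [] from h]
  | cons d e ih =>
    have h1 := ih h.2.1 (zero_notMem_removeBox hl d)
    have h2 := sum_removeBox h.1.1 (h.1.pos hl)
    rw [List.length_cons]
    omega

/-- Dual immaculate recording tableaux correspond to column words. -/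
noncomputable def dirtEquiv (α β : Composition n) :
    {Q : Filling β (Entry n) // IsDIRT Q ∧ HasRowStripShape Q α.reverse} ≃
      {e : List ℕ // IsColumnWord β.blocks e ∧ stripSizes e = α.blocks} :=
  Equiv.ofBijective (fun Q => ⟨columnWord (wordOf (rowAt Q.1) n), by
    have hQ : IsRowStandard Q.1 := ⟨Q.2.1.bijective, Q.2.1.row_increasing⟩
    have h := (hQ.isDIRT_iff α).1 Q.2
    exact ⟨h.1.isColumnWord (zero_notMem_blocks β) le_rfl hQ.hasUpperShape, h.2⟩⟩) (by
    constructor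
    · intro Q Q' h
      have hQ : IsRowStandard Q.1 := ⟨Q.2.1.bijective, Q.2.1.row_increasing⟩
      have hQ' : IsRowStandard Q'.1 := ⟨Q'.2.1.bijective, Q'.2.1.row_increasing⟩
      refine Subtype.ext (hQ.eq_of_rowAt hQ' (eq_of_wordOf_eq (IsRecordingWord.eq
        ((hQ.isDIRT_iff α).1 Q.2).1 ((hQ'.isDIRT_iff α).1 Q'.2).1 (fun x => ?_)
        (congrArg Subtype.val h))))
      rw [hQ.count_eq, hQ'.count_eq]
    · rintro ⟨e, he, hs⟩
      obtain ⟨w, hw, hsh, rfl⟩ := exists_recordingWord (m := β.length) he (zero_notMem_blocks β)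
        le_rfl
      have hcount : ∀ r, w.count r = β.blocks.getD r 0 := by
        intro r
        rw [← hsh.1]
        congr 1
        change r = β.length - β.length + r
        omega
      have hlen : w.length = n := by
        rw [← length_columnWord, ← he.sum_eq (zero_notMem_blocks β), β.blocks_sum]
      obtain ⟨⟨Q, hQ⟩, hQw⟩ := (fillingEquiv β).surjective ⟨w, hlen, hcount⟩
      have hQw : wordOf (rowAt Q) n = w := congrArg Subtype.val hQw
      refine ⟨⟨Q, (hQ.isDIRT_iff α).2 (by rw [hQw]; exact ⟨hw, hs⟩)⟩, Subtype.ext ?_⟩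
      change columnWord (wordOf (rowAt Q) n) = columnWord w
      rw [hQw])

end

/-! ### Peak functions in terms of monomial quasisymmetric functions -/

theorem mem_partialSums {n : ℕ} {α : Composition n} {x : ℕ} :
    x ∈ partialSums α ↔ 0 < x ∧ x < n ∧ ∃ i, α.sizeUpTo i = x := by
  simp only [partialSums, Finset.mem_image, Finset.mem_Ioo]
  constructor
  · rintro ⟨i, ⟨h1, h2⟩, rfl⟩
    refine ⟨?_, ?_, i, rfl⟩
    · have h3 := α.sizeUpTo_strict_mono (show 0 < α.length by omega)
      have h4 := α.monotone_sizeUpTo (show 0 + 1 ≤ i by omega)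
      rw [α.sizeUpTo_zero] at h3
      omega
    · have h3 := α.sizeUpTo_strict_mono h2
      have h4 := α.sizeUpTo_le (i + 1)
      omega
  · rintro ⟨h1, h2, i, rfl⟩
    refine ⟨i, ⟨?_, ?_⟩, rfl⟩
    · apply Nat.pos_of_ne_zero
      rintro rfl
      simp at h1
    · by_contra hi
      rw [α.sizeUpTo_ofLength_le i (not_lt.1 hi)] at h2
      omega

theorem card_partialSums {n : ℕ} (hn : 0 < n) (α : Composition n) :
    (partialSums α).card + 1 = α.length := by
  rw [partialSums, Finset.card_image_of_injOn, Nat.card_Ioo]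
  · have := α.length_pos_iff.2 hn
    omega
  · have hlt : ∀ i j, i < j → j < α.length → α.sizeUpTo i < α.sizeUpTo j := fun i j hij hj =>
      (α.sizeUpTo_strict_mono (hij.trans hj)).trans_le (α.monotone_sizeUpTo hij)
    intro i hi j hj hij
    simp only [Finset.coe_Ioo, Set.mem_Ioo] at hi hj
    rcases lt_trichotomy i j with h | h | h
    · have := hlt i j h hj.2
      omega
    · exact h
    · have := hlt j i h hi.2
      omega

theorem mem_boundaries {n : ℕ} {α : Composition n} {x : Fin (n + 1)} :
    x ∈ α.boundaries ↔ ∃ i, α.sizeUpTo i = x := by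
  simp only [Composition.boundaries, Finset.mem_map, Finset.mem_univ, true_and]
  constructor
  · rintro ⟨i, rfl⟩
    exact ⟨i, rfl⟩
  · rintro ⟨i, hi⟩
    by_cases h : i < α.length + 1
    · exact ⟨⟨i, h⟩, Fin.ext hi⟩
    · refine ⟨Fin.last _, Fin.ext ?_⟩
      rw [α.sizeUpTo_ofLength_le i (by omega)] at hi
      simp [← hi]

theorem partialSums_injective {n : ℕ} :
    Function.Injective (partialSums : Composition n → Finset ℕ) := by
  intro α β h
  apply (compositionEquiv n).injective
  apply CompositionAsSet.ext
  change α.boundaries = β.boundaries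
  ext x
  rw [mem_boundaries, mem_boundaries]
  have key := congrArg (fun s => (x : ℕ) ∈ s) h
  simp only [mem_partialSums, eq_iff_iff] at key
  rcases Nat.eq_zero_or_pos (x : ℕ) with h0 | h0
  · rw [h0]
    exact iff_of_true ⟨0, α.sizeUpTo_zero⟩ ⟨0, β.sizeUpTo_zero⟩
  · have hx := x.2
    by_cases hn : (x : ℕ) < n
    · simpa [h0, hn] using key
    · have : (x : ℕ) = n := by omega
      rw [this]
      exact iff_of_true ⟨_, α.sizeUpTo_length⟩ ⟨_, β.sizeUpTo_length⟩

theorem partialSums_compOfSet (n : ℕ) (X : Finset ℕ) :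
    partialSums (compOfSet n X) = X.filter fun x => 0 < x ∧ x < n := by
  ext x
  rw [mem_partialSums, Finset.mem_filter]
  have : ∀ hx : x < n + 1, (∃ i, (compOfSet n X).sizeUpTo i = x) ↔ x = 0 ∨ x = n ∨ x ∈ X := by
    intro hx
    have h := mem_boundaries (α := compOfSet n X) (x := ⟨x, hx⟩)
    rw [compOfSet, CompositionAsSet.toComposition_boundaries] at h
    simp only [Finset.mem_filter, Finset.mem_univ, true_and] at h
    rw [compOfSet, ← h]
    simp [Fin.ext_iff]
  constructor
  · rintro ⟨h1, h2, h3⟩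
    rw [this (by omega)] at h3
    exact ⟨(h3.resolve_left h1.ne').resolve_left h2.ne, h1, h2⟩
  · rintro ⟨h1, h2, h3⟩
    exact ⟨h2, h3, (this (by omega)).2 (Or.inr (Or.inr h1))⟩

/-! ### Refinement as inclusion of partial sums -/

/-- Cut `b` where its partial sum equals the first part of `a`, and recur on the remainder. Since
`b` has no zeros, nothing of it is left when `a` is exhausted. -/
theorem exists_flatten {a b : List ℕ} (hb : 0 ∉ b) (hs : a.sum = b.sum)
    (h : ∀ i, ∃ j, (b.take j).sum = (a.take i).sum) :
    ∃ L : List (List ℕ), L.flatten = b ∧ L.map List.sum = a := by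
  induction a generalizing b with
  | nil =>
    refine ⟨[], ?_, rfl⟩
    rcases b with _ | ⟨x, b⟩
    · rfl
    · rw [List.sum_nil, List.sum_cons] at hs
      exact absurd (List.mem_cons.2 (Or.inl (by omega))) hb
  | cons x a ih =>
    obtain ⟨j, hj⟩ := h 1
    simp only [List.take_succ_cons, List.take_zero, List.sum_cons, List.sum_nil, add_zero] at hj
    have hsplit := List.sum_take_add_sum_drop b j
    obtain ⟨L, hL1, hL2⟩ := ih (b := b.drop j) (fun h0 => hb (List.mem_of_mem_drop h0))
      (by rw [List.sum_cons] at hs; omega) (fun i => by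
        obtain ⟨k, hk⟩ := h (i + 1)
        rw [List.take_succ_cons, List.sum_cons] at hk
        by_cases hkj : k ≤ j
        · refine ⟨0, ?_⟩
          have : (b.take k).sum ≤ (b.take j).sum := by
            have : b.take k = (b.take j).take k := by rw [List.take_take, min_eq_left hkj]
            rw [this]
            exact (List.take_sublist _ _).sum_le_sum (by simp)
          simp
          omega
        · obtain ⟨k', rfl⟩ := Nat.exists_eq_add_of_le (not_le.1 hkj).le
          refine ⟨k', ?_⟩
          rw [List.take_add, List.sum_append] at hk
          omega)
    refine ⟨b.take j :: L, ?_, ?_⟩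
    · rw [List.flatten_cons, hL1, List.take_append_drop]
    · rw [List.map_cons, hj, hL2]

theorem refines_iff {n : ℕ} {α β : Composition n} :
    Refines β α ↔ partialSums α ⊆ partialSums β := by
  constructor
  · rintro ⟨L, h1, h2⟩ x hx
    rw [mem_partialSums] at hx ⊢
    obtain ⟨h3, h4, i, rfl⟩ := hx
    refine ⟨h3, h4, (L.take i).flatten.length, ?_⟩
    have : L.flatten = (L.take i).flatten ++ (L.drop i).flatten := by
      rw [← List.flatten_append, List.take_append_drop]
    rw [Composition.sizeUpTo, Composition.sizeUpTo, ← h1, ← h2, this, List.take_left,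
      ← List.map_take, List.sum_flatten]
  · intro h
    refine exists_flatten (zero_notMem_blocks β) (α.blocks_sum.trans β.blocks_sum.symm) fun i => ?_
    change ∃ j, β.sizeUpTo j = α.sizeUpTo i
    rcases Nat.eq_zero_or_pos (α.sizeUpTo i) with h0 | h0
    · exact ⟨0, by rw [h0, β.sizeUpTo_zero]⟩
    · by_cases hn : α.sizeUpTo i < n
      · exact (mem_partialSums.1 (h (mem_partialSums.2 ⟨h0, hn, i, rfl⟩))).2.2
      · have := α.sizeUpTo_le i
        exact ⟨β.length, by rw [β.sizeUpTo_length]; omega⟩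

/-- Subsets of `G` that contain exactly one of `p` and `p - 1` for each `p ∈ P`. -/
theorem card_separating (G P : Finset ℕ) (hP : ∀ p ∈ P, 0 < p ∧ p + 1 ∉ P) :
    2 ^ P.card * (G.powerset.filter fun S => ∀ p ∈ P, (p ∈ S ↔ p - 1 ∉ S)).card =
      if ∀ p ∈ P, p ∈ G ∨ p - 1 ∈ G then 2 ^ G.card else 0 := by
  induction P using Finset.induction_on with
  | empty => simp
  | insert q P hq ih =>
    have hP' : ∀ p ∈ P, 0 < p ∧ p + 1 ∉ P := fun p hp =>
      ⟨(hP p (Finset.mem_insert_of_mem hp)).1, fun h =>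
        (hP p (Finset.mem_insert_of_mem hp)).2 (Finset.mem_insert_of_mem h)⟩
    have ih := ih hP'
    have hq0 := (hP q (Finset.mem_insert_self q P)).1
    by_cases hqG : q ∈ G ∨ q - 1 ∈ G
    · obtain ⟨x, hxG, hx⟩ : ∃ x ∈ G, x = q ∨ x = q - 1 := by
        rcases hqG with h | h
        · exact ⟨q, h, Or.inl rfl⟩
        · exact ⟨q - 1, h, Or.inr rfl⟩
      -- No two elements of `P` are adjacent, so the pairs `{p - 1, p}` are disjoint and `x` can be
      -- toggled without affecting the conditions for the other elements.
      have hxP : ∀ p ∈ P, x ≠ p ∧ x ≠ p - 1 := by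
        intro p hp
        have h1 := hP p (Finset.mem_insert_of_mem hp)
        have h2 := (hP q (Finset.mem_insert_self q P)).2
        have h3 : p ≠ q := fun h => hq (h ▸ hp)
        have h4 : p + 1 ≠ q := fun h => h1.2 (h ▸ Finset.mem_insert_self q P)
        have h5 : q + 1 ≠ p := fun h => h2 (h ▸ Finset.mem_insert_of_mem hp)
        omega
      set A := G.powerset.filter fun S => ∀ p ∈ P, (p ∈ S ↔ p - 1 ∉ S) with hA
      have hsplit := Finset.card_filter_add_card_filter_not (s := A)
        (fun S => (q ∈ S ↔ q - 1 ∉ S))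
      have hfil : (G.powerset.filter fun S => ∀ p ∈ insert q P, (p ∈ S ↔ p - 1 ∉ S)) =
          A.filter fun S => (q ∈ S ↔ q - 1 ∉ S) := by
        ext S
        simp only [hA, Finset.mem_filter, Finset.mem_insert, forall_eq_or_imp]
        tauto
      -- Toggling `x` flips the condition at `q`, so exactly half of `A` satisfies it; this absorbs
      -- the new factor `2`.
      have htog : (A.filter fun S => (q ∈ S ↔ q - 1 ∉ S)).card =
          (A.filter fun S => ¬ (q ∈ S ↔ q - 1 ∉ S)).card := by
        have hmem : ∀ (S : Finset ℕ) (y : ℕ), y ∈ symmDiff S {x} ↔ (y ∈ S ↔ y ≠ x) := by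
          intro S y
          simp only [Finset.mem_symmDiff, Finset.mem_singleton]
          tauto
        have hAs : ∀ S ∈ A, symmDiff S {x} ∈ A := by
          intro S hS
          simp only [hA, Finset.mem_filter, Finset.mem_powerset] at hS ⊢
          refine ⟨fun y hy => ?_, fun p hp => ?_⟩
          · rw [hmem] at hy
            by_cases hyx : y = x
            · exact hyx ▸ hxG
            · exact hS.1 (hy.2 hyx)
          · have := hxP p hp
            rw [hmem, hmem]
            have h1 := hS.2 p hp
            have h2 : p ≠ x := this.1.symm
            have h3 : p - 1 ≠ x := this.2.symm
            tauto
        have hflip : ∀ S : Finset ℕ, (q ∈ symmDiff S {x} ↔ q - 1 ∉ symmDiff S {x}) ↔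
            ¬ (q ∈ S ↔ q - 1 ∉ S) := by
          intro S
          rw [hmem, hmem]
          rcases hx with rfl | rfl
          · have : x - 1 ≠ x := by omega
            tauto
          · have : q ≠ q - 1 := by omega
            tauto
        refine Finset.card_nbij' (fun S => symmDiff S {x}) (fun S => symmDiff S {x}) ?_ ?_ ?_ ?_
        · intro S hS
          simp only [Finset.coe_filter, Set.mem_ofPred_eq] at hS ⊢
          refine ⟨hAs S hS.1, ?_⟩
          rw [hflip]
          tauto
        · intro S hS
          simp only [Finset.coe_filter, Set.mem_ofPred_eq] at hS ⊢
          refine ⟨hAs S hS.1, ?_⟩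
          rw [hflip]
          tauto
        · intro S _
          exact symmDiff_symmDiff_cancel_right _ _
        · intro S _
          exact symmDiff_symmDiff_cancel_right _ _
      rw [hfil, Finset.card_insert_of_notMem hq, pow_succ]
      have hiff : (∀ p ∈ insert q P, p ∈ G ∨ p - 1 ∈ G) ↔ ∀ p ∈ P, p ∈ G ∨ p - 1 ∈ G := by
        simp only [Finset.mem_insert, forall_eq_or_imp]
        exact and_iff_right hqG
      simp only [hiff]
      rw [← ih, mul_assoc]
      congr 1
      omega
    · have h1 : ¬ ∀ p ∈ insert q P, p ∈ G ∨ p - 1 ∈ G := fun h =>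
        hqG (h q (Finset.mem_insert_self q P))
      rw [if_neg h1, Finset.filter_eq_empty_iff.2, Finset.card_empty, mul_zero]
      intro S hS h
      have := h q (Finset.mem_insert_self q P)
      rw [Finset.mem_powerset] at hS
      have h2 : q ∉ S := fun h => hqG (Or.inl (hS h))
      have h3 : q - 1 ∉ S := fun h => hqG (Or.inr (hS h))
      tauto

/-- The coefficient of `M_γ` counts the subsets of `set(γ)` that contain exactly one of `p - 1` and
`p` for each peak `p`. By `card_separating`, multiplying by `2 ^ |P|` gives `2 ^ |set(γ)|` or `0`,
and the remaining factor `2` turns `|set(γ)|` into the length of `γ`. -/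
theorem peakFunction_eq {n : ℕ} (hn : 0 < n) (α : Composition n) :
    peakFunction α = ∑ γ : Composition n,
      (if ∀ p ∈ peakSet (partialSums α), p ∈ partialSums γ ∨ p - 1 ∈ partialSums γ
        then (2 : ℂ) ^ γ.length else 0) • monomialQS γ := by
  let _ : ∀ γ β : Composition n, Decidable (Refines γ β) := fun _ _ => Classical.propDecidable _
  set P := peakSet (partialSums α) with hPdef
  have hP : ∀ p ∈ P, 0 < p ∧ p + 1 ∉ P := by
    intro p hp
    simp only [hPdef, peakSet, Finset.mem_filter] at hp ⊢
    refine ⟨(mem_partialSums.1 hp.1).1, fun h => h.2.1 ?_⟩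
    simpa using hp.1
  have hsub : ∀ β : Composition n, P ⊆ symmDiff (partialSums β) ((partialSums β).image (· + 1)) ↔
      ∀ p ∈ P, (p ∈ partialSums β ↔ p - 1 ∉ partialSums β) := by
    intro β
    refine forall₂_congr fun p hp => ?_
    have hp0 := (hP p hp).1
    have : p ∈ (partialSums β).image (· + 1) ↔ p - 1 ∈ partialSums β := by
      rw [Finset.mem_image]
      constructor
      · rintro ⟨a, ha, rfl⟩
        simpa using ha
      · intro h
        exact ⟨p - 1, h, by omega⟩
    rw [Finset.mem_symmDiff, this]
    tauto
  have hcard : ∀ γ : Composition n, (Finset.univ.filter fun β : Composition n =>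
      P ⊆ symmDiff (partialSums β) ((partialSums β).image (· + 1)) ∧ Refines γ β).card =
      ((partialSums γ).powerset.filter fun S => ∀ p ∈ P, (p ∈ S ↔ p - 1 ∉ S)).card := by
    intro γ
    refine Finset.card_nbij partialSums ?_ partialSums_injective.injOn ?_
    · intro β hβ
      simp only [Finset.coe_filter, Finset.mem_univ, true_and, Set.mem_ofPred_eq,
        Finset.mem_powerset] at hβ ⊢
      rw [hsub, refines_iff] at hβ
      exact hβ.symm
    · intro S hS
      simp only [Finset.coe_filter, Finset.mem_powerset, Set.mem_ofPred_eq] at hS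
      have hSn : partialSums (compOfSet n S) = S := by
        rw [partialSums_compOfSet, Finset.filter_true_of_mem]
        intro x hx
        have := mem_partialSums.1 (hS.1 hx)
        exact ⟨this.1, this.2.1⟩
      refine ⟨compOfSet n S, ?_, hSn⟩
      simp only [Finset.coe_filter, Finset.mem_univ, true_and, Set.mem_ofPred_eq]
      rw [hsub, refines_iff, hSn]
      exact hS.symm
  simp only [peakFunction, fundamentalQS]
  rw [Finset.sum_filter]
  have h1 : ∀ β : Composition n, (if P ⊆ symmDiff (partialSums β) ((partialSums β).image (· + 1))
      then ∑ γ : Composition n with Refines γ β, monomialQS γ else 0) =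
      ∑ γ : Composition n, if P ⊆ symmDiff (partialSums β) ((partialSums β).image (· + 1)) ∧
        Refines γ β then monomialQS γ else 0 := by
    intro β
    split_ifs with h
    · simp [h, Finset.sum_filter]
    · simp [h]
  rw [Finset.sum_congr rfl fun β _ => h1 β, Finset.sum_comm, Finset.smul_sum]
  refine Finset.sum_congr rfl fun γ _ => ?_
  rw [← Finset.sum_filter, Finset.sum_const, hcard γ, ← Nat.cast_smul_eq_nsmul ℂ, smul_smul]
  congr 1
  have h2 := card_separating (partialSums γ) P hP
  have h3 : ((2 ^ P.card * ((partialSums γ).powerset.filter fun S =>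
      ∀ p ∈ P, (p ∈ S ↔ p - 1 ∉ S)).card : ℕ) : ℂ) =
      ((if ∀ p ∈ P, p ∈ partialSums γ ∨ p - 1 ∈ partialSums γ then 2 ^ (partialSums γ).card else 0 :
        ℕ) : ℂ) := congrArg _ h2
  push_cast at h3
  rw [pow_succ, mul_right_comm, h3, ← card_partialSums hn γ]
  split_ifs
  · rw [pow_succ]
  · simp

theorem peakSet_peakSet (X : Finset ℕ) : peakSet (peakSet X) = peakSet X := by
  ext i
  simp only [peakSet, Finset.mem_filter]
  tauto

/-- The expansion of the peak function of a descent set. -/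
theorem peakFunction_compOfSet {n : ℕ} (hn : 0 < n) {D : Finset ℕ} (hD : D ⊆ Finset.Icc 1 (n - 1)) :
    peakFunction (compOfSet n (peakSet D)) = ∑ γ : Composition n,
      (if ∀ p ∈ peakSet D, p ∈ partialSums γ ∨ p - 1 ∈ partialSums γ
        then (2 : ℂ) ^ γ.length else 0) • monomialQS γ := by
  rw [peakFunction_eq hn, partialSums_compOfSet, Finset.filter_true_of_mem, peakSet_peakSet]
  intro x hx
  have := Finset.mem_Icc.1 (hD (Finset.mem_filter.1 hx).1)
  omega

section
/-! ### Standardization of marked tableaux -/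

variable {n : ℕ} {α : Composition n}

/-- `S` lists the boxes by their entries in `T`; equal marked entries are listed from bottom to top
(and from right to left in a row), equal unmarked entries in the opposite order. -/
structure IsStandardization (S : Filling α (Entry n)) (T : Filling α (MarkedEntry n)) : Prop where
  bijective : Function.Bijective S
  le : ∀ b b', S b < S b' → T b ≤ T b'
  marked_iff : ∀ b b', S b < S b' → T b = T b' →
    ((T b).IsMarked ↔ b.row < b'.row ∨ b.row = b'.row ∧ b'.col < b.col)

open scoped Classical in
/-- The sort key of a box. -/
noncomputable def sortKey (T : Filling α (MarkedEntry n)) (b : Box α) :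
    MarkedEntry n ×ₗ (ℤ ×ₗ ℤ) :=
  toLex (T b, if (T b).IsMarked then toLex ((b.row : ℤ), -(b.col : ℤ))
    else toLex (-(b.row : ℤ), (b.col : ℤ)))

theorem sortKey_injective (T : Filling α (MarkedEntry n)) : Function.Injective (sortKey T) := by
  intro b b' h
  simp only [sortKey, EmbeddingLike.apply_eq_iff_eq, Prod.mk.injEq] at h
  obtain ⟨h1, h2⟩ := h
  rw [← h1] at h2
  split_ifs at h2 <;>
  · simp only [EmbeddingLike.apply_eq_iff_eq, Prod.mk.injEq] at h2
    exact Box.ext (by omega) (by omega)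

theorem sortKey_lt_iff {T : Filling α (MarkedEntry n)} {b b' : Box α} (hb : b ≠ b') :
    sortKey T b < sortKey T b' ↔ T b ≤ T b' ∧ (T b = T b' →
      ((T b).IsMarked ↔ b.row < b'.row ∨ b.row = b'.row ∧ b'.col < b.col)) := by
  have hne : ¬ (b.col = b'.col ∧ b.row = b'.row) := fun h => hb (Box.ext h.1 h.2)
  rw [sortKey, sortKey, Prod.Lex.toLex_lt_toLex]
  simp only
  constructor
  · rintro (h | ⟨h1, h2⟩)
    · exact ⟨h.le, fun h' => absurd h' h.ne⟩
    · refine ⟨h1.le, fun _ => ?_⟩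
      rw [← h1] at h2
      split_ifs at h2 with hm <;> rw [Prod.Lex.toLex_lt_toLex] at h2 <;> simp only at h2
      · exact iff_of_true hm (by omega)
      · exact iff_of_false hm (by omega)
  · rintro ⟨h1, h2⟩
    rcases h1.lt_or_eq with h | h
    · exact Or.inl h
    · refine Or.inr ⟨h, ?_⟩
      have h2 := h2 h
      rw [← h]
      split_ifs with hm <;> rw [Prod.Lex.toLex_lt_toLex] <;> simp only
      · have := h2.1 hm
        omega
      · have := mt h2.2 hm
        omega

theorem isStandardization_iff {S : Filling α (Entry n)} {T : Filling α (MarkedEntry n)} :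
    IsStandardization S T ↔
      Function.Bijective S ∧ ∀ b b', S b < S b' ↔ sortKey T b < sortKey T b' := by
  constructor
  · intro h
    have key : ∀ b b', S b < S b' → sortKey T b < sortKey T b' := fun b b' hb =>
      (sortKey_lt_iff (by rintro rfl; exact lt_irrefl _ hb)).2
        ⟨h.le b b' hb, h.marked_iff b b' hb⟩
    refine ⟨h.bijective, fun b b' => ⟨key b b', fun hb => ?_⟩⟩
    rcases lt_trichotomy (S b) (S b') with h1 | h1 | h1
    · exact h1
    · rw [h.bijective.1 h1] at hb
      exact absurd hb (lt_irrefl _)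
    · exact absurd (key _ _ h1) hb.not_gt
  · rintro ⟨h1, h2⟩
    have key : ∀ b b', S b < S b' → T b ≤ T b' ∧ (T b = T b' →
        ((T b).IsMarked ↔ b.row < b'.row ∨ b.row = b'.row ∧ b'.col < b.col)) := fun b b' hb =>
      (sortKey_lt_iff (by rintro rfl; exact lt_irrefl _ hb)).1 ((h2 b b').1 hb)
    exact ⟨h1, fun b b' hb => (key b b' hb).1, fun b b' hb => (key b b' hb).2⟩

/-- A set of boxes that is closed downward in the order given by `S`. -/
theorem filter_eq_of_downward {S : Filling α (Entry n)} (hS : Function.Bijective S)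
    {p : Box α → Prop} [DecidablePred p] (h : ∀ b b', p b' → S b < S b' → p b) :
    ∃ k ≤ n, ∀ b, p b ↔ (S b : ℕ) ≤ k := by
  set A := (Finset.univ.filter p).image fun b => (S b : ℕ) with hA
  have hmem : ∀ b, (S b : ℕ) ∈ A ↔ p b := by
    intro b
    simp only [hA, Finset.mem_image, Finset.mem_filter, Finset.mem_univ, true_and]
    constructor
    · rintro ⟨b', h1, h2⟩
      rwa [← hS.1 (Subtype.ext h2)]
    · exact fun h => ⟨b, h, rfl⟩
  have h0 : ∀ x ∈ A, ∃ b, (S b : ℕ) = x := fun x hx => by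
    obtain ⟨b, -, rfl⟩ := Finset.mem_image.1 hx
    exact ⟨b, rfl⟩
  have hIcc := eq_Icc_of_downward (S := A) (fun x hx => by
    obtain ⟨b, rfl⟩ := h0 x hx
    exact (Finset.mem_Icc.1 (S b).2).1) (fun x hx y hy hyx => by
    obtain ⟨b, rfl⟩ := h0 x hx
    have hn := (Finset.mem_Icc.1 (S b).2).2
    obtain ⟨b', hb'⟩ := hS.2 ⟨y, Finset.mem_Icc.2 ⟨hy, hyx.trans hn⟩⟩
    have hby : (S b' : ℕ) = y := by rw [hb']
    rw [← hby, hmem]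
    rw [hmem] at hx
    rcases hyx.lt_or_eq with h1 | h1
    · exact h b' b hx (by rw [← Subtype.coe_lt_coe, hby]; exact h1)
    · rwa [hS.1 (Subtype.ext (hby.trans h1))])
  refine ⟨A.card, ?_, fun b => ?_⟩
  · refine Finset.card_image_le.trans ((Finset.card_filter_le _ _).trans ?_)
    rw [Finset.card_univ, card_box]
  · rw [← hmem, hIcc, Finset.mem_Icc, Nat.card_Icc, Nat.add_sub_cancel]
    exact ⟨And.right, fun h => ⟨(Finset.mem_Icc.1 (S b).2).1, h⟩⟩

/-- An entry is its own rank, so a standard filling is determined by the order of its boxes;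
uniqueness of the standardization rests on this. -/
theorem entry_eq_card {S : Filling α (Entry n)} (hS : Function.Bijective S) (b : Box α) :
    (S b : ℕ) = (Finset.univ.filter fun b' => S b' ≤ S b).card := by
  have h1 : ((Finset.univ.filter fun b' => S b' ≤ S b).image fun b' => (S b' : ℕ)) =
      Finset.Icc 1 (S b : ℕ) := by
    ext x
    simp only [Finset.mem_image, Finset.mem_filter, Finset.mem_univ, true_and, Finset.mem_Icc]
    constructor
    · rintro ⟨b', h, rfl⟩
      exact ⟨(Finset.mem_Icc.1 (S b').2).1, h⟩
    · rintro ⟨h2, h3⟩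
      obtain ⟨b', hb'⟩ := hS.2 ⟨x, Finset.mem_Icc.2 ⟨h2,
        h3.trans (Finset.mem_Icc.1 (S b).2).2⟩⟩
      refine ⟨b', ?_, by rw [hb']⟩
      rw [hb']
      exact h3
  have h2 := congrArg Finset.card h1
  rw [Nat.card_Icc, Nat.add_sub_cancel, Finset.card_image_of_injective] at h2
  · exact h2.symm
  · exact fun b b' h => hS.1 (Subtype.ext h)

theorem existsUnique_standardization (T : Filling α (MarkedEntry n)) :
    ∃! S, IsStandardization S T := by
  have hmem : ∀ b : Box α, (Finset.univ.filter fun b' => sortKey T b' ≤ sortKey T b).card ∈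
      Finset.Icc 1 n := by
    intro b
    rw [Finset.mem_Icc]
    constructor
    · exact Finset.card_pos.2 ⟨b, by simp⟩
    · refine (Finset.card_filter_le _ _).trans ?_
      rw [Finset.card_univ, card_box]
  let S : Filling α (Entry n) := fun b => ⟨_, hmem b⟩
  have hlt : ∀ b b', sortKey T b < sortKey T b' → S b < S b' := by
    intro b b' h
    rw [← Subtype.coe_lt_coe]
    refine Finset.card_lt_card ⟨fun x hx => ?_, fun hsub => ?_⟩
    · simp only [Finset.mem_filter, Finset.mem_univ, true_and] at hx ⊢
      exact hx.trans h.le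
    · have := hsub (show b' ∈ _ by simp)
      simp only [Finset.mem_filter, Finset.mem_univ, true_and] at this
      exact h.not_ge this
  have hinj : Function.Injective S := by
    intro b b' h
    rcases lt_trichotomy (sortKey T b) (sortKey T b') with h1 | h1 | h1
    · exact absurd h (hlt _ _ h1).ne
    · exact sortKey_injective T h1
    · exact absurd h (hlt _ _ h1).ne'
  have hbij : Function.Bijective S := by
    refine (Fintype.bijective_iff_injective_and_card S).2 ⟨hinj, ?_⟩
    rw [card_box, Fintype.card_coe, Nat.card_Icc, Nat.add_sub_cancel]
  refine ⟨S, isStandardization_iff.2 ⟨hbij, fun b b' => ⟨fun h => ?_, hlt b b'⟩⟩, fun S' hS' => ?_⟩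
  · rcases lt_trichotomy (sortKey T b) (sortKey T b') with h1 | h1 | h1
    · exact h1
    · rw [sortKey_injective T h1] at h
      exact absurd h (lt_irrefl _)
    · exact absurd (hlt _ _ h1) h.not_gt
  · obtain ⟨h1, h2⟩ := isStandardization_iff.1 hS'
    funext b
    refine Subtype.ext ((entry_eq_card h1 b).trans ?_)
    congr 1
    refine Finset.filter_congr fun b' _ => ?_
    rw [← not_lt, h2, not_lt]

theorem val_mono {x y : MarkedEntry n} (h : x ≤ y) : x.val ≤ y.val := by
  rcases Prod.Lex.le_iff.1 h with h | h
  · exact (Subtype.coe_lt_coe.2 h).le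
  · exact (congrArg Subtype.val h.1).le

/-- An unmarked entry is the largest one with its value. -/
theorem eq_of_le_of_not_isMarked {x y : MarkedEntry n} (h : x ≤ y) (hx : ¬ x.IsMarked)
    (hv : y.val = x.val) : x = y := by
  have h1 : (ofLex x).1 = (ofLex y).1 := Subtype.ext hv.symm
  have hx : (ofLex x).2 = true := by simpa [MarkedEntry.IsMarked] using hx
  rcases Prod.Lex.le_iff.1 h with h | h
  · exact absurd h1 h.ne
  · refine ofLex.injective (Prod.ext h1 ?_)
    rw [hx] at h ⊢
    exact (Bool.eq_true_of_true_le h.2).symm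

theorem IsStandardization.isMPCT {S : Filling α (Entry n)} {T : Filling α (MarkedEntry n)}
    (h : IsStandardization S T) (hS : IsSPIT S) : IsMPCT T where
  row_weak b b' hr hc := h.le b b' (hS.row_increasing b b' hr hc)
  row_marked b b' hr hc hm he := by
    have := (h.marked_iff b b' (hS.row_increasing b b' hr hc) he).1 hm
    omega
  first_col b b' hb hb' hr := by
    obtain ⟨d, hd1, hd2, hd3⟩ := hS.peak b' hb' b.row b.one_le_row hr
    have hbd := hS.row_increasing b d hd2.symm (by omega)
    refine (h.le b b' (hbd.trans hd3)).lt_of_ne fun he => ?_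
    -- The second box `d` of the lower row is listed between `b` and `b'`, so all three entries
    -- agree. Going up to `b'` requires a mark, going right to `d` excludes it.
    have he' : T b = T d := le_antisymm (h.le _ _ hbd) (he ▸ h.le _ _ hd3)
    have h1 := h.marked_iff _ _ hbd he'
    have h2 := h.marked_iff _ _ (hbd.trans hd3) he
    have h3 := h2.2 (Or.inl hr)
    rw [h1] at h3
    omega
  peak k hk := by
    obtain ⟨j, hj, hj'⟩ := filter_eq_of_downward h.bijective (p := fun b => (T b).val ≤ k)
      fun b b' hb' hlt => (val_mono (h.le b b' hlt)).trans hb'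
    have := hS.isPeakDiagram hj
    simp only [hj']
    exact this
  second_col b b' hb hm hb' hr hv := by
    obtain ⟨d, hd1, hd2, hd3⟩ := hS.peak b' hb' b.row b.one_le_row (by omega)
    rw [Box.ext (hd1.trans hb.symm) hd2] at hd3
    have := h.marked_iff b b' hd3 (eq_of_le_of_not_isMarked (h.le _ _ hd3) hm hv)
    exact hm (this.2 (Or.inl (by omega)))

theorem IsStandardization.isSPIT {S : Filling α (Entry n)} {T : Filling α (MarkedEntry n)}
    (h : IsStandardization S T) (hT : IsMPCT T) : IsSPIT S := by
  refine ⟨⟨h.bijective, fun b b' hr hc => ?_⟩, fun b hb r hr1 hr2 => ?_⟩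
  · by_contra hlt
    have hne : S b' ≠ S b := fun he => by
      have := h.bijective.1 he
      subst this
      omega
    have hlt := (not_lt.1 hlt).lt_of_ne hne
    have he := le_antisymm (h.le _ _ hlt) (hT.row_weak b b' hr hc)
    have := (h.marked_iff _ _ hlt he).2 (Or.inr ⟨hr.symm, hc⟩)
    exact hT.row_marked b b' hr hc (he ▸ this) he.symm
  · have hdiag : ∀ a : Box α, a.col = 1 → ∀ r', 1 ≤ r' → r' < a.row →
        ∃ d : Box α, d.col = 2 ∧ d.row = r' ∧ (T d).val ≤ (T a).val := by
      intro a ha r' h1 h2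
      obtain ⟨m, γ, hγ, hdiag⟩ := hT.peak (T a).val (Finset.mem_Icc.1 (ofLex (T a)).1.2).2
      have ham : a.1 ∈ diagram γ := by
        rw [hdiag]
        exact Finset.mem_image_of_mem _ (by simp)
      have := hγ.two_mem_diagram (c := a.col) (r := a.row) ham h1 h2
      rw [hdiag] at this
      obtain ⟨d, hd, hd'⟩ := Finset.mem_image.1 this
      simp only [Finset.mem_filter, Finset.mem_univ, true_and] at hd
      exact ⟨d, congrArg Prod.fst hd', congrArg Prod.snd hd', hd⟩
    -- The first column increases, so it suffices to treat the row directly above `r`, the only one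
    -- that condition (4) speaks about.
    obtain ⟨a, ha1, ha2, ha3⟩ : ∃ a : Box α, a.col = 1 ∧ a.row = r + 1 ∧ S a ≤ S b := by
      by_cases hbr : b.row = r + 1
      · exact ⟨b, hb, hbr, le_rfl⟩
      · obtain ⟨d, hd1, hd2, -⟩ := hdiag b hb (r + 1) (by omega) (by omega)
        obtain ⟨a, ha1, ha2⟩ := d.exists_of_le (c := 1) le_rfl (by omega)
        refine ⟨a, ha1, ha2.trans hd2, ?_⟩
        by_contra hlt
        exact (h.le _ _ (not_le.1 hlt)).not_gt (hT.first_col a b ha1 hb (by omega))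
    obtain ⟨d, hd1, hd2, hd3⟩ := hdiag a ha1 r hr1 (by omega)
    refine ⟨d, hd1, hd2, lt_of_lt_of_le ?_ ha3⟩
    by_contra hlt
    have hne : S a ≠ S d := fun he => by
      have := h.bijective.1 he
      subst this
      omega
    have hlt := (not_lt.1 hlt).lt_of_ne hne
    have hle := h.le _ _ hlt
    have hv := le_antisymm hd3 (val_mono hle)
    -- If `a` were listed before `d`, their values would agree. Condition (4) then forces a mark on
    -- `d`, so `a` is marked too, but equal marked entries are listed upwards and `d` is lower.
    have hm : (T d).IsMarked := by
      by_contra hm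
      exact hT.second_col d a hd1 hm ha1 (by omega) hv.symm
    have ham : (T a).IsMarked := by
      by_contra ham
      rw [eq_of_le_of_not_isMarked hle ham hv] at ham
      exact ham hm
    have he : T a = T d := ofLex.injective (Prod.ext (Subtype.ext hv.symm)
      ((show (ofLex (T a)).2 = false from ham).trans (show (ofLex (T d)).2 = false from hm).symm))
    have := (h.marked_iff _ _ hlt he).1 ham
    omega

end

section
/-! ### Weights and packed tableaux -/

theorem getD_filter_ne_zero {L : List ℕ}
    (h : ∀ i j, i < j → j < L.length → L.getD i 0 = 0 → L.getD j 0 = 0) (i : ℕ) :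
    (L.filter (· ≠ 0)).getD i 0 = L.getD i 0 := by
  induction L generalizing i with
  | nil => rfl
  | cons a L ih =>
    have ih := ih fun i j hij hj h0 => by
      simpa using h (i + 1) (j + 1) (by omega) (by simpa using hj) (by simpa using h0)
    by_cases ha : a = 0
    · have h0 : ∀ j, L.getD j 0 = 0 := by
        intro j
        by_cases hj : j < L.length
        · simpa using h 0 (j + 1) (by omega) (by simpa using hj) (by simpa using ha)
        · exact List.getD_eq_default _ _ (by omega)
      rw [List.filter_cons_of_neg (by simpa using ha), ih, h0]
      rcases i with _ | i
      · simp [ha]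
      · simpa using (h0 i).symm
    · rw [List.filter_cons_of_pos (by simpa using ha)]
      rcases i with _ | i
      · simp
      · simpa using ih i

theorem filter_ne_zero_eq {L B : List ℕ} (hB : 0 ∉ B) (h : ∀ i, L.getD i 0 = B.getD i 0) :
    L.filter (· ≠ 0) = B := by
  refine eq_of_getD_eq (by simp) hB fun i => ?_
  rw [← h, getD_filter_ne_zero]
  intro i j hij _ h0
  rw [h, getD_eq_zero_iff hB] at h0 ⊢
  omega

variable {n : ℕ} {α : Composition n}

/-- For a packed weight, the filter drops only trailing zeros, which the default value `0` of `getD`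
restores. -/
theorem packed_iff (T : Filling α (MarkedEntry n)) (γ : Composition n) :
    IsPacked T ∧ weightComposition T = γ ↔ ∀ i < n, weight T (i + 1) = γ.blocks.getD i 0 := by
  set L := (List.range' 1 n).map (weight T) with hL
  have hlen : L.length = n := by simp [hL]
  have hget : ∀ i < n, L.getD i 0 = weight T (i + 1) := by
    intro i hi
    rw [List.getD_eq_getElem _ _ (by omega)]
    simp [hL, add_comm]
  have hget' : ∀ i, n ≤ i → L.getD i 0 = 0 := fun i hi => List.getD_eq_default _ _ (by omega)
  constructor
  · rintro ⟨h1, rfl⟩ i hi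
    rw [← hget i hi]
    refine (getD_filter_ne_zero (fun i j hij hj h0 => ?_) i).symm
    rw [hlen] at hj
    rw [hget _ (by omega)] at h0 ⊢
    exact h1 _ _ (by omega) (by omega) (by omega) h0
  · intro h
    have hz := zero_notMem_blocks γ
    have hγ : ∀ i, L.getD i 0 = γ.blocks.getD i 0 := by
      intro i
      by_cases hi : i < n
      · rw [hget i hi, h i hi]
      · rw [hget' i (by omega), eq_comm, getD_eq_zero_iff hz]
        exact γ.length_le.trans (by omega)
    refine ⟨fun i j h1 h2 h3 h4 => ?_, Composition.ext (filter_ne_zero_eq hz hγ)⟩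
    obtain ⟨i, rfl⟩ := Nat.exists_eq_add_of_le' h1
    obtain ⟨j, rfl⟩ := Nat.exists_eq_add_of_le' (h1.trans h2.le)
    rw [h _ (by omega), getD_eq_zero_iff hz] at h4 ⊢
    omega

theorem sizeUpTo_add_getD (γ : Composition n) (i : ℕ) :
    γ.sizeUpTo (i + 1) = γ.sizeUpTo i + γ.blocks.getD i 0 := by
  by_cases hi : i < γ.blocks.length
  · rw [γ.sizeUpTo_succ hi, List.getD_eq_getElem _ _ hi]
  · have hi : γ.length ≤ i := not_lt.1 hi
    rw [γ.sizeUpTo_ofLength_le _ (by omega), γ.sizeUpTo_ofLength_le _ hi,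
      List.getD_eq_default _ _ hi, add_zero]

/-- The block of `γ` (counted from `1`) that contains the entry of a box. -/
def blockIndex (γ : Composition n) (S : Filling α (Entry n)) (b : Box α) : ℕ :=
  γ.index ⟨(S b : ℕ) - 1, by have := Finset.mem_Icc.1 (S b).2; omega⟩ + 1

theorem blockIndex_le_iff {γ : Composition n} {S : Filling α (Entry n)} {b : Box α} {i : ℕ} :
    blockIndex γ S b ≤ i ↔ (S b : ℕ) ≤ γ.sizeUpTo i := by
  have hb := Finset.mem_Icc.1 (S b).2
  set j : Fin n := ⟨(S b : ℕ) - 1, by omega⟩ with hj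
  have h1 := γ.sizeUpTo_index_le j
  have h2 := γ.lt_sizeUpTo_index_succ j
  have hjv : (j : ℕ) = S b - 1 := rfl
  rw [Fin.val_succ] at h2
  change (γ.index j : ℕ) + 1 ≤ i ↔ _
  constructor
  · intro h
    have := γ.monotone_sizeUpTo h
    omega
  · intro h
    by_contra hi
    have := γ.monotone_sizeUpTo (show i ≤ γ.index j by omega)
    omega

theorem blockIndex_mem (γ : Composition n) (S : Filling α (Entry n)) (b : Box α) :
    blockIndex γ S b ∈ Finset.Icc 1 n := by
  rw [Finset.mem_Icc]
  refine ⟨by simp [blockIndex], ?_⟩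
  rw [blockIndex_le_iff, γ.sizeUpTo_ofLength_le _ γ.length_le]
  exact (Finset.mem_Icc.1 (S b).2).2

theorem blockIndex_mono {γ : Composition n} {S : Filling α (Entry n)} {b b' : Box α}
    (h : S b ≤ S b') : blockIndex γ S b ≤ blockIndex γ S b' := by
  rw [blockIndex_le_iff]
  exact le_trans h (blockIndex_le_iff.1 le_rfl)

theorem blockIndex_eq_iff {γ : Composition n} {S : Filling α (Entry n)} {b b' : Box α}
    (h : (S b' : ℕ) = S b + 1) :
    blockIndex γ S b = blockIndex γ S b' ↔ (S b : ℕ) ∉ partialSums γ := by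
  have hb := Finset.mem_Icc.1 (S b).2
  have hb' := Finset.mem_Icc.1 (S b').2
  constructor
  · intro he hG
    obtain ⟨-, -, i, hi⟩ := mem_partialSums.1 hG
    have h1 := (blockIndex_le_iff (γ := γ)).2 hi.ge
    rw [he, blockIndex_le_iff] at h1
    omega
  · intro hG
    refine le_antisymm (blockIndex_mono ?_) ?_
    · rw [← Subtype.coe_le_coe]
      omega
    · rw [blockIndex_le_iff, h]
      have h1 := (blockIndex_le_iff (γ := γ) (S := S) (b := b)).1 le_rfl
      refine Nat.lt_of_le_of_ne h1 fun he => hG ?_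
      exact mem_partialSums.2 ⟨by omega, by omega, _, he.symm⟩

theorem card_entry_mem {S : Filling α (Entry n)} (hS : Function.Bijective S) {X : Finset ℕ}
    (hX : X ⊆ Finset.Icc 1 n) : (Finset.univ.filter fun b => (S b : ℕ) ∈ X).card = X.card := by
  refine Finset.card_nbij (fun b => (S b : ℕ)) ?_ ?_ ?_
  · intro b hb
    simpa using hb
  · exact fun b _ b' _ h => hS.1 (Subtype.ext h)
  · intro x hx
    obtain ⟨b, hb⟩ := hS.2 ⟨x, hX hx⟩
    exact ⟨b, by simpa [hb] using hx, by simp [hb]⟩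

/-- Since `T` is weakly increasing along `S`, the boxes with value at most `i` form an initial
segment. The weight fixes its length as `γ.sizeUpTo i`, and these segments determine all values. -/
theorem weight_eq_iff {S : Filling α (Entry n)} (hS : Function.Bijective S)
    {T : Filling α (MarkedEntry n)} (hT : ∀ b b', S b < S b' → T b ≤ T b') (γ : Composition n) :
    (∀ i < n, weight T (i + 1) = γ.blocks.getD i 0) ↔ ∀ b, (T b).val = blockIndex γ S b := by
  have hpos : ∀ b, 1 ≤ (T b).val := fun b => (Finset.mem_Icc.1 (ofLex (T b)).1.2).1
  have hle : ∀ b, (T b).val ≤ n := fun b => (Finset.mem_Icc.1 (ofLex (T b)).1.2).2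
  have hsum : ∀ i, (Finset.univ.filter fun b => (T b).val ≤ i + 1).card =
      (Finset.univ.filter fun b => (T b).val ≤ i).card + weight T (i + 1) := by
    intro i
    rw [weight, ← Finset.card_union_of_disjoint]
    · congr 1
      ext b
      simp only [Finset.mem_filter, Finset.mem_univ, true_and, Finset.mem_union]
      omega
    · rw [Finset.disjoint_filter]
      intro b _ h
      omega
  have hIcc : ∀ k ≤ n, (Finset.univ.filter fun b => (S b : ℕ) ≤ k).card = k := by
    intro k hk
    have := card_entry_mem hS (Finset.Icc_subset_Icc_right hk : Finset.Icc 1 k ⊆ _)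
    rw [Nat.card_Icc, Nat.add_sub_cancel] at this
    refine (congrArg Finset.card (Finset.filter_congr fun b _ => ?_)).trans this
    rw [Finset.mem_Icc]
    exact ⟨fun h => ⟨(Finset.mem_Icc.1 (S b).2).1, h⟩, And.right⟩
  constructor
  · intro h
    have hcum : ∀ i ≤ n, (Finset.univ.filter fun b => (T b).val ≤ i).card = γ.sizeUpTo i := by
      intro i
      induction i with
      | zero =>
        intro _
        rw [γ.sizeUpTo_zero, Finset.card_eq_zero, Finset.filter_eq_empty_iff]
        intro b _ h0
        have := hpos b
        omega
      | succ i ih =>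
        intro hi
        rw [hsum, ih (by omega), h i hi, sizeUpTo_add_getD]
    have hiff : ∀ i ≤ n, ∀ b, (T b).val ≤ i ↔ (S b : ℕ) ≤ γ.sizeUpTo i := by
      intro i hi
      obtain ⟨k, hk, hk'⟩ := filter_eq_of_downward hS (p := fun b => (T b).val ≤ i)
        fun b b' hb' hlt => (val_mono (hT b b' hlt)).trans hb'
      have : k = γ.sizeUpTo i := by
        rw [← hcum i hi, ← hIcc k hk]
        simp only [hk']
      rw [← this]
      exact hk'
    intro b
    refine eq_of_forall_ge_iff fun i => ?_
    by_cases hi : i ≤ n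
    · rw [hiff i hi, blockIndex_le_iff]
    · have h1 := hle b
      have h2 := (Finset.mem_Icc.1 (blockIndex_mem γ S b)).2
      exact iff_of_true (by omega) (by omega)
  · intro h i _
    have hcum : ∀ i, (Finset.univ.filter fun b => (T b).val ≤ i).card = γ.sizeUpTo i := by
      intro i
      simp only [h, blockIndex_le_iff]
      exact hIcc _ (γ.sizeUpTo_le i)
    have := hsum i
    rw [hcum, hcum, sizeUpTo_add_getD] at this
    omega

end

section
/-! ### Quasisymmetric Schur `Q`-functions in terms of peak functions -/

variable {n : ℕ} {α : Composition n}

/-- The conditions on the entry in a box, for the marked tableaux of weight `γ` with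
standardization `S`. -/
def IsAllowed (γ : Composition n) (S : Filling α (Entry n)) (b : Box α) (x : MarkedEntry n) : Prop :=
  x.val = blockIndex γ S b ∧
    ((S b : ℕ) ∈ descentAbove S \ partialSums γ → x.IsMarked) ∧
    ((S b : ℕ) - 1 ∈ Finset.Icc 1 (n - 1) \ (descentAbove S ∪ partialSums γ) → ¬ x.IsMarked)

theorem mem_descentAbove {S : Filling α (Entry n)} (hS : Function.Bijective S) {b b' : Box α}
    (h : (S b' : ℕ) = S b + 1) : (S b : ℕ) ∈ descentAbove S ↔ b.row < b'.row := by
  have hb := Finset.mem_Icc.1 (S b).2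
  have hb' := Finset.mem_Icc.1 (S b').2
  rw [descentAbove, Finset.mem_filter, Finset.mem_Icc]
  constructor
  · rintro ⟨-, d, d', hd, hd', hlt⟩
    have h1 : d = b := hS.1 (Subtype.ext hd)
    have h2 : d' = b' := hS.1 (Subtype.ext (hd'.trans h.symm))
    subst h1 h2
    exact hlt
  · exact fun hlt => ⟨by omega, b, b', rfl, h, hlt⟩

/-- Within a block, an unmarked entry is followed by an equal one, so the next box cannot be higher;
a marked entry is preceded by an equal marked one, so it must be higher than its predecessor. -/
theorem IsStandardization.isAllowed {S : Filling α (Entry n)} {T : Filling α (MarkedEntry n)}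
    (h : IsStandardization S T) (hS : IsRowStandard S) {γ : Composition n}
    (hγ : ∀ b, (T b).val = blockIndex γ S b) (b : Box α) : IsAllowed γ S b (T b) := by
  have hb := Finset.mem_Icc.1 (S b).2
  refine ⟨hγ b, fun hD => ?_, fun hD => ?_⟩
  · rw [Finset.mem_sdiff] at hD
    obtain ⟨b', hb'⟩ := exists_entry hS.bijective.2 (show (S b : ℕ) < n by
      have := Finset.mem_Icc.1 (Finset.mem_filter.1 hD.1).1
      omega)
    have hlt : S b < S b' := by
      rw [← Subtype.coe_lt_coe]
      omega
    have hv : (T b').val = (T b).val := by rw [hγ, hγ, (blockIndex_eq_iff hb').2 hD.2]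
    by_contra hm
    have he := eq_of_le_of_not_isMarked (h.le _ _ hlt) hm hv
    exact hm ((h.marked_iff _ _ hlt he).2 (Or.inl ((mem_descentAbove hS.bijective hb').1 hD.1)))
  · rw [Finset.mem_sdiff, Finset.mem_union, not_or, Finset.mem_Icc] at hD
    obtain ⟨b', hb'⟩ := exists_entry hS.bijective.2 (show (S b : ℕ) - 2 < n by omega)
    have hbb : (S b : ℕ) = S b' + 1 := by omega
    have hSb : (S b : ℕ) - 1 = S b' := by omega
    rw [hSb] at hD
    have hlt : S b' < S b := by
      rw [← Subtype.coe_lt_coe]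
      omega
    have hv : (T b).val = (T b').val := by rw [hγ, hγ, (blockIndex_eq_iff hbb).2 hD.2.2]
    intro hm
    have hm' : (T b').IsMarked := by
      by_contra hm'
      rw [eq_of_le_of_not_isMarked (h.le _ _ hlt) hm' hv] at hm'
      exact hm' hm
    have he : T b' = T b := ofLex.injective (Prod.ext (Subtype.ext hv.symm)
      ((show (ofLex (T b')).2 = false from hm').trans
        (show (ofLex (T b)).2 = false from hm).symm))
    rcases (h.marked_iff _ _ hlt he).1 hm' with h1 | h1
    · exact hD.2.1 ((mem_descentAbove hS.bijective hbb).2 h1)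
    · exact (hS.row_increasing b b' h1.1.symm h1.2).not_gt hlt

theorem le_of_val_of_isMarked {x y : MarkedEntry n} (hv : x.val ≤ y.val)
    (h : x.val = y.val → ¬ x.IsMarked → ¬ y.IsMarked) : x ≤ y := by
  rw [Prod.Lex.le_iff]
  rcases hv.lt_or_eq with h1 | h1
  · exact Or.inl h1
  · refine Or.inr ⟨Subtype.ext h1, ?_⟩
    have := h h1
    simp only [MarkedEntry.IsMarked, Bool.not_eq_false] at this
    rcases hx : (ofLex x).2 with _ | _
    · exact Bool.false_le _
    · rw [this hx]

/-- In a run of boxes of equal value, the entries that follow an unmarked entry are unmarked and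
weakly descend, and the entries that precede a marked entry are marked and ascend. -/
theorem run_of_isAllowed {S : Filling α (Entry n)} (hS : Function.Bijective S)
    {T : Filling α (MarkedEntry n)} {γ : Composition n} (h : ∀ b, IsAllowed γ S b (T b)) {b : Box α}
    (j : ℕ) : ∀ b', (S b' : ℕ) = S b + (j + 1) → (T b).val = (T b').val →
      (¬ (T b).IsMarked → ¬ (T b').IsMarked ∧ b'.row ≤ b.row) ∧
      ((T b').IsMarked → (T b).IsMarked ∧ b.row < b'.row) := by
  have hstep : ∀ d d', (S d' : ℕ) = S d + 1 → (T d).val = (T d').val →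
      ((T d).IsMarked ∧ d.row < d'.row) ∨ (¬ (T d').IsMarked ∧ d'.row ≤ d.row) := by
    intro d d' hd hv
    have h1 := Finset.mem_Icc.1 (S d).2
    have h2 := Finset.mem_Icc.1 (S d').2
    rw [(h d).1, (h d').1, blockIndex_eq_iff hd] at hv
    by_cases hD : (S d : ℕ) ∈ descentAbove S
    · exact Or.inl ⟨(h d).2.1 (Finset.mem_sdiff.2 ⟨hD, hv⟩), (mem_descentAbove hS hd).1 hD⟩
    · refine Or.inr ⟨(h d').2.2 ?_, not_lt.1 fun hlt => hD ((mem_descentAbove hS hd).2 hlt)⟩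
      rw [hd, Nat.add_sub_cancel, Finset.mem_sdiff, Finset.mem_Icc, Finset.mem_union]
      exact ⟨by omega, by tauto⟩
  induction j with
  | zero =>
    intro b' hb' hv
    rcases hstep b b' hb' hv with h1 | h1
    · exact ⟨fun h2 => absurd h1.1 h2, fun _ => h1⟩
    · exact ⟨fun _ => h1, fun h2 => absurd h2 h1.1⟩
  | succ j ih =>
    intro b' hb' hv
    have h2 := Finset.mem_Icc.1 (S b').2
    obtain ⟨d, hd⟩ := exists_entry hS.2 (show (S b : ℕ) + j < n by omega)
    have hlt1 : S b ≤ S d := by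
      rw [← Subtype.coe_le_coe]
      omega
    have hlt2 : S d ≤ S b' := by
      rw [← Subtype.coe_le_coe]
      omega
    have hv1 := blockIndex_mono (γ := γ) hlt1
    have hv2 := blockIndex_mono (γ := γ) hlt2
    rw [← (h _).1, ← (h _).1] at hv1 hv2
    have hvd : (T b).val = (T d).val := by omega
    obtain ⟨ih1, ih2⟩ := ih d (by omega) hvd
    rcases hstep d b' (by omega) (by omega) with h1 | h1
    · obtain ⟨h3, h4⟩ := ih2 h1.1
      exact ⟨fun h5 => absurd h3 h5, fun _ => ⟨h3, h4.trans h1.2⟩⟩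
    · exact ⟨fun h3 => ⟨h1.1, h1.2.trans (ih1 h3).2⟩, fun h3 => absurd h3 h1.1⟩

theorem isStandardization_of_isAllowed {S : Filling α (Entry n)} (hS : IsRowStandard S)
    {T : Filling α (MarkedEntry n)} {γ : Composition n} (h : ∀ b, IsAllowed γ S b (T b)) :
    IsStandardization S T := by
  have hrun : ∀ b b', S b < S b' → (T b).val = (T b').val →
      (¬ (T b).IsMarked → ¬ (T b').IsMarked ∧ b'.row ≤ b.row) ∧
      ((T b').IsMarked → (T b).IsMarked ∧ b.row < b'.row) := by
    intro b b' hlt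
    rw [← Subtype.coe_lt_coe] at hlt
    exact run_of_isAllowed hS.bijective h (S b' - S b - 1) b' (by omega)
  refine ⟨hS.bijective, fun b b' hlt => ?_, fun b b' hlt he => ?_⟩
  · refine le_of_val_of_isMarked ?_ fun hv hm => ((hrun b b' hlt hv).1 hm).1
    rw [(h b).1, (h b').1]
    exact blockIndex_mono hlt.le
  · obtain ⟨h1, h2⟩ := hrun b b' hlt (by rw [he])
    constructor
    · exact fun hm => Or.inl (h2 (he ▸ hm)).2
    · intro hr
      by_contra hm
      have := (h1 hm).2
      exact (hS.row_increasing b' b (by omega) (by omega)).not_gt hlt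

theorem isStandardization_packed_iff {S : Filling α (Entry n)} (hS : IsRowStandard S)
    (T : Filling α (MarkedEntry n)) (γ : Composition n) :
    IsStandardization S T ∧ IsPacked T ∧ weightComposition T = γ ↔
      ∀ b, IsAllowed γ S b (T b) := by
  rw [packed_iff]
  constructor
  · rintro ⟨h1, h2⟩
    exact h1.isAllowed hS ((weight_eq_iff hS.bijective h1.le γ).1 h2)
  · intro h
    have h1 := isStandardization_of_isAllowed hS h
    exact ⟨h1, (weight_eq_iff hS.bijective h1.le γ).2 fun b => (h b).1⟩

open scoped Classical in
theorem card_marked {v : ℕ} (hv : v ∈ Finset.Icc 1 n) (p q : Prop) [Decidable p]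
    [Decidable q] :
    (Finset.univ.filter fun x : MarkedEntry n =>
      x.val = v ∧ (p → x.IsMarked) ∧ (q → ¬ x.IsMarked)).card =
      if p ∧ q then 0 else if p ∨ q then 1 else 2 := by
  have h : (Finset.univ.filter fun x : MarkedEntry n =>
      x.val = v ∧ (p → x.IsMarked) ∧ (q → ¬ x.IsMarked)) =
      ((Finset.univ.filter fun m : Bool => (p → m = false) ∧ (q → m = true)).image
        fun m => (toLex (⟨v, hv⟩, m) : MarkedEntry n)) := by
    ext x
    simp only [Finset.mem_filter, Finset.mem_univ, true_and, Finset.mem_image]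
    constructor
    · rintro ⟨rfl, h1, h2⟩
      exact ⟨(ofLex x).2, ⟨h1, fun hq => by simpa [MarkedEntry.IsMarked] using h2 hq⟩, rfl⟩
    · rintro ⟨m, ⟨h1, h2⟩, rfl⟩
      refine ⟨rfl, h1, fun hq => ?_⟩
      have := h2 hq
      subst this
      simp [MarkedEntry.IsMarked]
  rw [h, Finset.card_image_of_injective]
  · by_cases hp : p <;> by_cases hq : q <;> simp [hp, hq, Finset.filter_eq']
  · intro m m' h
    simpa using h

open scoped Classical in
theorem card_allowed (γ : Composition n) (S : Filling α (Entry n)) (b : Box α) :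
    (Finset.univ.filter (IsAllowed γ S b)).card =
      if (S b : ℕ) ∈ descentAbove S \ partialSums γ ∧
        (S b : ℕ) - 1 ∈ Finset.Icc 1 (n - 1) \ (descentAbove S ∪ partialSums γ) then 0
      else if (S b : ℕ) ∈ descentAbove S \ partialSums γ ∨
        (S b : ℕ) - 1 ∈ Finset.Icc 1 (n - 1) \ (descentAbove S ∪ partialSums γ) then 1
      else 2 := by
  convert card_marked (blockIndex_mem γ S b) ((S b : ℕ) ∈ descentAbove S \ partialSums γ)
    ((S b : ℕ) - 1 ∈ Finset.Icc 1 (n - 1) \ (descentAbove S ∪ partialSums γ)) using 2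
  ext x
  simp only [Finset.mem_filter, IsAllowed]

/-- Each constrained box has one choice and contributes a compensating factor `2`; each free box has
two choices. -/
theorem prod_mul_two_pow {B : Type*} [Fintype B] (p q : B → Prop) [DecidablePred p]
    [DecidablePred q] (h : ∀ b, ¬ (p b ∧ q b)) :
    (∏ b, if p b ∧ q b then 0 else if p b ∨ q b then 1 else 2) *
      2 ^ ((Finset.univ.filter p).card + (Finset.univ.filter q).card) = 2 ^ Fintype.card B := by
  rw [pow_add, Finset.card_filter, Finset.card_filter, ← Finset.prod_pow_eq_pow_sum,
    ← Finset.prod_pow_eq_pow_sum, ← Finset.prod_mul_distrib, ← Finset.prod_mul_distrib,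
    Finset.prod_congr rfl (g := fun _ => 2), Finset.prod_const, Finset.card_univ]
  intro b _
  have := h b
  by_cases hp : p b <;> by_cases hq : q b <;> simp_all

-- The conditions in `IsAllowed` are independent from box to box, so the count is a product. A box
-- constrained in both ways holds a peak `p` with `p` and `p - 1` outside `set(γ)`; otherwise the
-- number of free boxes is the length of `γ`.
open scoped Classical in
theorem card_standardization (hn : 0 < n) {S : Filling α (Entry n)} (hS : IsRowStandard S)
    (γ : Composition n) :
    (Finset.univ.filter fun T : Filling α (MarkedEntry n) =>
      IsStandardization S T ∧ IsPacked T ∧ weightComposition T = γ).card =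
      if ∀ p ∈ peakSet (descentAbove S), p ∈ partialSums γ ∨ p - 1 ∈ partialSums γ
        then 2 ^ γ.length else 0 := by
  set D := descentAbove S with hD
  set G := partialSums γ with hG
  set X := D \ G with hX
  set Y := Finset.Icc 1 (n - 1) \ (D ∪ G) with hY
  have hDn : D ⊆ Finset.Icc 1 (n - 1) := Finset.filter_subset _ _
  have hGn : G ⊆ Finset.Icc 1 (n - 1) := fun x hx => by
    have := mem_partialSums.1 hx
    rw [Finset.mem_Icc]
    omega
  have hpi : (Finset.univ.filter fun T : Filling α (MarkedEntry n) =>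
      IsStandardization S T ∧ IsPacked T ∧ weightComposition T = γ) =
      Fintype.piFinset fun b => Finset.univ.filter (IsAllowed γ S b) := by
    ext T
    simp only [Finset.mem_filter, Finset.mem_univ, true_and, Fintype.mem_piFinset]
    exact isStandardization_packed_iff hS T γ
  rw [hpi, Fintype.card_piFinset]
  simp only [card_allowed]
  split_ifs with hp
  · have hno : ∀ b, ¬ ((S b : ℕ) ∈ X ∧ (S b : ℕ) - 1 ∈ Y) := by
      rintro b ⟨h1, h2⟩
      simp only [hX, hY, Finset.mem_sdiff, Finset.mem_union, Finset.mem_Icc, not_or] at h1 h2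
      have := hp (S b) (Finset.mem_filter.2 ⟨h1.1, h2.2.1, by omega⟩)
      tauto
    have hXn : X ⊆ Finset.Icc 1 n := fun x hx => by
      have := Finset.mem_Icc.1 (hDn (Finset.mem_sdiff.1 hx).1)
      rw [Finset.mem_Icc]
      omega
    have hYn : Y.image (· + 1) ⊆ Finset.Icc 1 n := fun x hx => by
      obtain ⟨y, hy, rfl⟩ := Finset.mem_image.1 hx
      have := Finset.mem_Icc.1 (Finset.mem_sdiff.1 hy).1
      rw [Finset.mem_Icc]
      omega
    have hcY : ∀ b, (S b : ℕ) ∈ Y.image (· + 1) ↔ (S b : ℕ) - 1 ∈ Y := by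
      intro b
      have := (Finset.mem_Icc.1 (S b).2).1
      rw [Finset.mem_image]
      constructor
      · rintro ⟨y, hy, h⟩
        rwa [← h, Nat.add_sub_cancel]
      · exact fun h => ⟨_, h, by omega⟩
    have h1 := card_entry_mem hS.bijective hXn
    have h2 := card_entry_mem hS.bijective hYn
    simp only [hcY] at h2
    rw [Finset.card_image_of_injective _ (add_left_injective 1)] at h2
    have h3 := prod_mul_two_pow (fun b : Box α => (S b : ℕ) ∈ X) (fun b => (S b : ℕ) - 1 ∈ Y) hno
    rw [h1, h2, card_box] at h3
    -- Each `i < n` is a block end or forces exactly one mark: that of `i` if it is a descent, that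
    -- of `i + 1` if not.
    have h4 : X.card + Y.card + G.card = n - 1 := by
      rw [← Finset.card_union_of_disjoint, ← Finset.card_union_of_disjoint]
      · have : X ∪ Y ∪ G = Finset.Icc 1 (n - 1) := by
          ext x
          have h5 := @hDn x
          have h6 := @hGn x
          simp only [hX, hY, Finset.mem_union, Finset.mem_sdiff]
          tauto
        rw [this, Nat.card_Icc, Nat.add_sub_cancel]
      · rw [Finset.disjoint_left]
        intro x
        simp only [hX, hY, Finset.mem_union, Finset.mem_sdiff]
        tauto
      · rw [Finset.disjoint_left]
        intro x
        simp only [hX, hY, Finset.mem_union, Finset.mem_sdiff]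
        tauto
    have h5 := card_partialSums hn γ
    rw [← hG] at h5
    have h6 : n = γ.length + (X.card + Y.card) := by omega
    refine Nat.eq_of_mul_eq_mul_right (pow_pos two_pos (X.card + Y.card)) ?_
    rw [← pow_add, ← h6]
    exact h3
  · push Not at hp
    obtain ⟨p, hp1, hp2, hp3⟩ := hp
    have hp1 := Finset.mem_filter.1 hp1
    have hpn := Finset.mem_Icc.1 (hDn hp1.1)
    obtain ⟨b, hb⟩ := exists_entry hS.bijective.2 (show p - 1 < n by omega)
    have hbp : (S b : ℕ) = p := by omega
    refine Finset.prod_eq_zero (Finset.mem_univ b) (if_pos ?_)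
    rw [hbp, Finset.mem_sdiff, Finset.mem_sdiff, Finset.mem_Icc, Finset.mem_union]
    refine ⟨⟨hp1.1, hp2⟩, by omega, ?_⟩
    tauto

open scoped Classical in
/-- The quasisymmetric Schur `Q`-function as a sum of peak functions. -/
theorem schurQ_eq (hn : 0 < n) (α : Composition n) :
    schurQ α = ∑ S : Filling α (Entry n) with IsSPIT S,
      peakFunction (compOfSet n (peakSet (descentAbove S))) := by
  -- Each `T` is counted once, at its unique standardization, which transfers the tableau axioms to
  -- `IsSPIT`.
  have h1 : ∀ T : Filling α (MarkedEntry n),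
      (if IsMPCT T ∧ IsPacked T then monomialQS (weightComposition T) else 0) =
        ∑ S : Filling α (Entry n), if IsSPIT S ∧ IsStandardization S T ∧ IsPacked T
          then monomialQS (weightComposition T) else 0 := by
    intro T
    obtain ⟨S, hS, huniq⟩ := existsUnique_standardization T
    rw [Finset.sum_eq_single S]
    · have : IsMPCT T ↔ IsSPIT S := ⟨hS.isSPIT, hS.isMPCT⟩
      simp only [this, hS, true_and]
    · intro S' _ hS'
      rw [if_neg]
      exact fun h => hS' (huniq S' h.2.1)
    · exact fun h => absurd (Finset.mem_univ S) h
  rw [schurQ, Finset.sum_filter, Finset.sum_congr rfl fun T _ => h1 T, Finset.sum_comm,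
    Finset.sum_filter]
  refine Finset.sum_congr rfl fun S _ => ?_
  split_ifs with hS
  · rw [peakFunction_compOfSet hn (show descentAbove S ⊆ _ from Finset.filter_subset _ _)]
    have h2 : ∀ T : Filling α (MarkedEntry n),
        (if IsSPIT S ∧ IsStandardization S T ∧ IsPacked T
          then monomialQS (weightComposition T) else 0) =
        ∑ γ : Composition n, if IsStandardization S T ∧ IsPacked T ∧ weightComposition T = γ
          then monomialQS γ else 0 := by
      intro T
      rw [Finset.sum_eq_single (weightComposition T)]
      · simp [hS]
      · intro γ _ hγ
        rw [if_neg]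
        exact fun h => hγ h.2.2.symm
      · exact fun h => absurd (Finset.mem_univ _) h
    rw [Finset.sum_congr rfl fun T _ => h2 T, Finset.sum_comm]
    refine Finset.sum_congr rfl fun γ _ => ?_
    rw [← Finset.sum_filter, Finset.sum_const, card_standardization hn hS.toIsRowStandard,
      ← Nat.cast_smul_eq_nsmul ℂ]
    congr 1
    split_ifs <;> simp
  · exact Finset.sum_eq_zero fun T _ => if_neg fun h => hS h.1

end

section
/-! ### The expansion -/

variable {n : ℕ}

theorem sum_stripSizes (e : List ℕ) : (stripSizes e).sum = e.length := by
  induction e with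
  | nil => rfl
  | cons d e ih =>
    rw [stripSizes, List.length_cons]
    split_ifs
    · rw [List.sum_cons, ih, add_comm]
    · rw [sum_lengthen _ _ (Nat.zero_le _), ih]

/-- The pairs of a column word of a recording tableau and a column word of a standard peak Young
composition tableau, sorted by their common shape. -/
noncomputable def shapeEquiv (α : Composition n) :
    (Σ β : {β : Composition n // IsPeak β}, {u : List ℕ // IsYoungWord u ∧ columnShape u = β.1.blocks} ×
      {e : List ℕ // IsColumnWord β.1.blocks e ∧ stripSizes e = α.blocks}) ≃
      {p : List ℕ × List ℕ // IsYoungWord p.2 ∧ IsColumnWord (columnShape p.2) p.1 ∧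
        stripSizes p.1 = α.blocks} :=
  Equiv.ofBijective (fun x => ⟨(x.2.2.1, x.2.1.1), x.2.1.2.1, by
    rw [x.2.1.2.2]
    exact x.2.2.2⟩) (by
    constructor
    · rintro ⟨⟨β, hβ⟩, ⟨u, hu⟩, ⟨e, he⟩⟩ ⟨⟨β', hβ'⟩, ⟨u', hu'⟩, ⟨e', he'⟩⟩ h
      simp only [Subtype.mk.injEq, Prod.mk.injEq] at h
      obtain ⟨rfl, rfl⟩ := h
      have : β = β' := Composition.ext (hu.2.symm.trans hu'.2)
      subst this
      rfl
    · rintro ⟨⟨e, u⟩, hu, he, hs⟩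
      have h0 := hu.zero_notMem
      have hsum : (columnShape u).sum = n := by
        rw [he.sum_eq h0, ← sum_stripSizes e, hs, α.blocks_sum]
      exact ⟨⟨⟨⟨columnShape u, fun {i} hi => Nat.pos_of_ne_zero fun h => h0 (h ▸ hi), hsum⟩,
        hu.dropLast⟩, ⟨u, hu, rfl⟩, ⟨e, he, hs⟩⟩, rfl⟩)

/-- Insertion as a bijection between tableaux. -/
noncomputable def tableauEquiv (α : Composition n) :
    {S : Filling α (Entry n) // IsSPIT S} ≃
      Σ β : {β : Composition n // IsPeak β}, {U : Filling β.1 (Entry n) // IsSPYCT U} ×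
        {Q : Filling β.1 (Entry n) // IsDIRT Q ∧ HasRowStripShape Q α.reverse} :=
  (((spitEquiv α).trans (insertEquiv α.blocks)).trans (shapeEquiv α).symm).trans
    (Equiv.sigmaCongrRight fun β => Equiv.prodCongr (spyctEquiv β.1).symm (dirtEquiv α β.1).symm)

theorem descentLeft_tableauEquiv (α : Composition n) (S : {S : Filling α (Entry n) // IsSPIT S}) :
    descentLeft (tableauEquiv α S).2.1.1 = descentAbove S.1 := by
  -- Starting from the pair `x` lets the inverse equivalences cancel, so that the words of both
  -- tableaux appear directly.
  obtain ⟨x, rfl⟩ := (tableauEquiv α).symm.surjective S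
  rw [Equiv.apply_symm_apply, descentLeft_eq x.2.1.2.bijective,
    descentAbove_eq ((tableauEquiv α).symm x).2.bijective]
  have h2 := insertEquiv_snd α.blocks (spitEquiv α ((tableauEquiv α).symm x))
  have h3 : insertEquiv α.blocks (spitEquiv α ((tableauEquiv α).symm x)) =
      shapeEquiv α ⟨x.1, spyctEquiv x.1.1 x.2.1, dirtEquiv α x.1.1 x.2.2⟩ := by
    simp only [tableauEquiv, Equiv.symm_trans_apply, Equiv.symm_symm, Equiv.apply_symm_apply]
    rfl
  rw [h3] at h2
  exact h2

end

end PeakExpansion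

/-! ### Assembly of the expansion -/

theorem mainTheorem1 {n : ℕ} (hn : 0 < n) (α : Composition n) (hα : PeakExpansion.IsPeak α) :
    PeakExpansion.schurQ α =
      ∑ β : Composition n with PeakExpansion.IsPeak β,
        (PeakExpansion.dirtCount α β : ℂ) • PeakExpansion.peakYoungSchur β := by
  classical
  -- The coefficient becomes a sum over recording tableaux of a term that does not depend on them,
  -- so each product is a sum over pairs `(U, Q)`.
  have h1 : ∀ β : Composition n,
      (PeakExpansion.dirtCount α β : ℂ) • PeakExpansion.peakYoungSchur β =
        ∑ x : {U : PeakExpansion.Filling β (PeakExpansion.Entry n) // PeakExpansion.IsSPYCT U} ×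
          {Q : PeakExpansion.Filling β (PeakExpansion.Entry n) // PeakExpansion.IsDIRT Q ∧
            PeakExpansion.HasRowStripShape Q α.reverse},
          PeakExpansion.peakFunction (PeakExpansion.compOfSet n
            (PeakExpansion.peakSet (PeakExpansion.descentLeft x.1.1))) := by
    intro β
    rw [Fintype.sum_prod_type, PeakExpansion.peakYoungSchur, Finset.smul_sum,
      Finset.sum_subtype (p := PeakExpansion.IsSPYCT) _ (by simp)]
    refine Finset.sum_congr rfl fun U _ => ?_
    dsimp only
    rw [Finset.sum_const, PeakExpansion.dirtCount, Nat.card_eq_fintype_card, Finset.card_univ,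
      Nat.cast_smul_eq_nsmul]
  rw [PeakExpansion.schurQ_eq hn, Finset.sum_subtype (p := PeakExpansion.IsSPIT) _ (by simp),
    Finset.sum_congr rfl fun β _ => h1 β,
    Finset.sum_subtype (p := PeakExpansion.IsPeak) _ (by simp), ← Fintype.sum_sigma']
  refine Fintype.sum_equiv (PeakExpansion.tableauEquiv α) _ _ fun S => ?_
  rw [PeakExpansion.descentLeft_tableauEquiv]
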